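/- Let $H$ be a separable real Hilbert space, let $Q\in\mathcal L(H)$ be symmetric, strictly positive and of finite trace, with an orthonormal basis of eigenvectors $Qe_k=\lambda_k e_k$, and let $\mu$ be the Gaussian measure on $H$ with mean $0$ and covariance $Q$. Write $D_k$ for the derivative in the direction $e_k$. Let $\mathcal E_0(H)$ be the linear span of the real and imaginary parts of the functions $x\mapsto e^{i\langle x,h\rangle}$, $h\in H$. For $\varphi\in\mathcal E_0(H)$ put $$Q^{1/2}D\varphi=\sum_k\lambda_k^{1/2}D_k\varphi\,e_k,\qquad \mathcal L_0\varphi(x)=\tfrac12\operatorname{Tr}[QD^2\varphi(x)]-\tfrac12\langle x,D\varphi(x)\rangle .$$ For $p=1,2$ let $W^{1,p}_0(H,\mu)$ be the domain of the closure, still denoted $Q^{1/2}D$, of $Q^{1/2}D:\mathcal E_0(H)\subset L^p(H,\mu)\to L^p(H,\mu;H)$. Let $W^{2,2}_0(H,\mu)$ be the completion of $\mathcal E_0(H)$ in the norm with square $\int_H\big(\varphi^2+|Q^{1/2}D\varphi|^2+\sum_{h,k}\lambda_h\lambda_k(D_{hk}\varphi)^2\big)\,d\mu$, so that $Q^{1/2}D^2\varphi\,Q^{1/2}$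 is defined for $\varphi \in W^{2,2}_0(H,\mu)$. Let $L_0$, with domain $D(L_0)\subset W^{2,2}_0(H,\mu)$, be the closure of $\mathcal L_0:\mathcal E_0(H)\subset L^2(H,\mu)\to L^2(H,\mu)$. Let $g\in D(L_0)$ be such that $|Q^{1/2}Dg|^{-1}\in L^4(H,\mu)$ (with $1/0=\infty$), and set $$\psi:=\frac{L_0g}{|Q^{1/2}Dg|^2}-\frac{\langle Q^{1/2}D^2g\,Q^{1/2}\cdot Q^{1/2}Dg,\;Q^{1/2}Dg\rangle}{|Q^{1/2}Dg|^4}.$$ Then: (a) the image measure $\mu\circ g^{-1}$ is absolutely continuous with respect to the Lebesgue measure on $\mathbb R$; (b) if $\rho\in W^{1,1}_0(H,\mu)$ is such that $\psi\rho\in L^1(H,\mu)$ and $\dfrac{|Q^{1/2}D\rho|}{|Q^{1/2}Dg|}\in L^1(H,\mu)$, then the signed measure $\rho\mu\circ g^{-1}$, $I\mapsto\int_{g^{-1}(I)}\rho\,d\mu$, is absolutely continuous with respect to the Lebesgue measure on $\mathbb R$. -/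

import Mathlib

open MeasureTheory ProbabilityTheory Filter Topology
open scoped ENNReal RealInnerProductSpace

namespace GaussHilbert

variable {H : Type*} [NormedAddCommGroup H] [InnerProductSpace ℝ H] {ι : Type*}

/-- `μ` is the Gaussian measure on `H` with mean `0` and covariance operator `Q`. -/
def IsCenteredGaussian [CompleteSpace H] [MeasurableSpace H] [BorelSpace H]
    (μ : Measure H) (Q : H →L[ℝ] H) : Prop :=
  IsGaussian μ ∧ ∫ x, x ∂μ = 0 ∧ ∀ x y : H, covarianceBilin μ x y = ⟪Q x, y⟫

/-- The space `ℰ₀(H)`: the linear span of the real and imaginary parts of the functions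
`x ↦ exp (i ⟨x, h⟩)`, with `h ∈ H`. -/
def expSpace (H : Type*) [NormedAddCommGroup H] [InnerProductSpace ℝ H] :
    Submodule ℝ (H → ℝ) :=
  Submodule.span ℝ
    (Set.range (fun (h x : H) => (Complex.exp (Complex.I * ((⟪x, h⟫ : ℝ) : ℂ))).re) ∪
      Set.range (fun (h x : H) => (Complex.exp (Complex.I * ((⟪x, h⟫ : ℝ) : ℂ))).im))

/-- `Q^{1/2} D φ = ∑ₖ λₖ^{1/2} (Dₖ φ) eₖ`, for a smooth function `φ`, where `e` is an
orthonormal basis of eigenvectors of `Q` with eigenvalues `lam`. -/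
noncomputable def smoothGrad (e : HilbertBasis ι ℝ H) (lam : ι → ℝ) (φ : H → ℝ) (x : H) : H :=
  ∑' k, (Real.sqrt (lam k) * fderiv ℝ φ x (e k)) • e k

/-- The entry `⟨Q^{1/2} D²φ(x) Q^{1/2} e_h, e_k⟩ = λ_h^{1/2} λ_k^{1/2} D_{hk} φ(x)`, for a smooth
function `φ`. -/
noncomputable def smoothHess (e : HilbertBasis ι ℝ H) (lam : ι → ℝ) (φ : H → ℝ) (x : H)
    (h k : ι) : ℝ :=
  Real.sqrt (lam h) * Real.sqrt (lam k) * fderiv ℝ (fderiv ℝ φ) x (e h) (e k)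

/-- `𝓛₀ φ(x) = ½ Tr[Q D²φ(x)] - ½ ⟨x, Dφ(x)⟩`, for a smooth function `φ`. -/
noncomputable def smoothL (e : HilbertBasis ι ℝ H) (lam : ι → ℝ) (φ : H → ℝ) (x : H) : ℝ :=
  (1 / 2) * ∑' k, lam k * fderiv ℝ (fderiv ℝ φ) x (e k) (e k) - (1 / 2) * fderiv ℝ φ x x

variable [MeasurableSpace H]

/-- `(f, F)` is in the graph of the closure of
`Q^{1/2} D : ℰ₀(H) ⊆ Lᵖ(H, μ) → Lᵖ(H, μ; H)`. -/
def IsGrad (μ : Measure H) (e : HilbertBasis ι ℝ H) (lam : ι → ℝ) (p : ℝ≥0∞)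
    (f : H → ℝ) (F : H → H) : Prop :=
  MemLp f p μ ∧ MemLp F p μ ∧ ∃ φ : ℕ → H → ℝ, (∀ n, φ n ∈ expSpace H) ∧
    Tendsto (fun n => eLpNorm (fun x => φ n x - f x) p μ) atTop (𝓝 0) ∧
    Tendsto (fun n => eLpNorm (fun x => smoothGrad e lam (φ n) x - F x) p μ) atTop (𝓝 0)

/-- `f ∈ W₀^{1,p}(H, μ)`. -/
def MemW1 (μ : Measure H) (e : HilbertBasis ι ℝ H) (lam : ι → ℝ) (p : ℝ≥0∞)
    (f : H → ℝ) : Prop :=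
  ∃ F, IsGrad μ e lam p f F

open Classical in
/-- `Q^{1/2} D f` for `f ∈ W₀^{1,p}(H, μ)` (unique up to null sets, since `Q^{1/2} D` is closable);
the value is `0` for other `f`. -/
noncomputable def grad (μ : Measure H) (e : HilbertBasis ι ℝ H) (lam : ι → ℝ) (p : ℝ≥0∞)
    (f : H → ℝ) : H → H :=
  if hf : MemW1 μ e lam p f then hf.choose else 0

/-- `f ∈ W₀^{2,2}(H, μ)` with `B = Q^{1/2} D²f Q^{1/2}`: there is a sequence in `ℰ₀(H)` that
converges to `f` in `L²`, whose `Q^{1/2} D` converge in `L²(H, μ; H)`, and whose second derivatives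
`Q^{1/2} D² Q^{1/2}` converge to `B` in `L²` with respect to the Hilbert-Schmidt norm. -/
def IsHess (μ : Measure H) (e : HilbertBasis ι ℝ H) (lam : ι → ℝ)
    (f : H → ℝ) (B : H → H →L[ℝ] H) : Prop :=
  MemLp f 2 μ ∧ (∀ h k, AEStronglyMeasurable (fun x => ⟪B x (e h), e k⟫) μ) ∧
  ∃ F : H → H, MemLp F 2 μ ∧ ∃ φ : ℕ → H → ℝ, (∀ n, φ n ∈ expSpace H) ∧
    Tendsto (fun n => eLpNorm (fun x => φ n x - f x) 2 μ) atTop (𝓝 0) ∧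
    Tendsto (fun n => eLpNorm (fun x => smoothGrad e lam (φ n) x - F x) 2 μ) atTop (𝓝 0) ∧
    Tendsto (fun n => ∫⁻ x, ∑' h, ∑' k,
      ENNReal.ofReal ((smoothHess e lam (φ n) x h k - ⟪B x (e h), e k⟫) ^ 2) ∂μ) atTop (𝓝 0)

open Classical in
/-- `Q^{1/2} D²f Q^{1/2}` for `f ∈ W₀^{2,2}(H, μ)` (unique up to null sets); the value is `0` for
other `f`. Every function in the domain of `L₀` is in `W₀^{2,2}(H, μ)`. -/
noncomputable def hess (μ : Measure H) (e : HilbertBasis ι ℝ H) (lam : ι → ℝ)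
    (f : H → ℝ) : H → H →L[ℝ] H :=
  if hf : ∃ B, IsHess μ e lam f B then hf.choose else 0

/-- `(f, u)` is in the graph of `L₀`, the closure of `𝓛₀ : ℰ₀(H) ⊆ L²(H, μ) → L²(H, μ)`. -/
def IsL0 (μ : Measure H) (e : HilbertBasis ι ℝ H) (lam : ι → ℝ) (f u : H → ℝ) : Prop :=
  MemLp f 2 μ ∧ MemLp u 2 μ ∧ ∃ φ : ℕ → H → ℝ, (∀ n, φ n ∈ expSpace H) ∧
    Tendsto (fun n => eLpNorm (fun x => φ n x - f x) 2 μ) atTop (𝓝 0) ∧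
    Tendsto (fun n => eLpNorm (fun x => smoothL e lam (φ n) x - u x) 2 μ) atTop (𝓝 0)

/-- `f ∈ D(L₀)`. -/
def MemDomL0 (μ : Measure H) (e : HilbertBasis ι ℝ H) (lam : ι → ℝ) (f : H → ℝ) : Prop :=
  ∃ u, IsL0 μ e lam f u

open Classical in
/-- `L₀ f` for `f ∈ D(L₀)` (unique up to null sets, since `𝓛₀` is closable); the value is `0` for
other `f`. -/
noncomputable def L0 (μ : Measure H) (e : HilbertBasis ι ℝ H) (lam : ι → ℝ)
    (f : H → ℝ) : H → ℝ :=
  if hf : MemDomL0 μ e lam f then hf.choose else 0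

/-- `ψ = L₀g / |Q^{1/2}Dg|² - ⟨Q^{1/2}D²g Q^{1/2} Q^{1/2}Dg, Q^{1/2}Dg⟩ / |Q^{1/2}Dg|⁴`. -/
noncomputable def psi (μ : Measure H) (e : HilbertBasis ι ℝ H) (lam : ι → ℝ)
    (g : H → ℝ) (x : H) : ℝ :=
  L0 μ e lam g x / ‖grad μ e lam 2 g x‖ ^ 2
    - ⟪hess μ e lam g x (grad μ e lam 2 g x), grad μ e lam 2 g x⟫
        / ‖grad μ e lam 2 g x‖ ^ 4

end GaussHilbert

/-! Write `F = Q^{1/2}Dg`, `B = Q^{1/2}D²g Q^{1/2}`, `R = Q^{1/2}Dρ`. The proof integrates by parts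
along the field `F / |F|²`, which pairs with `F` to give 1. For bounded `φ` with bounded continuous
derivative it yields `∫ φ'(g) ρ dμ = -∫ φ(g) m dμ`, with `m = 2ψρ + ⟨R, F⟩ / |F|²` integrable
(`integral_deriv_comp_mul_eq`). If `A` is Lebesgue null, `φ'` can be taken close to `1_A` for the
image of `|ρ|μ` under `g` and small in `L¹(dt)`. Then `φ` is uniformly small and the integral of `ρ`
over `g⁻¹(A)` vanishes (`setIntegral_preimage_eq_zero`). Part (a) is the case `ρ = 1`: there `ψ ∈
L¹`, because `L₀g`, the norm of `B` and `|F|⁻²` are all in `L²`.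

Formally, the formula is `∫ ⟨Q^{1/2}Dw, F⟩ dμ = -∫ 2 w L₀g dμ` for `w = φ(g) |F|⁻² ρ`. On `ℰ₀(H)`
this duality, and the energy identity for `∫ (2𝓛₀φ)² dμ`, are explicit Gaussian integrals of pairs
of cosines. The energy identity shows that the domain of `L₀` lies in `W₀^{2,2}`, and the duality
passes to the closure (`exists_isHess_of_isL0`).

The test function `w` is reached in stages. Products and compositions of elements of `ℰ₀(H)` are
uniform limits from `ℰ₀(H)` together with their gradients (`UnifGrad`). With `1/s` replaced by a
decaying `κ(s)` and `ρ` by a bounded `T(ρ)`, limits are taken in the approximation of `g`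
(`integral_eq_zero_of_unifGrad`), in that of `ρ` (`integral_eq_zero_of_isGrad_one`), in `κ(s) → 1/s`
(`integral_eq_zero_of_bounded`), and finally in `T(ρ) → ρ`. -/

namespace GaussHilbert

/-! ### The operator `Q^{1/2}` and coordinate-free forms of the derivatives. -/

section Diagonal

variable {H : Type*} [NormedAddCommGroup H] [InnerProductSpace ℝ H] {ι : Type*}

/-- `S` is the operator `Q^{1/2}`, diagonal in the basis `e`. -/
def IsDiagSqrt (e : HilbertBasis ι ℝ H) (lam : ι → ℝ) (S : H →L[ℝ] H) : Prop :=
  ∀ k, S (e k) = Real.sqrt (lam k) • e k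

variable {e : HilbertBasis ι ℝ H} {lam : ι → ℝ}

/-- Multiplication by the bounded sequence `√λ_k` on `ℓ²`, transported to `H` by the basis. -/
theorem exists_isDiagSqrt [CompleteSpace H] (e : HilbertBasis ι ℝ H) (hsum : Summable lam)
    (hpos : ∀ k, 0 ≤ lam k) : ∃ S : H →L[ℝ] H, IsDiagSqrt e lam S := by
  classical
  set C : ℝ := Real.sqrt (∑' k, lam k) with hC
  have hle : ∀ k, Real.sqrt (lam k) ≤ C := fun k =>
    Real.sqrt_le_sqrt (hsum.le_tsum k (fun j _ => hpos j))
  have hC0 : 0 ≤ C := Real.sqrt_nonneg _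
  have hbound : ∀ (v : lp (fun _ : ι => ℝ) 2) k, ‖Real.sqrt (lam k) * v k‖ ≤ C * ‖v k‖ := by
    intro v k
    rw [norm_mul, Real.norm_of_nonneg (Real.sqrt_nonneg _)]
    exact mul_le_mul_of_nonneg_right (hle k) (norm_nonneg _)
  have hmem : ∀ v : lp (fun _ : ι => ℝ) 2, Memℓp (fun k => Real.sqrt (lam k) * v k) 2 := by
    intro v
    exact ((lp.memℓp v).norm.const_mul C).mono (hbound v)
  let T : lp (fun _ : ι => ℝ) 2 →ₗ[ℝ] lp (fun _ : ι => ℝ) 2 :=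
    { toFun := fun v => ⟨fun k => Real.sqrt (lam k) * v k, hmem v⟩
      map_add' := fun v w => by ext k; exact mul_add _ _ _
      map_smul' := fun c v => by ext k; exact mul_left_comm _ _ _ }
  have hT : ∀ v, ‖T v‖ ≤ C * ‖v‖ := by
    intro v
    have : ‖T v‖ ≤ ‖C • v‖ := by
      refine lp.norm_mono (by norm_num) fun k => ?_
      simpa [T, abs_of_nonneg hC0] using hbound v k
    simpa [norm_smul, abs_of_nonneg hC0] using this
  let T' := T.mkContinuous C hT
  refine ⟨(e.repr.symm.toContinuousLinearEquiv : lp (fun _ : ι => ℝ) 2 →L[ℝ] H) ∘L T' ∘L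
    (e.repr.toContinuousLinearEquiv : H →L[ℝ] lp (fun _ : ι => ℝ) 2), fun k => ?_⟩
  have : T (lp.single 2 k (1 : ℝ)) = Real.sqrt (lam k) • lp.single 2 k (1 : ℝ) := by
    ext j
    by_cases hj : j = k
    · subst hj; simp [T]
    · simp [T, hj]
  simp only [ContinuousLinearMap.comp_apply, ContinuousLinearEquiv.coe_coe,
    LinearIsometryEquiv.coe_toContinuousLinearEquiv, e.repr_self]
  change e.repr.symm (T _) = _
  rw [this, map_smul, e.repr_symm_single]

variable {S : H →L[ℝ] H}

theorem HilbertBasis.ext_inner (e : HilbertBasis ι ℝ H) {x y : H}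
    (h : ∀ k, ⟪e k, x⟫ = ⟪e k, y⟫) : x = y :=
  e.repr.injective (by ext k; simpa [e.repr_apply_apply] using h k)

theorem HilbertBasis.ext_clm {F : Type*} [TopologicalSpace F] [T2Space F] [AddCommMonoid F]
    [Module ℝ F] (e : HilbertBasis ι ℝ H) {A B : H →L[ℝ] F} (h : ∀ k, A (e k) = B (e k)) :
    A = B := by
  refine ContinuousLinearMap.ext_on (s := Set.range e) ?_ ?_
  · rw [Submodule.dense_iff_topologicalClosure_eq_top]
    exact e.dense_span
  · rintro _ ⟨k, rfl⟩; exact h k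

/-- Both sides are continuous and linear in `v`, so basis vectors suffice. Self-adjointness of `S`
follows from this by Parseval. -/
theorem IsDiagSqrt.inner_basis (hS : IsDiagSqrt e lam S) (k : ι) (v : H) :
    ⟪e k, S v⟫ = Real.sqrt (lam k) * ⟪e k, v⟫ := by
  have : innerSL ℝ (e k) ∘L S = Real.sqrt (lam k) • innerSL ℝ (e k) := by
    refine HilbertBasis.ext_clm e fun j => ?_
    classical
    simp only [ContinuousLinearMap.comp_apply, innerSL_apply_apply, hS j, inner_smul_right,
      smul_apply, smul_eq_mul, orthonormal_iff_ite.1 e.orthonormal]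
    split_ifs with hkj
    · rw [hkj]
    · simp
  simpa using congrArg (fun A : H →L[ℝ] ℝ => A v) this

theorem IsDiagSqrt.symm (hS : IsDiagSqrt e lam S) (v w : H) : ⟪S v, w⟫ = ⟪v, S w⟫ := by
  have h1 := e.hasSum_inner_mul_inner (S v) w
  have h2 := e.hasSum_inner_mul_inner v (S w)
  refine h1.unique (h2.congr_fun ?_)
  intro k
  rw [real_inner_comm, hS.inner_basis, hS.inner_basis, real_inner_comm v]
  ring

theorem IsDiagSqrt.inner_inner (hS : IsDiagSqrt e lam S) (hpos : ∀ k, 0 ≤ lam k) {Q : H →L[ℝ] H}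
    (hQe : ∀ k, Q (e k) = lam k • e k) (v w : H) : ⟪S v, S w⟫ = ⟪Q v, w⟫ := by
  have : S ∘L S = Q := by
    refine HilbertBasis.ext_clm e fun j => ?_
    simp [hS j, hQe j, smul_smul, Real.mul_self_sqrt (hpos j)]
  rw [← this, ContinuousLinearMap.comp_apply, hS.symm (S v) w]

/-- Replaces the series by an operator applied to a Riesz representative, so that the rules of
calculus apply without any summation. -/
theorem smoothGrad_eq [CompleteSpace H] (hS : IsDiagSqrt e lam S) (φ : H → ℝ) (x : H) :
    smoothGrad e lam φ x = S ((InnerProductSpace.toDual ℝ H).symm (fderiv ℝ φ x)) := by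
  set v := (InnerProductSpace.toDual ℝ H).symm (fderiv ℝ φ x)
  have h := e.hasSum_repr (S v)
  unfold smoothGrad
  rw [← h.tsum_eq]
  congr 1; ext1 k
  rw [e.repr_apply_apply, hS.inner_basis, real_inner_comm,
    InnerProductSpace.toDual_symm_apply]

theorem inner_smoothGrad [CompleteSpace H] (hS : IsDiagSqrt e lam S) (φ : H → ℝ) (x v : H) :
    ⟪smoothGrad e lam φ x, v⟫ = fderiv ℝ φ x (S v) := by
  rw [smoothGrad_eq hS, hS.symm, InnerProductSpace.toDual_symm_apply]

theorem smoothHess_eq (hS : IsDiagSqrt e lam S) (φ : H → ℝ) (x : H) (h k : ι) :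
    smoothHess e lam φ x h k = fderiv ℝ (fderiv ℝ φ) x (S (e h)) (S (e k)) := by
  simp [smoothHess, hS h, hS k]; ring

/-- The operator that represents a bounded bilinear form. -/
noncomputable def opOfBilin [CompleteSpace H] (b : H →L[ℝ] H →L[ℝ] ℝ) : H →L[ℝ] H :=
  LinearMap.mkContinuous
    { toFun := fun v => (InnerProductSpace.toDual ℝ H).symm (b v)
      map_add' := fun v w => by simp
      map_smul' := fun c v => by simp } ‖b‖ fun v => by simpa using b.le_opNorm v

theorem inner_opOfBilin [CompleteSpace H] (b : H →L[ℝ] H →L[ℝ] ℝ) (v w : H) :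
    ⟪opOfBilin b v, w⟫ = b v w :=
  InnerProductSpace.toDual_symm_apply (E := H)

/-- The operator `Q^{1/2} D²φ(x) Q^{1/2}` for a smooth function `φ`, with `S = Q^{1/2}`. -/
noncomputable def hessOp [CompleteSpace H] (S : H →L[ℝ] H) (φ : H → ℝ) (x : H) : H →L[ℝ] H :=
  S ∘L opOfBilin (fderiv ℝ (fderiv ℝ φ) x) ∘L S

theorem inner_hessOp [CompleteSpace H] (hS : IsDiagSqrt e lam S) (φ : H → ℝ) (x v w : H) :
    ⟪hessOp S φ x v, w⟫ = fderiv ℝ (fderiv ℝ φ) x (S v) (S w) := by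
  rw [hessOp, ContinuousLinearMap.comp_apply, hS.symm, ContinuousLinearMap.comp_apply,
    inner_opOfBilin]

end Diagonal

/-! ### Calculus of cosines with phases. -/

section Trig

variable {H : Type*} [NormedAddCommGroup H] [InnerProductSpace ℝ H]

/-- The function `x ↦ cos (⟨x, h⟩ + a)`. -/
noncomputable def cosf (h : H) (a : ℝ) (x : H) : ℝ := Real.cos (⟪x, h⟫ + a)

theorem cosf_mem (h : H) (a : ℝ) : cosf h a ∈ expSpace H := by
  have : cosf h a = Real.cos a • (fun x : H => (Complex.exp (Complex.I * ((⟪x, h⟫ : ℝ) : ℂ))).re)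
      + (-Real.sin a) • (fun x : H => (Complex.exp (Complex.I * ((⟪x, h⟫ : ℝ) : ℂ))).im) := by
    ext x
    simp [cosf, Complex.exp_re, Complex.exp_im, Real.cos_add]
    ring
  rw [this]
  refine Submodule.add_mem _ (Submodule.smul_mem _ _ (Submodule.subset_span (Or.inl ⟨h, rfl⟩)))
    (Submodule.smul_mem _ _ (Submodule.subset_span (Or.inr ⟨h, rfl⟩)))

/-- Finite linear combinations of the functions `cosf`. -/
noncomputable def trigSum {n : ℕ} (r : Fin n → ℝ) (h : Fin n → H) (a : Fin n → ℝ) (x : H) : ℝ :=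
  ∑ i, r i * cosf (h i) (a i) x

/-- A sine is a cosine with phase `-π/2`. Cosines with phases are stable under differentiation,
which shifts the phase by `π/2`, so claims on `ℰ₀(H)` reduce to one cosine or a pair. -/
theorem exists_trigSum {φ : H → ℝ} (hφ : φ ∈ expSpace H) :
    ∃ (n : ℕ) (r : Fin n → ℝ) (h : Fin n → H) (a : Fin n → ℝ), φ = trigSum r h a := by
  obtain ⟨n, r, g, rfl⟩ := Submodule.mem_span_set'.1 hφ
  have : ∀ i, ∃ (h : H) (a : ℝ), (g i : H → ℝ) = cosf h a := by
    intro i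
    rcases (g i).2 with ⟨h, hh⟩ | ⟨h, hh⟩
    · refine ⟨h, 0, ?_⟩
      rw [← hh]; ext x; simp [cosf, Complex.exp_re]
    · refine ⟨h, -(Real.pi / 2), ?_⟩
      rw [← hh]; ext x
      simp only [cosf, ← sub_eq_add_neg, Real.cos_sub_pi_div_two]
      simp [Complex.exp_im]
  choose h a ha using this
  refine ⟨n, r, h, a, ?_⟩
  ext x
  simp [trigSum, ha]

theorem sum_mem_expSpace {κ : Type*} (s : Finset κ) {f : κ → H → ℝ}
    (hf : ∀ i ∈ s, f i ∈ expSpace H) : (fun x => ∑ i ∈ s, f i x) ∈ expSpace H := by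
  have := Submodule.sum_mem (expSpace H) hf
  convert this using 1
  ext x; simp

theorem const_mul_mem_expSpace (c : ℝ) {f : H → ℝ} (hf : f ∈ expSpace H) :
    (fun x => c * f x) ∈ expSpace H := Submodule.smul_mem _ c hf

theorem cosf_mul_cosf (h k : H) (a b : ℝ) (x : H) :
    cosf h a x * cosf k b x = (1 / 2) * cosf (h + k) (a + b) x
      + (1 / 2) * cosf (h - k) (a - b) x := by
  simp only [cosf, inner_add_right, inner_sub_right]
  have h1 : ⟪x, h⟫ + ⟪x, k⟫ + (a + b) = (⟪x, h⟫ + a) + (⟪x, k⟫ + b) := by ring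
  have h2 : ⟪x, h⟫ - ⟪x, k⟫ + (a - b) = (⟪x, h⟫ + a) - (⟪x, k⟫ + b) := by ring
  rw [h1, h2, Real.cos_add (⟪x, h⟫ + a), Real.cos_sub]; ring

theorem cosf_mul_mem (h k : H) (a b : ℝ) :
    (fun x => cosf h a x * cosf k b x) ∈ expSpace H := by
  simp_rw [cosf_mul_cosf]
  exact Submodule.add_mem _ (const_mul_mem_expSpace _ (cosf_mem _ _))
    (const_mul_mem_expSpace _ (cosf_mem _ _))

/-- The product-to-sum formula makes `ℰ₀(H)` an algebra; the approximation by polynomials in the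
chain rule relies on this. -/
theorem mul_mem_expSpace {φ ψ : H → ℝ} (hφ : φ ∈ expSpace H) (hψ : ψ ∈ expSpace H) :
    (fun x => φ x * ψ x) ∈ expSpace H := by
  obtain ⟨n, r, h, a, rfl⟩ := exists_trigSum hφ
  obtain ⟨m, s, k, b, rfl⟩ := exists_trigSum hψ
  simp only [trigSum, Finset.sum_mul_sum]
  refine sum_mem_expSpace _ fun i _ => sum_mem_expSpace _ fun j _ => ?_
  have := const_mul_mem_expSpace (r i * s j) (cosf_mul_mem (h i) (k j) (a i) (b j))
  convert this using 2
  ring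

theorem one_mem_expSpace : (fun _ : H => (1 : ℝ)) ∈ expSpace H := by
  have := cosf_mem (0 : H) 0
  convert this using 1
  ext x; simp [cosf]

theorem abs_cosf_le (h : H) (a : ℝ) (x : H) : |cosf h a x| ≤ 1 := Real.abs_cos_le_one _

theorem continuous_cosf (h : H) (a : ℝ) : Continuous (cosf h a) := by
  unfold cosf; fun_prop

theorem cosf_add_pi (h : H) (a : ℝ) (x : H) :
    cosf h (a + Real.pi / 2 + Real.pi / 2) x = - cosf h a x := by
  unfold cosf
  rw [← Real.cos_add_pi]; ring_nf

theorem hasFDerivAt_cosf (h : H) (a : ℝ) (x : H) :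
    HasFDerivAt (cosf h a) (cosf h (a + Real.pi / 2) x • innerSL ℝ h) x := by
  have h1 : HasFDerivAt (fun x : H => ⟪x, h⟫ + a) (innerSL ℝ h) x := by
    have := ((innerSL ℝ h).hasFDerivAt (x := x)).add_const a
    simpa only [innerSL_apply_apply, real_inner_comm] using this
  have h2 := h1.cos
  have h3 : cosf h (a + Real.pi / 2) x = -Real.sin (⟪x, h⟫ + a) := by
    unfold cosf
    rw [← add_assoc, Real.cos_add_pi_div_two]
  rw [h3]
  exact h2

variable {n : ℕ} (r : Fin n → ℝ) (h : Fin n → H) (a : Fin n → ℝ)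

theorem hasFDerivAt_trigSum (x : H) :
    HasFDerivAt (trigSum r h a)
      (∑ i, (r i * cosf (h i) (a i + Real.pi / 2) x) • innerSL ℝ (h i)) x := by
  have := HasFDerivAt.fun_sum (u := Finset.univ)
    (fun i _ => (hasFDerivAt_cosf (h i) (a i) x).const_mul (r i))
  simp only [smul_smul] at this
  exact this

theorem fderiv_trigSum :
    fderiv ℝ (trigSum r h a) =
      fun x => ∑ i, (r i * cosf (h i) (a i + Real.pi / 2) x) • innerSL ℝ (h i) :=
  funext fun x => (hasFDerivAt_trigSum r h a x).fderiv

theorem hasFDerivAt_fderiv_trigSum (x : H) :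
    HasFDerivAt (fderiv ℝ (trigSum r h a))
      (∑ i, (r i * -cosf (h i) (a i) x) • (innerSL ℝ (h i)).smulRight (innerSL ℝ (h i))) x := by
  rw [fderiv_trigSum]
  have := HasFDerivAt.fun_sum (u := Finset.univ)
    (fun i _ => ((hasFDerivAt_cosf (h i) (a i + Real.pi / 2) x).const_mul (r i)).smul_const
      (innerSL ℝ (h i) : H →L[ℝ] ℝ))
  refine this.congr_fderiv ?_
  refine Finset.sum_congr rfl fun i _ => ?_
  ext v w
  simp [cosf_add_pi]
  ring

theorem fderiv_fderiv_trigSum (x v w : H) :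
    fderiv ℝ (fderiv ℝ (trigSum r h a)) x v w =
      ∑ i, r i * -cosf (h i) (a i) x * (⟪h i, v⟫ * ⟪h i, w⟫) := by
  rw [(hasFDerivAt_fderiv_trigSum r h a x).fderiv]
  simp only [sum_apply, smul_apply,
    ContinuousLinearMap.smulRight_apply, smul_eq_mul, innerSL_apply_apply]

variable {ι : Type*} {e : HilbertBasis ι ℝ H} {lam : ι → ℝ} {S : H →L[ℝ] H} [CompleteSpace H]

theorem smoothGrad_trigSum (hS : IsDiagSqrt e lam S) (x : H) :
    smoothGrad e lam (trigSum r h a) x =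
      ∑ i, (r i * cosf (h i) (a i + Real.pi / 2) x) • S (h i) := by
  refine ext_inner_right ℝ fun v => ?_
  rw [inner_smoothGrad hS, fderiv_trigSum]
  simp [sum_inner, inner_smul_left, hS.symm]

theorem hessOp_trigSum (hS : IsDiagSqrt e lam S) (x v : H) :
    hessOp S (trigSum r h a) x v =
      ∑ i, (r i * -cosf (h i) (a i) x * ⟪S (h i), v⟫) • S (h i) := by
  refine ext_inner_right ℝ fun w => ?_
  rw [inner_hessOp hS, fderiv_fderiv_trigSum]
  simp only [sum_inner, inner_smul_left, hS.symm, conj_trivial]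
  exact Finset.sum_congr rfl fun i _ => by ring

omit [CompleteSpace H] in
theorem smoothL_trigSum (hS : IsDiagSqrt e lam S) (hpos : ∀ k, 0 ≤ lam k) (x : H) :
    2 * smoothL e lam (trigSum r h a) x =
      ∑ i, r i * (-cosf (h i) (a i) x * ⟪S (h i), S (h i)⟫
        - cosf (h i) (a i + Real.pi / 2) x * ⟪x, h i⟫) := by
  -- Parseval: each cosine contributes `∑ λ_k ⟨e_k, h⟩² = ‖S h‖²` to the trace.
  have key : HasSum (fun k => lam k * fderiv ℝ (fderiv ℝ (trigSum r h a)) x (e k) (e k))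
      (∑ i, r i * -cosf (h i) (a i) x * ⟪S (h i), S (h i)⟫) := by
    have : ∀ i, HasSum (fun k => r i * -cosf (h i) (a i) x *
        (⟪S (h i), e k⟫ * ⟪e k, S (h i)⟫)) (r i * -cosf (h i) (a i) x * ⟪S (h i), S (h i)⟫) :=
      fun i => (e.hasSum_inner_mul_inner (S (h i)) (S (h i))).mul_left _
    refine (hasSum_sum (s := Finset.univ) fun i _ => this i).congr_fun fun k => ?_
    rw [fderiv_fderiv_trigSum, Finset.mul_sum]
    refine Finset.sum_congr rfl fun i _ => ?_
    rw [real_inner_comm (e k) (S (h i)), hS.inner_basis, real_inner_comm (e k) (h i)]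
    linear_combination (r i * cosf (h i) (a i) x * ⟪e k, h i⟫ ^ 2) *
      Real.mul_self_sqrt (hpos k)
  unfold smoothL
  rw [key.tsum_eq, fderiv_trigSum]
  simp only [sum_apply, smul_apply, smul_eq_mul,
    innerSL_apply_apply]
  rw [← mul_sub, ← mul_assoc, mul_one_div_cancel two_ne_zero, one_mul, ← Finset.sum_sub_distrib]
  refine Finset.sum_congr rfl fun i _ => ?_
  rw [real_inner_comm x (h i)]; ring

omit [CompleteSpace H] in
theorem continuous_trigSum : Continuous (trigSum r h a) := by
  unfold trigSum
  exact continuous_finsetSum _ fun i _ => (continuous_cosf _ _).const_mul _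

end Trig

/-! ### Regularity, bounds and derivative rules on `ℰ₀(H)`. -/

section ExpSpace

variable {H : Type*} [NormedAddCommGroup H] [InnerProductSpace ℝ H]
  {ι : Type*} {e : HilbertBasis ι ℝ H} {lam : ι → ℝ} {S : H →L[ℝ] H} {φ ψ : H → ℝ}

theorem continuous_of_mem_expSpace (hφ : φ ∈ expSpace H) : Continuous φ := by
  obtain ⟨n, r, h, a, rfl⟩ := exists_trigSum hφ
  exact continuous_trigSum r h a

theorem hasFDerivAt_of_mem_expSpace (hφ : φ ∈ expSpace H) (x : H) :
    HasFDerivAt φ (fderiv ℝ φ x) x := by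
  obtain ⟨n, r, h, a, rfl⟩ := exists_trigSum hφ
  exact (hasFDerivAt_trigSum r h a x).differentiableAt.hasFDerivAt

theorem hasFDerivAt_fderiv_of_mem_expSpace (hφ : φ ∈ expSpace H) (x : H) :
    HasFDerivAt (fderiv ℝ φ) (fderiv ℝ (fderiv ℝ φ) x) x := by
  obtain ⟨n, r, h, a, rfl⟩ := exists_trigSum hφ
  exact (hasFDerivAt_fderiv_trigSum r h a x).differentiableAt.hasFDerivAt

theorem bounded_of_mem_expSpace (hφ : φ ∈ expSpace H) : ∃ C, ∀ x, |φ x| ≤ C := by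
  obtain ⟨n, r, h, a, rfl⟩ := exists_trigSum hφ
  refine ⟨∑ i, |r i|, fun x => (Finset.abs_sum_le_sum_abs _ _).trans
    (Finset.sum_le_sum fun i _ => ?_)⟩
  rw [abs_mul]
  exact mul_le_of_le_one_right (abs_nonneg _) (abs_cosf_le _ _ _)

variable [CompleteSpace H]

theorem continuous_smoothGrad (hS : IsDiagSqrt e lam S) (hφ : φ ∈ expSpace H) :
    Continuous (smoothGrad e lam φ) := by
  obtain ⟨n, r, h, a, rfl⟩ := exists_trigSum hφ
  have : smoothGrad e lam (trigSum r h a) = _ := funext (smoothGrad_trigSum r h a hS)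
  rw [this]
  exact continuous_finsetSum _ fun i _ => ((continuous_cosf _ _).const_mul _).smul continuous_const

theorem bounded_smoothGrad (hS : IsDiagSqrt e lam S) (hφ : φ ∈ expSpace H) :
    ∃ C, ∀ x, ‖smoothGrad e lam φ x‖ ≤ C := by
  obtain ⟨n, r, h, a, rfl⟩ := exists_trigSum hφ
  refine ⟨∑ i, |r i| * ‖S (h i)‖, fun x => ?_⟩
  rw [smoothGrad_trigSum r h a hS]
  refine (norm_sum_le _ _).trans (Finset.sum_le_sum fun i _ => ?_)
  rw [norm_smul, norm_mul, Real.norm_eq_abs, Real.norm_eq_abs]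
  refine mul_le_mul_of_nonneg_right ?_ (norm_nonneg _)
  exact mul_le_of_le_one_right (abs_nonneg _) (abs_cosf_le _ _ _)

theorem continuous_hessOp (hS : IsDiagSqrt e lam S) (hφ : φ ∈ expSpace H) (v w : H) :
    Continuous (fun x => ⟪hessOp S φ x v, w⟫) := by
  obtain ⟨n, r, h, a, rfl⟩ := exists_trigSum hφ
  simp_rw [hessOp_trigSum r h a hS, sum_inner, inner_smul_left, conj_trivial]
  exact continuous_finsetSum _ fun i _ =>
    (((continuous_cosf _ _).neg.const_mul _).mul continuous_const).mul continuous_const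

omit [CompleteSpace H] in
-- The drift `⟨x, Dφ⟩` may grow linearly, so the second moment of `μ` is what places `𝓛₀φ` in `L²`.
theorem bounded_smoothL (hS : IsDiagSqrt e lam S) (hpos : ∀ k, 0 ≤ lam k)
    (hφ : φ ∈ expSpace H) : Continuous (smoothL e lam φ) ∧
      ∃ C, ∀ x, |smoothL e lam φ x| ≤ C * (1 + ‖x‖) := by
  obtain ⟨n, r, h, a, rfl⟩ := exists_trigSum hφ
  have key : ∀ x, smoothL e lam (trigSum r h a) x = (1 / 2) *
      ∑ i, r i * (-cosf (h i) (a i) x * ⟪S (h i), S (h i)⟫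
        - cosf (h i) (a i + Real.pi / 2) x * ⟪x, h i⟫) := fun x => by
    rw [← smoothL_trigSum r h a hS hpos]; ring
  constructor
  · rw [funext key]
    refine (continuous_finsetSum _ fun i _ => ?_).const_mul _
    exact (((continuous_cosf _ _).neg.mul continuous_const).sub
      ((continuous_cosf _ _).mul (by fun_prop))).const_mul _
  · refine ⟨∑ i, |r i| * (‖S (h i)‖ ^ 2 + ‖h i‖), fun x => ?_⟩
    rw [key, abs_mul, Finset.sum_mul]
    have h0 : |(1 / 2 : ℝ)| ≤ 1 := by norm_num
    refine (mul_le_of_le_one_left (abs_nonneg _) h0).trans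
      ((Finset.abs_sum_le_sum_abs _ _).trans (Finset.sum_le_sum fun i _ => ?_))
    rw [abs_mul, mul_assoc]
    refine mul_le_mul_of_nonneg_left ?_ (abs_nonneg _)
    refine (abs_sub _ _).trans ?_
    rw [abs_mul, abs_mul, abs_neg, real_inner_self_eq_norm_sq, abs_of_nonneg (sq_nonneg ‖S (h i)‖)]
    have h1 := abs_cosf_le (h i) (a i) x
    have h2 := abs_cosf_le (h i) (a i + Real.pi / 2) x
    have h3 := abs_real_inner_le_norm x (h i)
    have h4 := mul_le_of_le_one_left (sq_nonneg ‖S (h i)‖) h1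
    have h5 := (mul_le_of_le_one_left (abs_nonneg _) h2).trans h3
    nlinarith [norm_nonneg x, norm_nonneg (h i), sq_nonneg ‖S (h i)‖,
      mul_nonneg (norm_nonneg x) (sq_nonneg ‖S (h i)‖)]

theorem smoothGrad_sub (hS : IsDiagSqrt e lam S) (hφ : φ ∈ expSpace H) (hψ : ψ ∈ expSpace H)
    (x : H) : smoothGrad e lam (φ - ψ) x = smoothGrad e lam φ x - smoothGrad e lam ψ x := by
  simp_rw [smoothGrad_eq hS]
  rw [((hasFDerivAt_of_mem_expSpace hφ x).sub (hasFDerivAt_of_mem_expSpace hψ x)).fderiv]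
  simp

omit [CompleteSpace H] in
theorem fderiv_fderiv_sub (hφ : φ ∈ expSpace H) (hψ : ψ ∈ expSpace H) (x : H) :
    fderiv ℝ (fderiv ℝ (φ - ψ)) x = fderiv ℝ (fderiv ℝ φ) x - fderiv ℝ (fderiv ℝ ψ) x := by
  have : fderiv ℝ (φ - ψ) = fderiv ℝ φ - fderiv ℝ ψ := funext fun y =>
    ((hasFDerivAt_of_mem_expSpace hφ y).sub (hasFDerivAt_of_mem_expSpace hψ y)).fderiv
  rw [this]
  exact ((hasFDerivAt_fderiv_of_mem_expSpace hφ x).sub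
    (hasFDerivAt_fderiv_of_mem_expSpace hψ x)).fderiv

omit [CompleteSpace H] in
theorem smoothHess_sub (hφ : φ ∈ expSpace H) (hψ : ψ ∈ expSpace H) (x : H) (h k : ι) :
    smoothHess e lam (φ - ψ) x h k = smoothHess e lam φ x h k - smoothHess e lam ψ x h k := by
  simp only [smoothHess, fderiv_fderiv_sub hφ hψ, sub_apply]; ring

omit [CompleteSpace H] in
theorem summable_trace (hS : IsDiagSqrt e lam S) (hpos : ∀ k, 0 ≤ lam k) (hφ : φ ∈ expSpace H)
    (x : H) : Summable (fun k => lam k * fderiv ℝ (fderiv ℝ φ) x (e k) (e k)) := by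
  obtain ⟨n, r, h, a, rfl⟩ := exists_trigSum hφ
  have : ∀ i, Summable (fun k => r i * -cosf (h i) (a i) x *
      (⟪S (h i), e k⟫ * ⟪e k, S (h i)⟫)) :=
    fun i => (e.hasSum_inner_mul_inner (S (h i)) (S (h i))).summable.mul_left _
  refine (summable_sum (s := Finset.univ) fun i _ => this i).congr fun k => ?_
  rw [fderiv_fderiv_trigSum, Finset.mul_sum]
  refine Finset.sum_congr rfl fun i _ => ?_
  rw [real_inner_comm (e k) (S (h i)), hS.inner_basis, real_inner_comm (e k) (h i)]
  linear_combination (-(r i * cosf (h i) (a i) x * ⟪e k, h i⟫ ^ 2)) *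
    Real.mul_self_sqrt (hpos k)

omit [CompleteSpace H] in
theorem smoothL_sub (hS : IsDiagSqrt e lam S) (hpos : ∀ k, 0 ≤ lam k)
    (hφ : φ ∈ expSpace H) (hψ : ψ ∈ expSpace H) (x : H) :
    smoothL e lam (φ - ψ) x = smoothL e lam φ x - smoothL e lam ψ x := by
  unfold smoothL
  rw [((hasFDerivAt_of_mem_expSpace hφ x).sub (hasFDerivAt_of_mem_expSpace hψ x)).fderiv]
  simp only [fderiv_fderiv_sub hφ hψ, sub_apply, mul_sub]
  rw [(summable_trace hS hpos hφ x).tsum_sub (summable_trace hS hpos hψ x)]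
  ring

/-- In particular `|Q^{1/2}Dφ|²` is again in `ℰ₀(H)`, so the chain rule covers `κ(|Q^{1/2}Dφ|²)`. -/
theorem inner_smoothGrad_mem (hS : IsDiagSqrt e lam S) (hφ : φ ∈ expSpace H)
    (hψ : ψ ∈ expSpace H) :
    (fun x => ⟪smoothGrad e lam φ x, smoothGrad e lam ψ x⟫) ∈ expSpace H := by
  obtain ⟨n, r, h, a, rfl⟩ := exists_trigSum hφ
  obtain ⟨m, s, k, b, rfl⟩ := exists_trigSum hψ
  simp only [smoothGrad_trigSum _ _ _ hS, sum_inner, inner_sum]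
  refine sum_mem_expSpace _ fun j _ => sum_mem_expSpace _ fun i _ => ?_
  have := const_mul_mem_expSpace (r i * s j * ⟪S (h i), S (k j)⟫)
    (cosf_mul_mem (h i) (k j) (a i + Real.pi / 2) (b j + Real.pi / 2))
  convert this using 2
  simp only [inner_smul_left, inner_smul_right, conj_trivial]
  ring

theorem smoothGrad_mul (hS : IsDiagSqrt e lam S) (hφ : φ ∈ expSpace H) (hψ : ψ ∈ expSpace H)
    (x : H) : smoothGrad e lam (fun x => φ x * ψ x) x =
      φ x • smoothGrad e lam ψ x + ψ x • smoothGrad e lam φ x := by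
  simp_rw [smoothGrad_eq hS]
  rw [((hasFDerivAt_of_mem_expSpace hφ x).fun_mul (hasFDerivAt_of_mem_expSpace hψ x)).fderiv]
  simp

/-- The source of the Hessian term in `ψ`. -/
theorem smoothGrad_norm_sq (hS : IsDiagSqrt e lam S) (hφ : φ ∈ expSpace H) (x : H) :
    smoothGrad e lam (fun x => ⟪smoothGrad e lam φ x, smoothGrad e lam φ x⟫) x =
      (2 : ℝ) • hessOp S φ x (smoothGrad e lam φ x) := by
  obtain ⟨n, r, h, a, rfl⟩ := exists_trigSum hφ
  have hD : HasFDerivAt (smoothGrad e lam (trigSum r h a))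
      (∑ i, (r i * -cosf (h i) (a i) x) • (innerSL ℝ (h i)).smulRight (S (h i))) x := by
    rw [funext (smoothGrad_trigSum r h a hS)]
    have := HasFDerivAt.fun_sum (u := Finset.univ)
      (fun i _ => ((hasFDerivAt_cosf (h i) (a i + Real.pi / 2) x).const_mul (r i)).smul_const
        (S (h i)))
    convert this using 1
    refine Finset.sum_congr rfl fun i _ => ?_
    ext v
    simp [cosf_add_pi, smul_smul]
  refine ext_inner_right ℝ fun v => ?_
  rw [inner_smoothGrad hS, (hD.inner ℝ hD).fderiv]
  simp only [ContinuousLinearMap.comp_apply, ContinuousLinearMap.prod_apply,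
    fderivInnerCLM_apply, inner_smul_left, hessOp_trigSum r h a hS, conj_trivial]
  rw [real_inner_comm, ← two_mul]
  simp only [sum_apply, smul_apply,
    ContinuousLinearMap.smulRight_apply, sum_inner, inner_smul_left, innerSL_apply_apply,
    conj_trivial]
  congr 1
  refine Finset.sum_congr rfl fun i _ => ?_
  rw [hS.symm (h i) v]; ring

end ExpSpace

/-! ### Gaussian moments against a cosine. -/

section Moments

variable {H : Type*} [NormedAddCommGroup H] [InnerProductSpace ℝ H]
  [MeasurableSpace H] [BorelSpace H] [SecondCountableTopology H]

/-- `μ` is a probability measure with finite second moment and the characteristic function of a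
centered Gaussian measure with covariance `S* S`. -/
structure HasGaussianCharFun (μ : Measure H) (S : H →L[ℝ] H) : Prop where
  isProb : IsProbabilityMeasure μ
  memLp_id : MemLp (fun x : H => x) 2 μ
  integral_cosf : ∀ h a, ∫ x, cosf h a x ∂μ = Real.exp (-‖S h‖ ^ 2 / 2) * Real.cos a

/-- The phase comes from multiplying the characteristic function by `e^{ia}` and taking real parts.
-/
theorem IsCenteredGaussian.hasGaussianCharFun [CompleteSpace H] {μ : Measure H} {Q S : H →L[ℝ] H}
    (hμ : IsCenteredGaussian μ Q) (hSQ : ∀ v w, ⟪S v, S w⟫ = ⟪Q v, w⟫) :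
    HasGaussianCharFun μ S := by
  obtain ⟨hG, hmean, hcov⟩ := hμ
  refine ⟨inferInstance, IsGaussian.memLp_two_id, fun h a => ?_⟩
  have hc := IsGaussian.charFun_eq' (μ := μ) h
  have hm : μ[id] = 0 := hmean
  rw [hm, inner_zero_right, hcov, ← hSQ, real_inner_self_eq_norm_sq, charFun_apply] at hc
  have hint : Integrable (fun x : H => Complex.exp (⟪x, h⟫ * Complex.I)) μ := by
    refine (integrable_const (1 : ℝ)).mono' (by fun_prop) (ae_of_all _ fun x => ?_)
    rw [Complex.norm_exp_ofReal_mul_I]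
  have hint2 := hint.const_mul (Complex.exp (a * Complex.I))
  have h2 : ∀ x, cosf h a x =
      (Complex.exp (a * Complex.I) * Complex.exp (⟪x, h⟫ * Complex.I)).re := fun x => by
    rw [← Complex.exp_add, ← add_mul, ← Complex.ofReal_add, Complex.exp_ofReal_mul_I_re, add_comm,
      cosf]
  simp_rw [h2]
  have h3 := integral_re hint2
  simp only [RCLike.re_eq_complex_re] at h3
  rw [h3, integral_const_mul, hc]
  have h4 : Complex.exp ((((0 : ℝ) : ℂ)) * Complex.I - (((‖S h‖ ^ 2 : ℝ) : ℂ)) / 2) =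
      ((Real.exp (-‖S h‖ ^ 2 / 2) : ℝ) : ℂ) := by
    push_cast; congr 1; ring
  rw [h4, Complex.re_mul_ofReal, Complex.exp_ofReal_mul_I_re, mul_comm]

variable {μ : Measure H} {S : H →L[ℝ] H}

theorem HasGaussianCharFun.memLp_inner (hG : HasGaussianCharFun μ S) (k : H) :
    MemLp (fun x : H => ⟪x, k⟫) 2 μ := by
  have := (innerSL ℝ k).comp_memLp' hG.memLp_id
  refine this.congr_norm (by fun_prop) (ae_of_all _ fun x => ?_)
  simp [real_inner_comm]

omit [SecondCountableTopology H] in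
theorem integrable_mul_cosf {f : H → ℝ} (hf : Integrable f μ) (h : H) (a : ℝ) :
    Integrable (fun x => f x * cosf h a x) μ :=
  hf.mul_bdd (c := 1) (continuous_cosf h a).aestronglyMeasurable
    (ae_of_all _ fun x => abs_cosf_le h a x)

omit [SecondCountableTopology H] in
-- Differentiating in the frequency brings down a factor `⟨x, k⟩`, so moments against cosines can be
-- read off the characteristic function. The domination `|f(x) ⟨x, k⟩|` is uniform in `s`.
theorem hasDerivAt_integral_mul_cosf {f : H → ℝ} (hf : Integrable f μ) (h k : H) (a : ℝ)
    (hfk : Integrable (fun x => f x * ⟪x, k⟫) μ) :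
    HasDerivAt (fun s : ℝ => ∫ x, f x * cosf (h + s • k) a x ∂μ)
      (∫ x, f x * ⟪x, k⟫ * cosf h (a + Real.pi / 2) x ∂μ) 0 := by
  have hd := (hasDerivAt_integral_of_dominated_loc_of_deriv_le (μ := μ) (x₀ := (0 : ℝ))
    (F := fun s x => f x * cosf (h + s • k) a x)
    (F' := fun s x => f x * ⟪x, k⟫ * cosf (h + s • k) (a + Real.pi / 2) x)
    (bound := fun x => ‖f x * ⟪x, k⟫‖) (s := Set.univ) univ_mem
    (Eventually.of_forall fun s => (integrable_mul_cosf hf _ _).aestronglyMeasurable)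
    (integrable_mul_cosf hf _ _) (integrable_mul_cosf hfk _ _).aestronglyMeasurable
    (ae_of_all _ fun x s _ => ?_) hfk.norm (ae_of_all _ fun x s _ => ?_)).2
  · simpa using hd
  · rw [norm_mul]
    exact mul_le_of_le_one_right (norm_nonneg _) (abs_cosf_le _ _ _)
  · have h1 : HasDerivAt (fun s : ℝ => ⟪x, h + s • k⟫ + a) ⟪x, k⟫ s := by
      simp only [inner_add_right, inner_smul_right]
      simpa using (((hasDerivAt_id s).mul_const ⟪x, k⟫).const_add ⟪x, h⟫).add_const a
    have h2 := (h1.cos).const_mul (f x)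
    have h3 : cosf (h + s • k) (a + Real.pi / 2) x = -Real.sin (⟪x, h + s • k⟫ + a) := by
      unfold cosf
      rw [← add_assoc, Real.cos_add_pi_div_two]
    rw [h3]
    refine h2.congr_deriv ?_
    ring

omit [MeasurableSpace H] [BorelSpace H] [SecondCountableTopology H] in
theorem hasDerivAt_exp_neg_norm_sq (S : H →L[ℝ] H) (h k : H) :
    HasDerivAt (fun s : ℝ => Real.exp (-‖S (h + s • k)‖ ^ 2 / 2))
      (-⟪S h, S k⟫ * Real.exp (-‖S h‖ ^ 2 / 2)) 0 := by
  have h1 : ∀ s : ℝ, -‖S (h + s • k)‖ ^ 2 / 2 =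
      -‖S h‖ ^ 2 / 2 + s * -⟪S h, S k⟫ + s ^ 2 * (-‖S k‖ ^ 2 / 2) := fun s => by
    rw [map_add, map_smul, norm_add_sq_real, inner_smul_right, norm_smul, mul_pow,
      Real.norm_eq_abs, sq_abs]
    ring
  simp_rw [h1]
  have h2 : HasDerivAt (fun s : ℝ => -‖S h‖ ^ 2 / 2 + s * -⟪S h, S k⟫ + s ^ 2 * (-‖S k‖ ^ 2 / 2))
      (-⟪S h, S k⟫) 0 := by
    have := (((hasDerivAt_id (0 : ℝ)).mul_const (-⟪S h, S k⟫)).const_add (-‖S h‖ ^ 2 / 2)).fun_add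
      (((hasDerivAt_id (0 : ℝ)).fun_pow 2).mul_const (-‖S k‖ ^ 2 / 2))
    simpa using this
  simpa [mul_comm] using h2.exp

theorem HasGaussianCharFun.integral_inner_mul_cosf (hG : HasGaussianCharFun μ S) (h k : H)
    (a : ℝ) : ∫ x, ⟪x, k⟫ * cosf h a x ∂μ =
      -⟪S h, S k⟫ * Real.exp (-‖S h‖ ^ 2 / 2) * Real.cos (a - Real.pi / 2) := by
  have := hG.isProb
  have hk := (hG.memLp_inner k).integrable one_le_two
  -- The phase starts at `a - π/2` because differentiation adds `π/2`.
  have h1 := hasDerivAt_integral_mul_cosf (μ := μ) (integrable_const (1 : ℝ)) h k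
    (a - Real.pi / 2) (by simpa using hk)
  simp only [one_mul, sub_add_cancel, hG.integral_cosf] at h1
  exact h1.unique ((hasDerivAt_exp_neg_norm_sq S h k).mul_const _)

theorem HasGaussianCharFun.integral_inner_mul_inner_mul_cosf (hG : HasGaussianCharFun μ S)
    (h k l : H) (a : ℝ) : ∫ x, ⟪x, k⟫ * ⟪x, l⟫ * cosf h a x ∂μ =
      (⟪S k, S l⟫ - ⟪S h, S k⟫ * ⟪S h, S l⟫) * Real.exp (-‖S h‖ ^ 2 / 2) * Real.cos a := by
  have := hG.isProb
  have hk := (hG.memLp_inner k).integrable one_le_two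
  have hkl : Integrable (fun x => ⟪x, k⟫ * ⟪x, l⟫) μ :=
    (hG.memLp_inner k).integrable_mul (hG.memLp_inner l)
  have h1 := hasDerivAt_integral_mul_cosf (μ := μ) hk h l (a - Real.pi / 2) hkl
  simp only [sub_add_cancel, hG.integral_inner_mul_cosf, map_add, map_smul, inner_add_left,
    inner_smul_left, conj_trivial] at h1
  have h2 : HasDerivAt (fun s : ℝ => -(⟪S h, S k⟫ + s * ⟪S l, S k⟫)) (-⟪S l, S k⟫) 0 := by
    simpa only [one_mul, id] using (((hasDerivAt_id (0 : ℝ)).mul_const ⟪S l, S k⟫).const_add ⟪S h, S k⟫).fun_neg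
  have h3 := (h2.fun_mul (hasDerivAt_exp_neg_norm_sq S h l)).mul_const
    (Real.cos (a - Real.pi / 2 - Real.pi / 2))
  have h4 : Real.cos (a - Real.pi / 2 - Real.pi / 2) = -Real.cos a := by
    rw [← Real.cos_sub_pi]; ring_nf
  have h5 := h1.unique (by simpa only [map_add, map_smul] using h3)
  rw [h5, h4, real_inner_comm (S k) (S l)]
  simp
  ring

end Moments

/-! ### Integration by parts and energy identity for two cosines. -/

section Pairs

variable {H : Type*} [NormedAddCommGroup H] [InnerProductSpace ℝ H]
  [MeasurableSpace H] [BorelSpace H] [SecondCountableTopology H]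
  {μ : Measure H} {S : H →L[ℝ] H}

omit [SecondCountableTopology H] in
theorem HasGaussianCharFun.integral_cosf_mul_cosf (hG : HasGaussianCharFun μ S) (h k : H)
    (a b : ℝ) : ∫ x, cosf h a x * cosf k b x ∂μ =
      (1 / 2) * (Real.exp (-‖S (h + k)‖ ^ 2 / 2) * Real.cos (a + b)) +
      (1 / 2) * (Real.exp (-‖S (h - k)‖ ^ 2 / 2) * Real.cos (a - b)) := by
  have := hG.isProb
  have hi : ∀ h a, Integrable (cosf h a) μ := fun h a => by
    simpa using integrable_mul_cosf (μ := μ) (integrable_const (1 : ℝ)) h a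
  simp_rw [cosf_mul_cosf]
  rw [integral_add ((hi _ _).const_mul _) ((hi _ _).const_mul _), integral_const_mul,
    integral_const_mul, hG.integral_cosf, hG.integral_cosf]

theorem HasGaussianCharFun.integral_inner_mul_cosf_mul_cosf (hG : HasGaussianCharFun μ S)
    (h k l : H) (a b : ℝ) : ∫ x, ⟪x, l⟫ * (cosf h a x * cosf k b x) ∂μ =
      (1 / 2) * (-⟪S (h + k), S l⟫ * Real.exp (-‖S (h + k)‖ ^ 2 / 2)
        * Real.cos (a + b - Real.pi / 2)) +
      (1 / 2) * (-⟪S (h - k), S l⟫ * Real.exp (-‖S (h - k)‖ ^ 2 / 2)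
        * Real.cos (a - b - Real.pi / 2)) := by
  have := hG.isProb
  have hi : ∀ h a, Integrable (fun x => ⟪x, l⟫ * cosf h a x) μ := fun h a =>
    integrable_mul_cosf ((hG.memLp_inner l).integrable one_le_two) h a
  simp_rw [cosf_mul_cosf, mul_add, mul_left_comm _ (1 / 2 : ℝ)]
  rw [integral_add ((hi _ _).const_mul _) ((hi _ _).const_mul _), integral_const_mul,
    integral_const_mul, hG.integral_inner_mul_cosf, hG.integral_inner_mul_cosf]

theorem HasGaussianCharFun.integral_inner_mul_inner_mul_cosf_mul_cosf
    (hG : HasGaussianCharFun μ S)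
    (h k l m : H) (a b : ℝ) : ∫ x, ⟪x, l⟫ * ⟪x, m⟫ * (cosf h a x * cosf k b x) ∂μ =
      (1 / 2) * ((⟪S l, S m⟫ - ⟪S (h + k), S l⟫ * ⟪S (h + k), S m⟫)
        * Real.exp (-‖S (h + k)‖ ^ 2 / 2) * Real.cos (a + b)) +
      (1 / 2) * ((⟪S l, S m⟫ - ⟪S (h - k), S l⟫ * ⟪S (h - k), S m⟫)
        * Real.exp (-‖S (h - k)‖ ^ 2 / 2) * Real.cos (a - b)) := by
  have := hG.isProb
  have hlm : Integrable (fun x => ⟪x, l⟫ * ⟪x, m⟫) μ :=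
    (hG.memLp_inner l).integrable_mul (hG.memLp_inner m)
  have hi : ∀ h a, Integrable (fun x => ⟪x, l⟫ * ⟪x, m⟫ * cosf h a x) μ := fun h a =>
    integrable_mul_cosf hlm h a
  simp_rw [cosf_mul_cosf, mul_add, mul_left_comm _ (1 / 2 : ℝ)]
  rw [integral_add ((hi _ _).const_mul _) ((hi _ _).const_mul _), integral_const_mul,
    integral_const_mul, hG.integral_inner_mul_inner_mul_cosf,
    hG.integral_inner_mul_inner_mul_cosf]

/-- Integration by parts for a pair of cosines. -/
theorem HasGaussianCharFun.ibp_cosf (hG : HasGaussianCharFun μ S) (h k : H) (a b : ℝ) :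
    ∫ x, cosf h a x * (-cosf k b x * ⟪S k, S k⟫ - cosf k (b + Real.pi / 2) x * ⟪x, k⟫) ∂μ =
      -(⟪S h, S k⟫ * ∫ x, cosf h (a + Real.pi / 2) x * cosf k (b + Real.pi / 2) x ∂μ) := by
  have := hG.isProb
  have h1 : Integrable (fun x => cosf h a x * cosf k b x) μ := by
    simpa using integrable_mul_cosf (integrable_mul_cosf (μ := μ) (integrable_const (1 : ℝ)) h a)
      k b
  have h2 : Integrable (fun x => ⟪x, k⟫ * (cosf h a x * cosf k (b + Real.pi / 2) x)) μ := by
    simpa only [mul_assoc] using integrable_mul_cosf (integrable_mul_cosf (μ := μ)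
      ((hG.memLp_inner k).integrable one_le_two) h a) k (b + Real.pi / 2)
  have h3 : ∀ x, cosf h a x * (-cosf k b x * ⟪S k, S k⟫ - cosf k (b + Real.pi / 2) x * ⟪x, k⟫) =
      -⟪S k, S k⟫ * (cosf h a x * cosf k b x) -
        ⟪x, k⟫ * (cosf h a x * cosf k (b + Real.pi / 2) x) := fun x => by ring
  simp_rw [h3]
  rw [integral_sub (h1.const_mul _) h2, integral_const_mul, hG.integral_cosf_mul_cosf,
    hG.integral_inner_mul_cosf_mul_cosf, hG.integral_cosf_mul_cosf]
  -- All phases reduce to `cos (a + b)` and `cos (a - b)`. With the two exponentials kept as they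
  -- are, a polynomial identity in the inner products of `S h` and `S k` remains.
  have e1 : Real.cos (a + (b + Real.pi / 2) - Real.pi / 2) = Real.cos (a + b) := by ring_nf
  have e2 : Real.cos (a - (b + Real.pi / 2) - Real.pi / 2) = -Real.cos (a - b) := by
    rw [← Real.cos_sub_pi]; ring_nf
  have e3 : Real.cos (a + Real.pi / 2 + (b + Real.pi / 2)) = -Real.cos (a + b) := by
    rw [← Real.cos_add_pi]; ring_nf
  have e4 : Real.cos (a + Real.pi / 2 - (b + Real.pi / 2)) = Real.cos (a - b) := by ring_nf
  rw [e1, e2, e3, e4]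
  simp only [map_add, map_sub, inner_add_left, inner_sub_left]
  ring

/-- The energy identity for a pair of cosines. -/
theorem HasGaussianCharFun.energy_cosf (hG : HasGaussianCharFun μ S) (h k : H) (a b : ℝ) :
    ∫ x, (-cosf h a x * ⟪S h, S h⟫ - cosf h (a + Real.pi / 2) x * ⟪x, h⟫) *
        (-cosf k b x * ⟪S k, S k⟫ - cosf k (b + Real.pi / 2) x * ⟪x, k⟫) ∂μ =
      ⟪S h, S k⟫ * ∫ x, cosf h (a + Real.pi / 2) x * cosf k (b + Real.pi / 2) x ∂μ +
      ⟪S h, S k⟫ ^ 2 * ∫ x, cosf h a x * cosf k b x ∂μ := by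
  have := hG.isProb
  have hcc : ∀ {f : H → ℝ}, Integrable f μ → ∀ a b,
      Integrable (fun x => f x * (cosf h a x * cosf k b x)) μ := fun hf a b => by
    simpa only [mul_assoc] using integrable_mul_cosf (integrable_mul_cosf hf h a) k b
  have h1 := hcc (integrable_const (⟪S h, S h⟫ * ⟪S k, S k⟫)) a b
  have h2 := hcc ((hG.memLp_inner k).integrable one_le_two) a (b + Real.pi / 2)
  have h3 := hcc ((hG.memLp_inner h).integrable one_le_two) (a + Real.pi / 2) b
  have h4 := hcc ((hG.memLp_inner h).integrable_mul (hG.memLp_inner k)) (a + Real.pi / 2)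
    (b + Real.pi / 2)
  simp only [Pi.mul_apply] at h4
  have h5 : ∀ x, (-cosf h a x * ⟪S h, S h⟫ - cosf h (a + Real.pi / 2) x * ⟪x, h⟫) *
        (-cosf k b x * ⟪S k, S k⟫ - cosf k (b + Real.pi / 2) x * ⟪x, k⟫) =
      ((⟪S h, S h⟫ * ⟪S k, S k⟫) * (cosf h a x * cosf k b x) +
        ⟪S h, S h⟫ * (⟪x, k⟫ * (cosf h a x * cosf k (b + Real.pi / 2) x))) +
      (⟪S k, S k⟫ * (⟪x, h⟫ * (cosf h (a + Real.pi / 2) x * cosf k b x)) +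
        ⟪x, h⟫ * ⟪x, k⟫ * (cosf h (a + Real.pi / 2) x * cosf k (b + Real.pi / 2) x)) :=
    fun x => by ring
  have h6 : Integrable (fun x => (⟪S h, S h⟫ * ⟪S k, S k⟫) * (cosf h a x * cosf k b x) +
      ⟪S h, S h⟫ * (⟪x, k⟫ * (cosf h a x * cosf k (b + Real.pi / 2) x))) μ :=
    h1.add (h2.const_mul _)
  have h7 : Integrable (fun x => ⟪S k, S k⟫ * (⟪x, h⟫ * (cosf h (a + Real.pi / 2) x * cosf k b x)) +
      ⟪x, h⟫ * ⟪x, k⟫ * (cosf h (a + Real.pi / 2) x * cosf k (b + Real.pi / 2) x)) μ :=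
    (h3.const_mul _).add h4
  simp_rw [h5]
  rw [integral_add h6 h7,
    integral_add h1 (h2.const_mul _), integral_add (h3.const_mul _) h4, integral_const_mul,
    integral_const_mul, integral_const_mul,
    hG.integral_inner_mul_inner_mul_cosf_mul_cosf, hG.integral_cosf_mul_cosf,
    hG.integral_inner_mul_cosf_mul_cosf, hG.integral_inner_mul_cosf_mul_cosf,
    hG.integral_cosf_mul_cosf]
  have e1 : Real.cos (a + (b + Real.pi / 2) - Real.pi / 2) = Real.cos (a + b) := by ring_nf
  have e2 : Real.cos (a - (b + Real.pi / 2) - Real.pi / 2) = -Real.cos (a - b) := by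
    rw [← Real.cos_sub_pi]; ring_nf
  have e3 : Real.cos (a + Real.pi / 2 + (b + Real.pi / 2)) = -Real.cos (a + b) := by
    rw [← Real.cos_add_pi]; ring_nf
  have e4 : Real.cos (a + Real.pi / 2 - (b + Real.pi / 2)) = Real.cos (a - b) := by ring_nf
  have e5 : Real.cos (a + Real.pi / 2 + b - Real.pi / 2) = Real.cos (a + b) := by ring_nf
  have e6 : Real.cos (a + Real.pi / 2 - b - Real.pi / 2) = Real.cos (a - b) := by ring_nf
  rw [e1, e2, e3, e4, e5, e6]
  simp only [map_add, map_sub, inner_add_left, inner_sub_left, real_inner_comm (S h) (S k)]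
  ring

end Pairs

/-! ### Convergence in `L²`. -/

section LpTools

variable {α E : Type*} [MeasurableSpace α] {μ : Measure α} [NormedAddCommGroup E]

theorem eLpNorm_two_sq (f : α → E) : eLpNorm f 2 μ ^ 2 = ∫⁻ x, ‖f x‖ₑ ^ 2 ∂μ := by
  have := eLpNorm_nnreal_pow_eq_lintegral (μ := μ) (f := f) (p := 2) two_ne_zero
  simpa using this

theorem eLpNorm_two_sq_eq_ofReal {f : α → E} (hf : MemLp f 2 μ) :
    eLpNorm f 2 μ ^ 2 = ENNReal.ofReal (∫ x, ‖f x‖ ^ 2 ∂μ) := by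
  rw [eLpNorm_two_sq, ofReal_integral_eq_lintegral_ofReal hf.norm.integrable_sq
    (ae_of_all _ fun x => sq_nonneg _)]
  refine lintegral_congr fun x => ?_
  rw [ENNReal.ofReal_pow (norm_nonneg _), ofReal_norm]

theorem eLpNorm_two_le_of_integral_sq_le {F : Type*} [NormedAddCommGroup F] {f : α → E}
    {g : α → F} (hf : MemLp f 2 μ) (hg : MemLp g 2 μ)
    (h : ∫ x, ‖f x‖ ^ 2 ∂μ ≤ ∫ x, ‖g x‖ ^ 2 ∂μ) :
    eLpNorm f 2 μ ≤ eLpNorm g 2 μ := by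
  have h2 : eLpNorm f 2 μ ^ 2 ≤ eLpNorm g 2 μ ^ 2 := by
    rw [eLpNorm_two_sq_eq_ofReal hf, eLpNorm_two_sq_eq_ofReal hg]
    exact ENNReal.ofReal_le_ofReal h
  exact (ENNReal.pow_le_pow_left_iff two_ne_zero).1 h2

theorem lintegral_enorm_mul_enorm_le {F : Type*} [NormedAddCommGroup F] {f : α → E} {g : α → F}
    (hf : AEStronglyMeasurable f μ) (hg : AEStronglyMeasurable g μ) :
    ∫⁻ x, ‖f x‖ₑ * ‖g x‖ₑ ∂μ ≤ eLpNorm f 2 μ * eLpNorm g 2 μ := by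
  have h := ENNReal.lintegral_mul_le_Lp_mul_Lq μ Real.HolderConjugate.two_two hf.enorm hg.enorm
  rw [eLpNorm_eq_lintegral_rpow_enorm_toReal two_ne_zero ENNReal.ofNat_ne_top,
    eLpNorm_eq_lintegral_rpow_enorm_toReal two_ne_zero ENNReal.ofNat_ne_top]
  simpa using h

theorem integrable_inner_of_memLp_two {E : Type*} [NormedAddCommGroup E] [InnerProductSpace ℝ E]
    {F G : α → E} (hF : MemLp F 2 μ) (hG : MemLp G 2 μ) :
    Integrable (fun x => ⟪F x, G x⟫) μ :=
  (hF.norm.integrable_mul hG.norm).mono' (hF.1.inner hG.1)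
    (ae_of_all _ fun _ => norm_inner_le_norm _ _)

theorem enorm_inner_le {E : Type*} [NormedAddCommGroup E] [InnerProductSpace ℝ E] (v w : E) :
    ‖⟪v, w⟫‖ₑ ≤ ‖v‖ₑ * ‖w‖ₑ := by
  rw [← ofReal_norm, ← ofReal_norm, ← ofReal_norm, ← ENNReal.ofReal_mul (norm_nonneg _)]
  exact ENNReal.ofReal_le_ofReal (norm_inner_le_norm _ _)

theorem tendsto_integral_inner {E : Type*} [NormedAddCommGroup E] [InnerProductSpace ℝ E]
    {f : ℕ → α → E} {F G : α → E} (hf : ∀ n, MemLp (f n) 2 μ)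
    (hF : MemLp F 2 μ) (hG : MemLp G 2 μ)
    (h : Tendsto (fun n => eLpNorm (fun x => f n x - F x) 2 μ) atTop (𝓝 0)) :
    Tendsto (fun n => ∫ x, ⟪f n x, G x⟫ ∂μ) atTop (𝓝 (∫ x, ⟪F x, G x⟫ ∂μ)) := by
  refine tendsto_integral_of_L1 _ (integrable_inner_of_memLp_two hF hG).1
    (Eventually.of_forall fun n => integrable_inner_of_memLp_two (hf n) hG) ?_
  have h1 := ENNReal.Tendsto.mul_const h (Or.inr hG.2.ne)
  rw [zero_mul] at h1
  refine tendsto_of_tendsto_of_tendsto_of_le_of_le tendsto_const_nhds h1 (fun _ => zero_le)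
    fun n => ?_
  refine le_trans (lintegral_mono fun x => ?_)
    (lintegral_enorm_mul_enorm_le (hf n |>.sub hF).1 hG.1)
  rw [← inner_sub_left]
  exact enorm_inner_le _ _

/-- Transfers the Cauchy property from `v` to `f`. With `v = 𝓛₀φ_n` and the energy estimate, it
produces the limits of first and second derivatives. -/
theorem exists_eLpNorm_limit [CompleteSpace E]
    {f : ℕ → α → E} {v : ℕ → α → ℝ} {u : α → ℝ}
    (hf : ∀ n, MemLp (f n) 2 μ) (hv : ∀ n, AEStronglyMeasurable (v n) μ)
    (hu : AEStronglyMeasurable u μ)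
    (h : Tendsto (fun n => eLpNorm (fun x => v n x - u x) 2 μ) atTop (𝓝 0))
    {C : ℝ≥0∞} (hC : C ≠ ∞) (hle : ∀ n m, eLpNorm (fun x => f n x - f m x) 2 μ ≤
      C * eLpNorm (fun x => v n x - v m x) 2 μ) :
    ∃ F, MemLp F 2 μ ∧ Tendsto (fun n => eLpNorm (fun x => f n x - F x) 2 μ) atTop (𝓝 0) := by
  have hcau : CauchySeq fun n => (hf n).toLp (f n) := by
    refine EMetric.cauchySeq_iff.2 fun ε hε => ?_
    have hC' : Tendsto (fun n => C * (eLpNorm (fun x => v n x - u x) 2 μ)) atTop (𝓝 0) := by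
      simpa using ENNReal.Tendsto.const_mul h (Or.inr hC)
    obtain ⟨N, hN⟩ := eventually_atTop.1 (hC'.eventually_lt_const (ENNReal.half_pos hε.ne'))
    refine ⟨N, fun m hm n hn => ?_⟩
    rw [Lp.edist_toLp_toLp]
    calc eLpNorm (f m - f n) 2 μ ≤ C * eLpNorm (fun x => v m x - v n x) 2 μ := hle m n
      _ ≤ C * (eLpNorm (fun x => v m x - u x) 2 μ + eLpNorm (fun x => v n x - u x) 2 μ) := by
          gcongr
          have : (fun x => v m x - v n x) = (fun x => v m x - u x) - (fun x => v n x - u x) := by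
            ext x; simp
          rw [this]
          exact eLpNorm_sub_le ((hv m).sub hu) ((hv n).sub hu) (by norm_num)
      _ < ε / 2 + ε / 2 := by
          rw [mul_add]
          exact ENNReal.add_lt_add (hN m hm) (hN n hn)
      _ = ε := ENNReal.add_halves ε
  obtain ⟨F, hF⟩ := cauchySeq_tendsto_of_complete hcau
  refine ⟨F, Lp.memLp F, ?_⟩
  rw [← Lp.toLp_coeFn F (Lp.memLp F)] at hF
  exact (Lp.tendsto_Lp_iff_tendsto_eLpNorm'' _ hf _ _).1 hF

end LpTools

/-! ### Hilbert-Schmidt operators as square summable matrices. -/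

section Tensor

variable {H : Type*} [NormedAddCommGroup H] [InnerProductSpace ℝ H] {ι : Type*}

/-- The space of square summable matrices. -/
abbrev HSMat (ι : Type*) := lp (fun _ : ι × ι => ℝ) 2

theorem summable_sq_inner (e : HilbertBasis ι ℝ H) (v : H) : Summable fun i => ⟪e i, v⟫ ^ 2 :=
  (e.summable_inner_mul_inner v v).congr fun i => by rw [real_inner_comm, sq]

theorem memℓp_tens (e : HilbertBasis ι ℝ H) (v w : H) :
    Memℓp (fun p : ι × ι => ⟪e p.1, v⟫ * ⟪e p.2, w⟫) 2 := by
  refine memℓp_gen ?_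
  have := (summable_sq_inner e v).mul_of_nonneg (summable_sq_inner e w) (fun _ => sq_nonneg _)
    (fun _ => sq_nonneg _)
  refine this.congr fun p => ?_
  simp [mul_pow]

/-- The tensor product `v ⊗ w` as a matrix in the basis `e`. -/
noncomputable def tens (e : HilbertBasis ι ℝ H) (v w : H) : HSMat ι :=
  ⟨fun p => ⟪e p.1, v⟫ * ⟪e p.2, w⟫, memℓp_tens e v w⟩

theorem tens_apply (e : HilbertBasis ι ℝ H) (v w : H) (p : ι × ι) :
    tens e v w p = ⟪e p.1, v⟫ * ⟪e p.2, w⟫ := rfl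

theorem inner_tens (e : HilbertBasis ι ℝ H) (v w v' w' : H) :
    ⟪tens e v w, tens e v' w'⟫ = ⟪v, v'⟫ * ⟪w, w'⟫ := by
  rw [lp.inner_eq_tsum, ← e.tsum_inner_mul_inner v v', ← e.tsum_inner_mul_inner w w',
    tsum_mul_tsum_of_summable_norm (e.summable_inner_mul_inner v v').norm
      (e.summable_inner_mul_inner w w').norm]
  refine tsum_congr fun p => ?_
  simp only [tens_apply, RCLike.inner_apply, conj_trivial, real_inner_comm (e _)]
  ring

theorem norm_tens (e : HilbertBasis ι ℝ H) (v w : H) : ‖tens e v w‖ = ‖v‖ * ‖w‖ := by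
  have h := inner_tens e v w v w
  simp only [real_inner_self_eq_norm_sq] at h
  rw [← mul_pow] at h
  exact (pow_left_inj₀ (norm_nonneg _) (by positivity) two_ne_zero).1 h

/-- The matrix of `e_i ⊗ e_j` is a standard unit vector of `ℓ²`, so pairing with it reads off an
entry. -/
theorem inner_tens_basis (e : HilbertBasis ι ℝ H) (A : HSMat ι) (i j : ι) :
    ⟪A, tens e (e i) (e j)⟫ = A (i, j) := by
  classical
  have : tens e (e i) (e j) = lp.single 2 (i, j) (1 : ℝ) := by
    ext p
    rw [tens_apply, orthonormal_iff_ite.1 e.orthonormal, orthonormal_iff_ite.1 e.orthonormal,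
      lp.single_apply]
    by_cases h1 : p.1 = i <;> by_cases h2 : p.2 = j <;> simp [Prod.ext_iff, h1, h2, Pi.single_apply]
  rw [this, lp.inner_single_right]
  simp

/-- The form `(v, w) ↦ ⟨A, v ⊗ w⟩` is bounded by `‖A‖` since `‖v ⊗ w‖ = ‖v‖ ‖w‖`; Riesz
representation gives the operator. -/
theorem exists_op_of_hsMat [CompleteSpace H] (e : HilbertBasis ι ℝ H) (A : HSMat ι) :
    ∃ B : H →L[ℝ] H, ∀ v w, ⟪B v, w⟫ = ⟪A, tens e v w⟫ := by
  let b : H →L[ℝ] H →L[ℝ] ℝ := LinearMap.mkContinuous₂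
    (LinearMap.mk₂ ℝ (fun v w => ⟪A, tens e v w⟫)
      (fun v v' w => by
        rw [← inner_add_right]; congr 1; ext p
        simp only [tens_apply, lp.coeFn_add, Pi.add_apply, inner_add_right]; ring)
      (fun c v w => by
        rw [smul_eq_mul, ← inner_smul_right (𝕜 := ℝ)]; congr 1; ext p
        simp only [tens_apply, lp.coeFn_smul, Pi.smul_apply, inner_smul_right, smul_eq_mul]; ring)
      (fun v w w' => by
        rw [← inner_add_right]; congr 1; ext p
        simp only [tens_apply, lp.coeFn_add, Pi.add_apply, inner_add_right]; ring)
      (fun c v w => by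
        rw [smul_eq_mul, ← inner_smul_right (𝕜 := ℝ)]; congr 1; ext p
        simp only [tens_apply, lp.coeFn_smul, Pi.smul_apply, inner_smul_right, smul_eq_mul]; ring))
    ‖A‖ (fun v w => by
      simpa [norm_tens, mul_assoc] using norm_inner_le_norm (𝕜 := ℝ) A (tens e v w))
  refine ⟨opOfBilin b, fun v w => ?_⟩
  rw [inner_opOfBilin]
  rfl

theorem enorm_sq_hsMat (A : HSMat ι) :
    ‖A‖ₑ ^ 2 = ∑' h, ∑' k, ENNReal.ofReal (A (h, k) ^ 2) := by
  rw [← ENNReal.tsum_prod' (f := fun p : ι × ι => ENNReal.ofReal (A p ^ 2))]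
  have h1 := lp.norm_rpow_eq_tsum (p := 2) (by norm_num) A
  have h2 := (lp.memℓp A).summable (by norm_num)
  simp only [ENNReal.toReal_ofNat, Real.rpow_ofNat, Real.norm_eq_abs, sq_abs] at h1 h2
  rw [← ofReal_norm, ← ENNReal.ofReal_pow (norm_nonneg _), h1,
    ENNReal.ofReal_tsum_of_nonneg (fun _ => sq_nonneg _) h2]

end Tensor

/-! ### The Hessian matrix on `ℰ₀(H)`. -/

section HessMat

variable {H : Type*} [NormedAddCommGroup H] [InnerProductSpace ℝ H] {ι : Type*}
  {e : HilbertBasis ι ℝ H} {lam : ι → ℝ} {S : H →L[ℝ] H} {φ ψ : H → ℝ}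

open Classical in
/-- The matrix of `Q^{1/2} D²φ(x) Q^{1/2}` as a square summable matrix. -/
noncomputable def hessMat (e : HilbertBasis ι ℝ H) (lam : ι → ℝ) (φ : H → ℝ) (x : H) : HSMat ι :=
  if h : Memℓp (fun p : ι × ι => smoothHess e lam φ x p.1 p.2) 2 then ⟨_, h⟩ else 0

theorem hessMat_eq_of_forall {x : H} {A : HSMat ι}
    (h : ∀ i j, smoothHess e lam φ x i j = A (i, j)) : hessMat e lam φ x = A := by
  have h1 : (fun p : ι × ι => smoothHess e lam φ x p.1 p.2) = ⇑A := by ext p; exact h p.1 p.2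
  have h2 : Memℓp (fun p : ι × ι => smoothHess e lam φ x p.1 p.2) 2 := h1 ▸ lp.memℓp A
  rw [hessMat, dif_pos h2]
  ext p
  exact h p.1 p.2

theorem smoothHess_trigSum (hS : IsDiagSqrt e lam S) {n : ℕ} (r : Fin n → ℝ) (h : Fin n → H)
    (a : Fin n → ℝ) (x : H) (i j : ι) : smoothHess e lam (trigSum r h a) x i j =
      (∑ l, (r l * -cosf (h l) (a l) x) • tens e (S (h l)) (S (h l)) : HSMat ι) (i, j) := by
  rw [smoothHess_eq hS, fderiv_fderiv_trigSum, lp.coeFn_sum, Finset.sum_apply]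
  refine Finset.sum_congr rfl fun l _ => ?_
  rw [lp.coeFn_smul, Pi.smul_apply, tens_apply, smul_eq_mul, ← hS.symm, ← hS.symm,
    real_inner_comm (e i), real_inner_comm (e j)]

/-- On `ℰ₀(H)` the second derivative has finite rank, so its matrix is square summable and the
default value `0` of `hessMat` never replaces it. -/
theorem hessMat_trigSum (hS : IsDiagSqrt e lam S) {n : ℕ} (r : Fin n → ℝ) (h : Fin n → H)
    (a : Fin n → ℝ) (x : H) : hessMat e lam (trigSum r h a) x =
      ∑ l, (r l * -cosf (h l) (a l) x) • tens e (S (h l)) (S (h l)) :=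
  hessMat_eq_of_forall (smoothHess_trigSum hS r h a x)

theorem hessMat_apply (hS : IsDiagSqrt e lam S) (hφ : φ ∈ expSpace H) (x : H) (i j : ι) :
    hessMat e lam φ x (i, j) = smoothHess e lam φ x i j := by
  obtain ⟨n, r, h, a, rfl⟩ := exists_trigSum hφ
  rw [hessMat_trigSum hS, smoothHess_trigSum hS]

theorem hessMat_sub (hS : IsDiagSqrt e lam S) (hφ : φ ∈ expSpace H) (hψ : ψ ∈ expSpace H)
    (x : H) : hessMat e lam (φ - ψ) x = hessMat e lam φ x - hessMat e lam ψ x :=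
  hessMat_eq_of_forall fun i j => by
    rw [smoothHess_sub hφ hψ, lp.coeFn_sub, Pi.sub_apply, hessMat_apply hS hφ,
      hessMat_apply hS hψ]

theorem continuous_hessMat (hS : IsDiagSqrt e lam S) (hφ : φ ∈ expSpace H) :
    Continuous (hessMat e lam φ) := by
  obtain ⟨n, r, h, a, rfl⟩ := exists_trigSum hφ
  rw [funext (hessMat_trigSum hS r h a)]
  exact continuous_finsetSum _ fun i _ => ((continuous_cosf _ _).neg.const_mul _).smul
    continuous_const

theorem bounded_hessMat (hS : IsDiagSqrt e lam S) (hφ : φ ∈ expSpace H) :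
    ∃ C, ∀ x, ‖hessMat e lam φ x‖ ≤ C := by
  obtain ⟨n, r, h, a, rfl⟩ := exists_trigSum hφ
  refine ⟨∑ i, |r i| * ‖tens e (S (h i)) (S (h i))‖, fun x => ?_⟩
  rw [hessMat_trigSum hS]
  refine (norm_sum_le _ _).trans (Finset.sum_le_sum fun i _ => ?_)
  rw [norm_smul, norm_mul, norm_neg, Real.norm_eq_abs, Real.norm_eq_abs]
  refine mul_le_mul_of_nonneg_right ?_ (norm_nonneg _)
  exact mul_le_of_le_one_right (abs_nonneg _) (abs_cosf_le _ _ _)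

end HessMat

/-! ### Integration by parts and energy identity on `ℰ₀(H)`. -/

section Energy

variable {H : Type*} [NormedAddCommGroup H] [InnerProductSpace ℝ H]
  [MeasurableSpace H] [BorelSpace H] [SecondCountableTopology H] [CompleteSpace H]
  {ι : Type*} {e : HilbertBasis ι ℝ H} {lam : ι → ℝ}
  {μ : Measure H} {S : H →L[ℝ] H} {φ ψ : H → ℝ}

omit [InnerProductSpace ℝ H] [SecondCountableTopology H] [CompleteSpace H] in
theorem memLp_of_continuous_bounded {E : Type*} [NormedAddCommGroup E]
    [SecondCountableTopologyEither H E] [IsFiniteMeasure μ] {f : H → E}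
    (hf : Continuous f) (hb : ∃ C, ∀ x, ‖f x‖ ≤ C) (p : ℝ≥0∞) : MemLp f p μ :=
  let ⟨C, hC⟩ := hb
  MemLp.of_bound hf.aestronglyMeasurable C (ae_of_all _ hC)

theorem memLp_smoothGrad [IsFiniteMeasure μ] (hS : IsDiagSqrt e lam S) (hφ : φ ∈ expSpace H)
    (p : ℝ≥0∞) : MemLp (smoothGrad e lam φ) p μ :=
  memLp_of_continuous_bounded (continuous_smoothGrad hS hφ) (bounded_smoothGrad hS hφ) p

omit [SecondCountableTopology H] [CompleteSpace H] in
theorem memLp_of_mem_expSpace [IsFiniteMeasure μ] (hφ : φ ∈ expSpace H) (p : ℝ≥0∞) :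
    MemLp φ p μ :=
  memLp_of_continuous_bounded (continuous_of_mem_expSpace hφ) (bounded_of_mem_expSpace hφ) p

omit [CompleteSpace H] in
theorem memLp_hessMat [IsFiniteMeasure μ] (hS : IsDiagSqrt e lam S) (hφ : φ ∈ expSpace H)
    (p : ℝ≥0∞) : MemLp (hessMat e lam φ) p μ :=
  memLp_of_continuous_bounded (continuous_hessMat hS hφ) (bounded_hessMat hS hφ) p

omit [SecondCountableTopology H] [CompleteSpace H] in
theorem HasGaussianCharFun.memLp_smoothL (hG : HasGaussianCharFun μ S)
    (hS : IsDiagSqrt e lam S) (hpos : ∀ k, 0 ≤ lam k) (hφ : φ ∈ expSpace H) :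
    MemLp (smoothL e lam φ) 2 μ := by
  have := hG.isProb
  obtain ⟨hc, C, hC⟩ := bounded_smoothL hS hpos hφ
  have h1 : MemLp (fun x : H => C * (1 + ‖x‖)) 2 μ :=
    ((memLp_const (1 : ℝ)).add hG.memLp_id.norm).const_mul C
  exact h1.of_le hc.aestronglyMeasurable
    (ae_of_all _ fun x => (hC x).trans (le_abs_self _))

theorem integral_sum_mul_sum {α : Type*} [MeasurableSpace α] {ν : Measure α} {n m : ℕ}
    {f : Fin n → α → ℝ} {g : Fin m → α → ℝ}
    (hfg : ∀ i j, Integrable (fun x => f i x * g j x) ν) :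
    ∫ x, (∑ i, f i x) * (∑ j, g j x) ∂ν = ∑ i, ∑ j, ∫ x, f i x * g j x ∂ν := by
  simp_rw [Finset.sum_mul_sum]
  rw [integral_finsetSum _ fun i _ => integrable_finsetSum _ fun j _ => hfg i j]
  exact Finset.sum_congr rfl fun i _ => integral_finsetSum _ fun j _ => hfg i j

omit [SecondCountableTopology H] [CompleteSpace H] in
theorem memLp_two_cosf [IsFiniteMeasure μ] (h : H) (a : ℝ) : MemLp (cosf h a) 2 μ :=
  memLp_of_mem_expSpace (cosf_mem h a) 2

omit [CompleteSpace H] in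
theorem HasGaussianCharFun.memLp_generator_cosf (hG : HasGaussianCharFun μ S) (h : H) (a : ℝ) :
    MemLp (fun x => -cosf h a x * ⟪S h, S h⟫ - cosf h (a + Real.pi / 2) x * ⟪x, h⟫) 2 μ := by
  have := hG.isProb
  refine ((memLp_two_cosf h a).neg.mul_const _).sub ?_
  refine (hG.memLp_inner h).of_le
    ((continuous_cosf _ _).mul (by fun_prop)).aestronglyMeasurable (ae_of_all _ fun x => ?_)
  rw [norm_mul]
  exact mul_le_of_le_one_left (norm_nonneg _) (abs_cosf_le _ _ _)

/-- Integration by parts on `ℰ₀(H)`. -/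
theorem HasGaussianCharFun.integral_inner_smoothGrad (hG : HasGaussianCharFun μ S)
    (hS : IsDiagSqrt e lam S) (hpos : ∀ k, 0 ≤ lam k)
    (hφ : φ ∈ expSpace H) (hψ : ψ ∈ expSpace H) :
    ∫ x, ⟪smoothGrad e lam φ x, smoothGrad e lam ψ x⟫ ∂μ =
      -∫ x, φ x * (2 * smoothL e lam ψ x) ∂μ := by
  have := hG.isProb
  obtain ⟨n, r, h, a, rfl⟩ := exists_trigSum hφ
  obtain ⟨m, s, k, b, rfl⟩ := exists_trigSum hψ
  simp_rw [smoothGrad_trigSum _ _ _ hS, smoothL_trigSum _ _ _ hS hpos, trigSum]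
  rw [integral_sum_mul_sum fun i j => ((memLp_two_cosf (h i) (a i)).const_mul (r i)).integrable_mul
    ((hG.memLp_generator_cosf (k j) (b j)).const_mul (s j))]
  simp_rw [sum_inner, inner_sum]
  have h1 : ∀ i j, Integrable (fun x => ⟪(r i * cosf (h i) (a i + Real.pi / 2) x) • S (h i),
      (s j * cosf (k j) (b j + Real.pi / 2) x) • S (k j)⟫) μ := fun i j => by
    have := ((memLp_two_cosf (μ := μ) (h i) (a i + Real.pi / 2)).integrable_mul
      (memLp_two_cosf (k j) (b j + Real.pi / 2))).const_mul (r i * s j * ⟪S (h i), S (k j)⟫)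
    refine this.congr (ae_of_all _ fun x => ?_)
    simp only [inner_smul_left, inner_smul_right, conj_trivial, Pi.mul_apply]
    ring
  rw [integral_finsetSum _ fun i _ => integrable_finsetSum _ fun j _ => h1 i j,
    ← Finset.sum_neg_distrib]
  refine Finset.sum_congr rfl fun i _ => ?_
  rw [integral_finsetSum _ fun j _ => h1 i j, ← Finset.sum_neg_distrib]
  refine Finset.sum_congr rfl fun j _ => ?_
  have h2 := hG.ibp_cosf (h i) (k j) (a i) (b j)
  have e1 : ∀ x, ⟪(r i * cosf (h i) (a i + Real.pi / 2) x) • S (h i),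
      (s j * cosf (k j) (b j + Real.pi / 2) x) • S (k j)⟫ = (r i * s j * ⟪S (h i), S (k j)⟫) *
      (cosf (h i) (a i + Real.pi / 2) x * cosf (k j) (b j + Real.pi / 2) x) := fun x => by
    simp only [inner_smul_left, inner_smul_right, conj_trivial]
    ring
  have e2 : ∀ x, r i * cosf (h i) (a i) x * (s j * (-cosf (k j) (b j) x * ⟪S (k j), S (k j)⟫ -
      cosf (k j) (b j + Real.pi / 2) x * ⟪x, k j⟫)) = (r i * s j) * (cosf (h i) (a i) x *
        (-cosf (k j) (b j) x * ⟪S (k j), S (k j)⟫ -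
          cosf (k j) (b j + Real.pi / 2) x * ⟪x, k j⟫)) := fun x => by ring
  simp_rw [e1, e2]
  rw [integral_const_mul, integral_const_mul, h2]
  ring

/-- The energy identity on `ℰ₀(H)`. -/
theorem HasGaussianCharFun.integral_smoothL_sq (hG : HasGaussianCharFun μ S)
    (hS : IsDiagSqrt e lam S) (hpos : ∀ k, 0 ≤ lam k) (hφ : φ ∈ expSpace H) :
    ∫ x, (2 * smoothL e lam φ x) ^ 2 ∂μ =
      ∫ x, ‖smoothGrad e lam φ x‖ ^ 2 ∂μ + ∫ x, ‖hessMat e lam φ x‖ ^ 2 ∂μ := by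
  have := hG.isProb
  obtain ⟨n, r, h, a, rfl⟩ := exists_trigSum hφ
  simp_rw [← real_inner_self_eq_norm_sq, smoothGrad_trigSum _ _ _ hS, hessMat_trigSum hS, sq,
    smoothL_trigSum _ _ _ hS hpos]
  rw [integral_sum_mul_sum fun i j => ((hG.memLp_generator_cosf (h i) (a i)).const_mul
    (r i)).integrable_mul ((hG.memLp_generator_cosf (h j) (a j)).const_mul (r j))]
  simp_rw [sum_inner, inner_sum]
  have e1 : ∀ i j x, ⟪(r i * cosf (h i) (a i + Real.pi / 2) x) • S (h i),
      (r j * cosf (h j) (a j + Real.pi / 2) x) • S (h j)⟫ = (r i * r j * ⟪S (h i), S (h j)⟫) *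
      (cosf (h i) (a i + Real.pi / 2) x * cosf (h j) (a j + Real.pi / 2) x) := fun i j x => by
    simp only [inner_smul_left, inner_smul_right, conj_trivial]
    ring
  have e2 : ∀ i j x, ⟪(r i * -cosf (h i) (a i) x) • tens e (S (h i)) (S (h i)),
      (r j * -cosf (h j) (a j) x) • tens e (S (h j)) (S (h j))⟫ =
      (r i * r j * ⟪S (h i), S (h j)⟫ ^ 2) *
      (cosf (h i) (a i) x * cosf (h j) (a j) x) := fun i j x => by
    simp only [inner_smul_left, inner_smul_right, conj_trivial, inner_tens]
    ring
  simp_rw [e1, e2]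
  have hcc : ∀ i j c d d', Integrable (fun x => c * (cosf (h i) d x * cosf (h j) d' x)) μ :=
    fun i j c d d' => ((memLp_two_cosf (h i) d).integrable_mul (memLp_two_cosf (h j) d')).const_mul c
  rw [integral_finsetSum _ fun i _ => integrable_finsetSum _ fun j _ => hcc _ _ _ _ _,
    integral_finsetSum _ fun i _ => integrable_finsetSum _ fun j _ => hcc _ _ _ _ _,
    ← Finset.sum_add_distrib]
  refine Finset.sum_congr rfl fun i _ => ?_
  rw [integral_finsetSum _ fun j _ => hcc _ _ _ _ _, integral_finsetSum _ fun j _ =>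
    hcc _ _ _ _ _, ← Finset.sum_add_distrib]
  refine Finset.sum_congr rfl fun j _ => ?_
  have e3 : ∀ x, r i * (-cosf (h i) (a i) x * ⟪S (h i), S (h i)⟫ -
      cosf (h i) (a i + Real.pi / 2) x * ⟪x, h i⟫) * (r j * (-cosf (h j) (a j) x *
      ⟪S (h j), S (h j)⟫ - cosf (h j) (a j + Real.pi / 2) x * ⟪x, h j⟫)) =
      (r i * r j) * ((-cosf (h i) (a i) x * ⟪S (h i), S (h i)⟫ -
      cosf (h i) (a i + Real.pi / 2) x * ⟪x, h i⟫) * (-cosf (h j) (a j) x *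
      ⟪S (h j), S (h j)⟫ - cosf (h j) (a j + Real.pi / 2) x * ⟪x, h j⟫)) := fun x => by ring
  simp_rw [e3]
  rw [integral_const_mul, integral_const_mul, integral_const_mul, hG.energy_cosf]
  ring

end Energy

/-! ### Passage to the closures of `𝓛₀` and `Q^{1/2}D`. -/

section Closure

variable {H : Type*} [NormedAddCommGroup H] [InnerProductSpace ℝ H]
  [MeasurableSpace H] [BorelSpace H] [SecondCountableTopology H] [CompleteSpace H]
  {ι : Type*} {e : HilbertBasis ι ℝ H} {lam : ι → ℝ}
  {μ : Measure H} {S : H →L[ℝ] H} {φ ψ : H → ℝ}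

/-- Drops the Hessian term from the energy identity. Applied to differences, it makes gradients
converge wherever `𝓛₀φ_n` does. -/
theorem HasGaussianCharFun.eLpNorm_smoothGrad_le (hG : HasGaussianCharFun μ S)
    (hS : IsDiagSqrt e lam S) (hpos : ∀ k, 0 ≤ lam k) (hφ : φ ∈ expSpace H) :
    eLpNorm (smoothGrad e lam φ) 2 μ ≤ 2 * eLpNorm (smoothL e lam φ) 2 μ := by
  have := hG.isProb
  have h1 := hG.integral_smoothL_sq hS hpos hφ
  have h2 : 0 ≤ ∫ x, ‖hessMat e lam φ x‖ ^ 2 ∂μ := integral_nonneg fun x => sq_nonneg _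
  have h3 := eLpNorm_two_le_of_integral_sq_le (memLp_smoothGrad hS hφ 2)
    ((hG.memLp_smoothL hS hpos hφ).const_mul 2) (by
      simp only [Real.norm_eq_abs, sq_abs]; linarith)
  refine h3.trans (le_of_eq ((eLpNorm_const_smul (2 : ℝ) (smoothL e lam φ) 2 μ).trans ?_))
  rw [Real.enorm_of_nonneg zero_le_two, ENNReal.ofReal_ofNat]

theorem HasGaussianCharFun.eLpNorm_hessMat_le (hG : HasGaussianCharFun μ S)
    (hS : IsDiagSqrt e lam S) (hpos : ∀ k, 0 ≤ lam k) (hφ : φ ∈ expSpace H) :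
    eLpNorm (hessMat e lam φ) 2 μ ≤ 2 * eLpNorm (smoothL e lam φ) 2 μ := by
  have := hG.isProb
  have h1 := hG.integral_smoothL_sq hS hpos hφ
  have h2 : 0 ≤ ∫ x, ‖smoothGrad e lam φ x‖ ^ 2 ∂μ := integral_nonneg fun x => sq_nonneg _
  have h3 := eLpNorm_two_le_of_integral_sq_le (memLp_hessMat hS hφ 2)
    ((hG.memLp_smoothL hS hpos hφ).const_mul 2) (by
      simp only [Real.norm_eq_abs, sq_abs]; linarith)
  refine h3.trans (le_of_eq ((eLpNorm_const_smul (2 : ℝ) (smoothL e lam φ) 2 μ).trans ?_))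
  rw [Real.enorm_of_nonneg zero_le_two, ENNReal.ofReal_ofNat]

/-- An element of the domain of `L₀` is in `W₀^{2,2}`, and the integration by parts formula
passes to the closure. -/
theorem HasGaussianCharFun.exists_isHess_of_isL0 (hG : HasGaussianCharFun μ S)
    (hS : IsDiagSqrt e lam S) (hpos : ∀ k, 0 ≤ lam k) {f u : H → ℝ} (hf : IsL0 μ e lam f u) :
    ∃ F B, IsGrad μ e lam 2 f F ∧ IsHess μ e lam f B ∧
      ∀ w ∈ expSpace H, ∫ x, ⟪smoothGrad e lam w x, F x⟫ ∂μ = -∫ x, w x * (2 * u x) ∂μ := by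
  have := hG.isProb
  obtain ⟨hfm, hum, φ, hφ, hφf, hφu⟩ := hf
  -- One sequence `φ` yields the limits of both derivatives; linearity turns the energy estimates
  -- into Cauchy estimates.
  obtain ⟨F, hF, hFlim⟩ := exists_eLpNorm_limit (fun n => memLp_smoothGrad (μ := μ) hS (hφ n) 2)
    (fun n => (hG.memLp_smoothL hS hpos (hφ n)).1) hum.1 hφu (C := 2) (by norm_num) fun n m => by
      simp_rw [← smoothGrad_sub hS (hφ n) (hφ m), ← smoothL_sub hS hpos (hφ n) (hφ m)]
      exact hG.eLpNorm_smoothGrad_le hS hpos (Submodule.sub_mem _ (hφ n) (hφ m))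
  obtain ⟨A, hA, hAlim⟩ := exists_eLpNorm_limit (fun n => memLp_hessMat (μ := μ) hS (hφ n) 2)
    (fun n => (hG.memLp_smoothL hS hpos (hφ n)).1) hum.1 hφu (C := 2) (by norm_num) fun n m => by
      simp_rw [← hessMat_sub hS (hφ n) (hφ m), ← smoothL_sub hS hpos (hφ n) (hφ m)]
      exact hG.eLpNorm_hessMat_le hS hpos (Submodule.sub_mem _ (hφ n) (hφ m))
  choose B hB using fun x => exists_op_of_hsMat e (A x)
  refine ⟨F, B, ⟨hfm, hF, φ, hφ, hφf, hFlim⟩, ⟨hfm, fun h k => ?_, F, hF, φ, hφ, hφf, hFlim, ?_⟩,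
    fun w hw => ?_⟩
  · simp_rw [hB]
    exact hA.1.inner aestronglyMeasurable_const
  · have h1 : Tendsto (fun n => eLpNorm (fun x => hessMat e lam (φ n) x - A x) 2 μ ^ 2) atTop
        (𝓝 0) := by simpa using ENNReal.Tendsto.pow hAlim (n := 2)
    refine h1.congr fun n => ?_
    rw [eLpNorm_two_sq]
    refine lintegral_congr fun x => ?_
    rw [enorm_sq_hsMat]
    simp_rw [hB, inner_tens_basis, lp.coeFn_sub, Pi.sub_apply, hessMat_apply hS (hφ n)]
  -- For fixed `w ∈ ℰ₀(H)`, both sides of the integration by parts are continuous for the `L²`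
  -- convergence at hand.
  · have h1 := tendsto_integral_inner (fun n => memLp_smoothGrad (μ := μ) hS (hφ n) 2) hF
      (memLp_smoothGrad hS hw 2) hFlim
    have h2 := tendsto_integral_inner (fun n => hG.memLp_smoothL hS hpos (hφ n)) hum
      (memLp_of_mem_expSpace hw 2) hφu
    have h3 : ∀ n, ∫ x, ⟪smoothGrad e lam (φ n) x, smoothGrad e lam w x⟫ ∂μ =
        -2 * ∫ x, ⟪smoothL e lam (φ n) x, w x⟫ ∂μ := fun n => by
      simp_rw [real_inner_comm (smoothGrad e lam w _)]
      rw [hG.integral_inner_smoothGrad hS hpos hw (hφ n), ← integral_const_mul, ← integral_neg]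
      refine integral_congr_ae (ae_of_all _ fun x => ?_)
      simp; ring
    simp_rw [h3] at h1
    have h4 := tendsto_nhds_unique h1 (h2.const_mul (-2))
    simp_rw [real_inner_comm (F _)]
    rw [h4, ← integral_const_mul, ← integral_neg]
    refine integral_congr_ae (ae_of_all _ fun x => ?_)
    simp; ring

/-- By integration by parts `G` is orthogonal to every gradient from `ℰ₀(H)`; being a limit of such
gradients, it is orthogonal to itself. -/
theorem HasGaussianCharFun.smoothGrad_closable (hG : HasGaussianCharFun μ S)
    (hS : IsDiagSqrt e lam S) (hpos : ∀ k, 0 ≤ lam k) {φ : ℕ → H → ℝ} {G : H → H}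
    (hφ : ∀ n, φ n ∈ expSpace H) (hGm : MemLp G 2 μ)
    (h0 : Tendsto (fun n => eLpNorm (φ n) 2 μ) atTop (𝓝 0))
    (h1 : Tendsto (fun n => eLpNorm (fun x => smoothGrad e lam (φ n) x - G x) 2 μ) atTop (𝓝 0)) :
    G =ᵐ[μ] 0 := by
  have := hG.isProb
  have h2 : ∀ w ∈ expSpace H, ∫ x, ⟪G x, smoothGrad e lam w x⟫ ∂μ = 0 := by
    intro w hw
    have h3 := tendsto_integral_inner (fun n => memLp_smoothGrad (μ := μ) hS (hφ n) 2) hGm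
      (memLp_smoothGrad hS hw 2) h1
    have h4 := tendsto_integral_inner (fun n => memLp_of_mem_expSpace (μ := μ) (hφ n) 2)
      (MemLp.zero (ε := ℝ)) ((hG.memLp_smoothL hS hpos hw).const_mul 2) (by simpa using h0)
    have h5 : ∀ n, ∫ x, ⟪smoothGrad e lam (φ n) x, smoothGrad e lam w x⟫ ∂μ =
        -∫ x, ⟪φ n x, 2 * smoothL e lam w x⟫ ∂μ := fun n => by
      rw [hG.integral_inner_smoothGrad hS hpos (hφ n) hw]
      congr 1
      refine integral_congr_ae (ae_of_all _ fun x => ?_)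
      simp; ring
    simp_rw [h5] at h3
    have h6 := tendsto_nhds_unique h3 h4.neg
    simpa using h6
  have h3 := tendsto_integral_inner (fun n => memLp_smoothGrad (μ := μ) hS (hφ n) 2) hGm hGm h1
  have h4 : ∫ x, ⟪G x, G x⟫ ∂μ = 0 := by
    refine tendsto_nhds_unique h3 (tendsto_const_nhds.congr fun n => ?_)
    rw [← h2 _ (hφ n)]
    exact integral_congr_ae (ae_of_all _ fun x => real_inner_comm _ _)
  have h5 := (integral_eq_zero_iff_of_nonneg (fun x => real_inner_self_nonneg)
    (integrable_inner_of_memLp_two hGm hGm)).1 h4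
  filter_upwards [h5] with x hx
  exact inner_self_eq_zero.1 hx

/-- Makes the gradients obtained from `L₀`, from the Hessian and from the choice in `grad`
interchangeable. -/
theorem HasGaussianCharFun.isGrad_unique (hG : HasGaussianCharFun μ S)
    (hS : IsDiagSqrt e lam S) (hpos : ∀ k, 0 ≤ lam k) {f : H → ℝ} {F F' : H → H}
    (hF : IsGrad μ e lam 2 f F) (hF' : IsGrad μ e lam 2 f F') : F =ᵐ[μ] F' := by
  have := hG.isProb
  obtain ⟨hfm, hFm, φ, hφ, hφf, hφF⟩ := hF
  obtain ⟨-, hFm', ψ, hψ, hψf, hψF⟩ := hF'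
  have h1 := hG.smoothGrad_closable hS hpos (φ := fun n => φ n - ψ n) (G := fun x => F x - F' x)
    (fun n => Submodule.sub_mem _ (hφ n) (hψ n)) (hFm.sub hFm') ?_ ?_
  · filter_upwards [h1] with x hx
    exact sub_eq_zero.1 hx
  · have h2 := hφf.add hψf
    rw [add_zero] at h2
    refine tendsto_of_tendsto_of_tendsto_of_le_of_le tendsto_const_nhds h2 (fun _ => zero_le)
      fun n => ?_
    have : φ n - ψ n = (fun x => φ n x - f x) - (fun x => ψ n x - f x) := by ext x; simp
    simp only [this]
    exact eLpNorm_sub_le ((memLp_of_mem_expSpace (hφ n) 2).1.sub hfm.1)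
      ((memLp_of_mem_expSpace (hψ n) 2).1.sub hfm.1) (by norm_num)
  · have h2 := hφF.add hψF
    rw [add_zero] at h2
    refine tendsto_of_tendsto_of_tendsto_of_le_of_le tendsto_const_nhds h2 (fun _ => zero_le)
      fun n => ?_
    have : (fun x => smoothGrad e lam (φ n - ψ n) x - (F x - F' x)) =
        (fun x => smoothGrad e lam (φ n) x - F x) - (fun x => smoothGrad e lam (ψ n) x - F' x) := by
      ext x; simp [smoothGrad_sub hS (hφ n) (hψ n)]; abel
    simp only [this]
    exact eLpNorm_sub_le ((memLp_smoothGrad hS (hφ n) 2).1.sub hFm.1)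
      ((memLp_smoothGrad hS (hψ n) 2).1.sub hFm'.1) (by norm_num)

end Closure

/-! ### Test functions as uniform limits from `ℰ₀(H)`. -/

section UniformClosure

variable {H : Type*} [NormedAddCommGroup H] [InnerProductSpace ℝ H] {ι : Type*}
  {e : HilbertBasis ι ℝ H} {lam : ι → ℝ} {S : H →L[ℝ] H}

/-- `(w, W)` is in the closure of the graph of `Q^{1/2} D` on `ℰ₀(H)` for uniform convergence. -/
def UnifGrad (e : HilbertBasis ι ℝ H) (lam : ι → ℝ) (w : H → ℝ) (W : H → H) : Prop :=
  ∀ ε > 0, ∃ φ ∈ expSpace H, ∀ x, |φ x - w x| ≤ ε ∧ ‖smoothGrad e lam φ x - W x‖ ≤ ε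

theorem UnifGrad.bounded [CompleteSpace H] {w : H → ℝ} {W : H → H} (h : UnifGrad e lam w W)
    (hS : IsDiagSqrt e lam S) : ∃ C, 0 ≤ C ∧ ∀ x, |w x| ≤ C ∧ ‖W x‖ ≤ C := by
  obtain ⟨φ, hφ, h1⟩ := h 1 one_pos
  obtain ⟨C, hC⟩ := bounded_of_mem_expSpace hφ
  obtain ⟨D, hD⟩ := bounded_smoothGrad hS hφ
  have hC0 := (abs_nonneg _).trans (hC 0)
  have hD0 := (norm_nonneg _).trans (hD 0)
  refine ⟨C + D + 1, by positivity, fun x => ⟨?_, ?_⟩⟩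
  · have := abs_sub_abs_le_abs_sub (w x) (φ x)
    rw [abs_sub_comm] at this
    linarith [(h1 x).1, hC x]
  · have := norm_sub_norm_le (W x) (smoothGrad e lam φ x)
    rw [norm_sub_rev] at this
    linarith [(h1 x).2, hD x]

theorem UnifGrad.continuous [CompleteSpace H] {w : H → ℝ} {W : H → H} (h : UnifGrad e lam w W)
    (hS : IsDiagSqrt e lam S) : Continuous w ∧ Continuous W := by
  constructor
  · refine continuous_of_uniform_approx_of_continuous fun u hu => ?_
    obtain ⟨ε, hε, hu⟩ := Metric.mem_uniformity_dist.1 hu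
    obtain ⟨φ, hφ, h1⟩ := h (ε / 2) (half_pos hε)
    refine ⟨φ, continuous_of_mem_expSpace hφ, fun x => hu ?_⟩
    rw [dist_comm, Real.dist_eq]
    linarith [(h1 x).1]
  · refine continuous_of_uniform_approx_of_continuous fun u hu => ?_
    obtain ⟨ε, hε, hu⟩ := Metric.mem_uniformity_dist.1 hu
    obtain ⟨φ, hφ, h1⟩ := h (ε / 2) (half_pos hε)
    refine ⟨_, continuous_smoothGrad hS hφ, fun x => hu ?_⟩
    rw [dist_comm, dist_eq_norm]
    linarith [(h1 x).2]

theorem UnifGrad.mul [CompleteSpace H] {w v : H → ℝ} {W V : H → H} (hw : UnifGrad e lam w W)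
    (hv : UnifGrad e lam v V) (hS : IsDiagSqrt e lam S) :
    UnifGrad e lam (fun x => w x * v x) (fun x => w x • V x + v x • W x) := by
  obtain ⟨C, hC0, hC⟩ := hw.bounded hS
  obtain ⟨D, hD0, hD⟩ := hv.bounded hS
  intro ε hε
  -- `δ ≤ 1` bounds the approximants by `C + 1` and `D + 1`. The four gradient errors then add up to
  -- `2(C + D + 1)δ`.
  set δ := min 1 (ε / (2 * (C + D + 1))) with hδ
  have hδ0 : 0 < δ := lt_min one_pos (by positivity)
  have hδ1 : δ ≤ 1 := min_le_left _ _
  have hδ2 : δ * (2 * (C + D + 1)) ≤ ε := by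
    rw [← le_div_iff₀ (by positivity)]; exact min_le_right _ _
  obtain ⟨φ, hφ, h1⟩ := hw δ hδ0
  obtain ⟨ψ, hψ, h2⟩ := hv δ hδ0
  have hφb : ∀ x, |φ x| ≤ C + 1 := fun x => by
    have := abs_sub_abs_le_abs_sub (φ x) (w x)
    linarith [(h1 x).1, (hC x).1]
  have hψb : ∀ x, |ψ x| ≤ D + 1 := fun x => by
    have := abs_sub_abs_le_abs_sub (ψ x) (v x)
    linarith [(h2 x).1, (hD x).1]
  refine ⟨_, mul_mem_expSpace hφ hψ, fun x => ⟨?_, ?_⟩⟩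
  · have e1 : φ x * ψ x - w x * v x = φ x * (ψ x - v x) + v x * (φ x - w x) := by ring
    rw [e1]
    refine (abs_add_le _ _).trans ?_
    rw [abs_mul, abs_mul]
    have a1 := mul_le_mul (hφb x) (h2 x).1 (abs_nonneg _) (by positivity)
    have a2 := mul_le_mul (hD x).1 (h1 x).1 (abs_nonneg _) hD0
    nlinarith
  · rw [smoothGrad_mul hS hφ hψ]
    have e1 : φ x • smoothGrad e lam ψ x + ψ x • smoothGrad e lam φ x -
        (w x • V x + v x • W x) = (φ x • (smoothGrad e lam ψ x - V x) + (φ x - w x) • V x) +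
        (ψ x • (smoothGrad e lam φ x - W x) + (ψ x - v x) • W x) := by
      simp only [smul_sub, sub_smul]; abel
    rw [e1]
    refine (norm_add_le _ _).trans ((add_le_add (norm_add_le _ _) (norm_add_le _ _)).trans ?_)
    simp only [norm_smul, Real.norm_eq_abs]
    have a1 := mul_le_mul (hφb x) (h2 x).2 (norm_nonneg _) (by positivity)
    have a2 := mul_le_mul (h1 x).1 (hD x).2 (norm_nonneg _) hδ0.le
    have a3 := mul_le_mul (hψb x) (h1 x).2 (norm_nonneg _) (by positivity)
    have a4 := mul_le_mul (h2 x).1 (hC x).2 (norm_nonneg _) hδ0.le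
    nlinarith

theorem exists_polynomial_derivative_eq (p : Polynomial ℝ) :
    ∃ P : Polynomial ℝ, Polynomial.derivative P = p := by
  induction p using Polynomial.induction_on' with
  | add p q hp hq =>
    obtain ⟨P, rfl⟩ := hp
    obtain ⟨R, rfl⟩ := hq
    exact ⟨P + R, Polynomial.derivative_add⟩
  | monomial n a =>
    refine ⟨Polynomial.monomial (n + 1) (a / (n + 1)), ?_⟩
    rw [Polynomial.derivative_monomial]
    congr 1
    push_cast
    field_simp

theorem polynomial_eval_mem_expSpace {φ : H → ℝ} (hφ : φ ∈ expSpace H) (p : Polynomial ℝ) :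
    (fun x => p.eval (φ x)) ∈ expSpace H := by
  have hpow : ∀ n : ℕ, (fun x => φ x ^ n) ∈ expSpace H := by
    intro n
    induction n with
    | zero => simpa using one_mem_expSpace
    | succ n ih => simpa only [pow_succ] using mul_mem_expSpace ih hφ
  induction p using Polynomial.induction_on' with
  | add p q hp hq =>
    simp only [Polynomial.eval_add]
    exact Submodule.add_mem _ hp hq
  | monomial n a =>
    simpa only [Polynomial.eval_monomial] using const_mul_mem_expSpace a (hpow n)

theorem smoothGrad_comp [CompleteSpace H] (hS : IsDiagSqrt e lam S) {φ : H → ℝ}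
    (hφ : φ ∈ expSpace H) {T : ℝ → ℝ} {t : ℝ} (x : H) (hT : HasDerivAt T t (φ x)) :
    smoothGrad e lam (fun x => T (φ x)) x = t • smoothGrad e lam φ x := by
  simp_rw [smoothGrad_eq hS]
  have h : HasFDerivAt (fun x => T (φ x)) (t • fderiv ℝ φ x) x :=
    hT.comp_hasFDerivAt x (hasFDerivAt_of_mem_expSpace hφ x)
  rw [h.fderiv]
  simp

/-- The chain rule, by uniform approximation of the derivative by polynomials. -/
theorem UnifGrad.comp [CompleteSpace H] (hS : IsDiagSqrt e lam S) {φ : H → ℝ}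
    (hφ : φ ∈ expSpace H) {T T' : ℝ → ℝ} (hT : ∀ t, HasDerivAt T (T' t) t)
    (hT' : Continuous T') :
    UnifGrad e lam (fun x => T (φ x)) (fun x => T' (φ x) • smoothGrad e lam φ x) := by
  obtain ⟨M, hM⟩ := bounded_of_mem_expSpace hφ
  obtain ⟨C, hC⟩ := bounded_smoothGrad hS hφ
  have hM0 := (abs_nonneg _).trans (hM 0)
  have hC0 := (norm_nonneg _).trans (hC 0)
  intro ε hε
  have hδ : 0 < ε / (M + C + 1) := by positivity
  set δ := ε / (M + C + 1)
  have hδε : δ * (M + C + 1) = ε := div_mul_cancel₀ _ (by positivity)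
  -- The values of `φ` lie in `[-M, M]`. Weierstrass is applied to `T'` rather than `T`, so that
  -- integrating controls both.
  obtain ⟨p, hp⟩ := exists_polynomial_near_of_continuousOn (-M) M T' hT'.continuousOn δ hδ
  obtain ⟨P₀, rfl⟩ := exists_polynomial_derivative_eq p
  -- The constant makes `P(0) = T(0)`; the mean value inequality then gives `|P - T| ≤ δM`.
  set P := P₀ + Polynomial.C (T 0 - P₀.eval 0) with hP
  have hPd : Polynomial.derivative P = Polynomial.derivative P₀ := by simp [hP]
  rw [← hPd] at hp
  have hmem : ∀ x, φ x ∈ Set.Icc (-M) M := fun x => abs_le.1 (hM x)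
  have hclose : ∀ t ∈ Set.Icc (-M) M, |P.eval t - T t| ≤ δ * M := by
    intro t ht
    have h0 : (0 : ℝ) ∈ Set.Icc (-M) M := ⟨by linarith, hM0⟩
    have := (convex_Icc (-M) M).norm_image_sub_le_of_norm_hasDerivWithin_le
      (f := fun t => P.eval t - T t) (fun s _ => ((P.hasDerivAt s).sub (hT s)).hasDerivWithinAt)
      (fun s hs => (hp s hs).le) h0 ht
    have e1 : P.eval 0 - T 0 = 0 := by simp [hP]
    rw [e1, sub_zero, sub_zero, Real.norm_eq_abs, Real.norm_eq_abs] at this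
    exact this.trans (mul_le_mul_of_nonneg_left (abs_le.2 ht) hδ.le)
  refine ⟨_, polynomial_eval_mem_expSpace hφ P, fun x => ⟨(hclose _ (hmem x)).trans ?_, ?_⟩⟩
  · nlinarith
  · rw [smoothGrad_comp hS hφ x (P.hasDerivAt _), ← sub_smul, norm_smul]
    have := mul_le_mul (hp _ (hmem x)).le (hC x) (norm_nonneg _) hδ.le
    rw [Real.norm_eq_abs]
    nlinarith

end UniformClosure

/-! ### Integration by parts against uniform limits. -/

section IntegrationByParts

variable {H : Type*} [NormedAddCommGroup H] [InnerProductSpace ℝ H]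
  [MeasurableSpace H] [BorelSpace H] [SecondCountableTopology H] [CompleteSpace H]
  {ι : Type*} {e : HilbertBasis ι ℝ H} {lam : ι → ℝ}
  {μ : Measure H} {S : H →L[ℝ] H}

/-- A uniform error `ε` in `w` and `W` changes the integral by at most `ε ∫ (|F| + |2u|) dμ`. -/
theorem UnifGrad.integral_inner [IsProbabilityMeasure μ] (hS : IsDiagSqrt e lam S)
    {F : H → H} {u : H → ℝ} (hF : MemLp F 2 μ) (hu : MemLp u 2 μ)
    (hibp : ∀ w ∈ expSpace H, ∫ x, ⟪smoothGrad e lam w x, F x⟫ ∂μ = -∫ x, w x * (2 * u x) ∂μ)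
    {w : H → ℝ} {W : H → H} (hw : UnifGrad e lam w W) :
    ∫ x, (⟪W x, F x⟫ + w x * (2 * u x)) ∂μ = 0 := by
  have hFi := (hF.integrable one_le_two).norm
  have hui := (hu.integrable one_le_two).const_mul 2
  obtain ⟨C, hC0, hC⟩ := hw.bounded hS
  have hWm : MemLp W 2 μ := memLp_of_continuous_bounded (hw.continuous hS).2
    ⟨C, fun x => (hC x).2⟩ 2
  have hwm : MemLp w 2 μ := memLp_of_continuous_bounded (hw.continuous hS).1
    ⟨C, fun x => (hC x).1⟩ 2
  have hWF := integrable_inner_of_memLp_two hWm hF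
  have hwu : Integrable (fun x => w x * (2 * u x)) μ := hwm.integrable_mul (hu.const_mul 2)
  set K := ∫ x, (‖F x‖ + ‖2 * u x‖) ∂μ with hK
  have hK0 : 0 ≤ K := integral_nonneg fun x => by positivity
  have hle : ∀ ε > 0, |∫ x, (⟪W x, F x⟫ + w x * (2 * u x)) ∂μ| ≤ ε * K := by
    intro ε hε
    obtain ⟨φ, hφ, h1⟩ := hw ε hε
    have hφF := integrable_inner_of_memLp_two (memLp_smoothGrad (μ := μ) hS hφ 2) hF
    have hφu : Integrable (fun x => φ x * (2 * u x)) μ :=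
      (memLp_of_mem_expSpace hφ 2).integrable_mul (hu.const_mul 2)
    have h0 : ∫ x, (⟪smoothGrad e lam φ x, F x⟫ + φ x * (2 * u x)) ∂μ = 0 := by
      rw [integral_add hφF hφu, hibp φ hφ, neg_add_cancel]
    have h2 : ∫ x, (⟪W x, F x⟫ + w x * (2 * u x)) ∂μ =
        ∫ x, ((⟪W x, F x⟫ + w x * (2 * u x)) -
          (⟪smoothGrad e lam φ x, F x⟫ + φ x * (2 * u x))) ∂μ := by
      have hA : Integrable (fun x => ⟪W x, F x⟫ + w x * (2 * u x)) μ := hWF.add hwu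
      have hB : Integrable (fun x => ⟪smoothGrad e lam φ x, F x⟫ + φ x * (2 * u x)) μ :=
        hφF.add hφu
      rw [integral_sub hA hB, h0, sub_zero]
    rw [h2, hK, ← integral_const_mul, ← Real.norm_eq_abs]
    have hA : Integrable (fun x => ‖F x‖ + ‖2 * u x‖) μ := hFi.add hui.norm
    refine norm_integral_le_of_norm_le (hA.const_mul ε) (ae_of_all _ fun x => ?_)
    have e1 : (⟪W x, F x⟫ + w x * (2 * u x)) - (⟪smoothGrad e lam φ x, F x⟫ + φ x * (2 * u x)) =
        -⟪smoothGrad e lam φ x - W x, F x⟫ + -((φ x - w x) * (2 * u x)) := by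
      rw [inner_sub_left]; ring
    rw [e1, mul_add]
    refine (norm_add_le _ _).trans ?_
    rw [norm_neg, norm_neg]
    refine add_le_add ((norm_inner_le_norm (𝕜 := ℝ) _ _).trans
      (mul_le_mul_of_nonneg_right (h1 x).2 (norm_nonneg _))) ?_
    rw [norm_mul]
    exact mul_le_mul_of_nonneg_right (h1 x).1 (norm_nonneg _)
  refine abs_nonpos_iff.1 (le_of_forall_pos_le_add fun ε hε => ?_)
  refine (hle (ε / (K + 1)) (by positivity)).trans ?_
  rw [zero_add, div_mul_eq_mul_div, div_le_iff₀ (by positivity)]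
  nlinarith

end IntegrationByParts

/-! ### Measurability and bounds for operator-valued functions. -/

section HilbertSchmidt

variable {H : Type*} [NormedAddCommGroup H] [InnerProductSpace ℝ H] [CompleteSpace H] {ι : Type*}

/-- The square of the Hilbert-Schmidt norm. -/
noncomputable def hsSq (e : HilbertBasis ι ℝ H) (C : H →L[ℝ] H) : ℝ≥0∞ :=
  ∑' h, ∑' k, ENNReal.ofReal (⟪C (e h), e k⟫ ^ 2)

/-- A finite Hilbert-Schmidt sum makes the coefficients an `ℓ²` matrix, whose operator agrees with
`C` on the basis. -/
theorem exists_hsMat_of_hsSq_ne_top (e : HilbertBasis ι ℝ H) {C : H →L[ℝ] H}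
    (hC : hsSq e C ≠ ∞) :
    ∃ A : HSMat ι, ‖A‖ₑ ^ 2 = hsSq e C ∧ ∀ v w, ⟪C v, w⟫ = ⟪A, tens e v w⟫ := by
  have hmem : Memℓp (fun p : ι × ι => ⟪C (e p.1), e p.2⟫) 2 := by
    refine memℓp_gen ?_
    rw [hsSq, ← ENNReal.tsum_prod' (f := fun p : ι × ι => ENNReal.ofReal (⟪C (e p.1), e p.2⟫ ^ 2))]
      at hC
    have h1 := ENNReal.summable_toReal hC
    refine h1.congr fun p => ?_
    rw [ENNReal.toReal_ofReal (sq_nonneg _)]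
    simp
  let A : HSMat ι := ⟨_, hmem⟩
  have hA : ∀ h k, A (h, k) = ⟪C (e h), e k⟫ := fun h k => rfl
  obtain ⟨B, hB⟩ := exists_op_of_hsMat e A
  have hBC : B = C := by
    refine HilbertBasis.ext_clm e fun h => HilbertBasis.ext_inner e fun k => ?_
    rw [real_inner_comm, hB, inner_tens_basis, hA, real_inner_comm]
  refine ⟨A, ?_, fun v w => by rw [← hB, hBC]⟩
  rw [enorm_sq_hsMat, hsSq]

theorem abs_inner_le_sqrt_hsSq (e : HilbertBasis ι ℝ H) {C : H →L[ℝ] H} (hC : hsSq e C ≠ ∞) (v w : H) :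
    |⟪C v, w⟫| ≤ Real.sqrt (hsSq e C).toReal * ‖v‖ * ‖w‖ := by
  obtain ⟨A, hA, hAC⟩ := exists_hsMat_of_hsSq_ne_top e hC
  have h1 : Real.sqrt (hsSq e C).toReal = ‖A‖ := by
    rw [← hA, ENNReal.toReal_pow, toReal_enorm, Real.sqrt_sq (norm_nonneg _)]
  rw [h1, hAC, mul_assoc, ← norm_tens e]
  exact norm_inner_le_norm (𝕜 := ℝ) _ _

variable [MeasurableSpace H] {μ : Measure H}

omit [CompleteSpace H] in
theorem aemeasurable_hsSq [Countable ι] (e : HilbertBasis ι ℝ H) {C : H → H →L[ℝ] H}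
    (hC : ∀ h k, AEStronglyMeasurable (fun x => ⟪C x (e h), e k⟫) μ) :
    AEMeasurable (fun x => hsSq e (C x)) μ :=
  AEMeasurable.tsum fun h => AEMeasurable.tsum fun k =>
    ((hC h k).aemeasurable.pow_const 2).ennreal_ofReal

/-- Only the coefficients of `C` are assumed measurable. The Hilbert-Schmidt norm, built from a
countable sum, is a measurable majorant of the operator norm. -/
theorem exists_memLp_bound_of_hsSq [Countable ι] (e : HilbertBasis ι ℝ H) {C : H → H →L[ℝ] H}
    (hC : ∀ h k, AEStronglyMeasurable (fun x => ⟪C x (e h), e k⟫) μ)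
    (hfin : ∫⁻ x, hsSq e (C x) ∂μ ≠ ∞) :
    ∃ b : H → ℝ, MemLp b 2 μ ∧ eLpNorm b 2 μ ^ 2 = ∫⁻ x, hsSq e (C x) ∂μ ∧ (∀ x, 0 ≤ b x) ∧
      ∀ᵐ x ∂μ, ∀ v w, |⟪C x v, w⟫| ≤ b x * ‖v‖ * ‖w‖ := by
  have hm := aemeasurable_hsSq e hC
  have hlt := ae_lt_top' hm hfin
  have hb : AEStronglyMeasurable (fun x => Real.sqrt (hsSq e (C x)).toReal) μ :=
    (hm.ennreal_toReal.sqrt).aestronglyMeasurable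
  have heq : eLpNorm (fun x => Real.sqrt (hsSq e (C x)).toReal) 2 μ ^ 2 =
      ∫⁻ x, hsSq e (C x) ∂μ := by
    rw [eLpNorm_two_sq]
    refine lintegral_congr_ae ?_
    filter_upwards [hlt] with x hx
    rw [Real.enorm_of_nonneg (Real.sqrt_nonneg _), ← ENNReal.ofReal_pow (Real.sqrt_nonneg _),
      Real.sq_sqrt ENNReal.toReal_nonneg, ENNReal.ofReal_toReal hx.ne]
  refine ⟨_, ⟨hb, ?_⟩, heq, fun x => Real.sqrt_nonneg _, ?_⟩
  · rw [lt_top_iff_ne_top]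
    intro h
    rw [h] at heq
    exact hfin (by rw [← heq]; simp)
  · filter_upwards [hlt] with x hx v w
    exact abs_inner_le_sqrt_hsSq e hx.ne v w

omit [CompleteSpace H] in
-- Expanding both arguments in the basis avoids measurability of `C` in operator norm.
theorem aestronglyMeasurable_inner_op [BorelSpace H] [Countable ι] (e : HilbertBasis ι ℝ H)
    {C : H → H →L[ℝ] H}
    (hC : ∀ h k, AEStronglyMeasurable (fun x => ⟪C x (e h), e k⟫) μ) {v w : H → H}
    (hv : AEStronglyMeasurable v μ) (hw : AEStronglyMeasurable w μ) :
    AEStronglyMeasurable (fun x => ⟪C x (v x), w x⟫) μ := by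
  have h1 : ∀ k, AEStronglyMeasurable (fun x => ⟪C x (v x), e k⟫) μ := fun k => by
    refine aestronglyMeasurable_of_tendsto_ae (u := (atTop : Filter (Finset ι)))
      (f := fun s x => ∑ h ∈ s, ⟪e h, v x⟫ * ⟪C x (e h), e k⟫) (fun s => ?_)
      (ae_of_all _ fun x => ?_)
    · exact Finset.aestronglyMeasurable_fun_sum _ fun h _ =>
        (aestronglyMeasurable_const.inner hv).mul (hC h k)
    · have := ((e.hasSum_repr (v x)).mapL (C x)).mapL (innerSL ℝ (e k))
      simp only [map_smul, smul_eq_mul, innerSL_apply_apply, e.repr_apply_apply] at this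
      simp only [real_inner_comm (e k)]
      exact this
  refine aestronglyMeasurable_of_tendsto_ae (u := (atTop : Filter (Finset ι)))
    (f := fun s x => ∑ k ∈ s, ⟪C x (v x), e k⟫ * ⟪e k, w x⟫) (fun s => ?_)
    (ae_of_all _ fun x => e.hasSum_inner_mul_inner (C x (v x)) (w x))
  exact Finset.aestronglyMeasurable_fun_sum _ fun k _ =>
    (h1 k).mul (aestronglyMeasurable_const.inner hw)

end HilbertSchmidt

/-! ### Almost everywhere approximation of `g` and its derivatives. -/

section Approximation

variable {H : Type*} [NormedAddCommGroup H] [InnerProductSpace ℝ H]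
  [MeasurableSpace H] [BorelSpace H] [SecondCountableTopology H] [CompleteSpace H]
  {ι : Type*} {e : HilbertBasis ι ℝ H} {lam : ι → ℝ}
  {μ : Measure H} {S : H →L[ℝ] H}

theorem exists_subseq_tendsto_ae {α E : Type*} [MeasurableSpace α] {ν : Measure α}
    [NormedAddCommGroup E] {p : ℝ≥0∞} (hp : p ≠ 0) {f : ℕ → α → E} {F : α → E}
    (hf : ∀ n, AEStronglyMeasurable (f n) ν) (hF : AEStronglyMeasurable F ν)
    (h : Tendsto (fun n => eLpNorm (fun x => f n x - F x) p ν) atTop (𝓝 0)) :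
    ∃ ns : ℕ → ℕ, StrictMono ns ∧ ∀ᵐ x ∂ν, Tendsto (fun i => f (ns i) x) atTop (𝓝 (F x)) :=
  (tendstoInMeasure_of_tendsto_eLpNorm hp hf hF h).exists_seq_tendsto_ae

/-- The sequence `γ` approximates `g`, with first derivative `F` and second derivative `B`, and `b`,
`β n` bound the norms of `B` and of the error of the second derivative of `γ n`. -/
structure HessApprox (μ : Measure H) (e : HilbertBasis ι ℝ H) (lam : ι → ℝ) (S : H →L[ℝ] H)
    (g : H → ℝ) (F : H → H) (B : H → H →L[ℝ] H) (γ : ℕ → H → ℝ) (b : H → ℝ) (β : ℕ → H → ℝ) :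
    Prop where
  mem : ∀ n, γ n ∈ expSpace H
  tendsto : ∀ᵐ x ∂μ, Tendsto (fun n => γ n x) atTop (𝓝 (g x))
  tendsto_grad : ∀ᵐ x ∂μ, Tendsto (fun n => smoothGrad e lam (γ n) x) atTop (𝓝 (F x))
  measurable : ∀ h k, AEStronglyMeasurable (fun x => ⟪B x (e h), e k⟫) μ
  memLp_bound : MemLp b 2 μ
  bound_nonneg : ∀ x, 0 ≤ b x
  bound : ∀ᵐ x ∂μ, ∀ v w, |⟪B x v, w⟫| ≤ b x * ‖v‖ * ‖w‖
  memLp_err : ∀ n, MemLp (β n) 2 μ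
  err_nonneg : ∀ n x, 0 ≤ β n x
  tendsto_err : Tendsto (fun n => eLpNorm (β n) 2 μ) atTop (𝓝 0)
  err : ∀ n, ∀ᵐ x ∂μ, ∀ v w, |⟪(hessOp S (γ n) x - B x) v, w⟫| ≤ β n x * ‖v‖ * ‖w‖

omit [MeasurableSpace H] [BorelSpace H] [SecondCountableTopology H] in
theorem hsSq_hessOp (hS : IsDiagSqrt e lam S) {φ : H → ℝ} (hφ : φ ∈ expSpace H) (x : H) :
    hsSq e (hessOp S φ x) = ‖hessMat e lam φ x‖ₑ ^ 2 := by
  rw [enorm_sq_hsMat, hsSq]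
  simp_rw [hessMat_apply hS hφ, inner_hessOp hS, smoothHess_eq hS]

omit [MeasurableSpace H] [BorelSpace H] [SecondCountableTopology H] [CompleteSpace H] in
theorem hsSq_le (C D : H →L[ℝ] H) : hsSq e C ≤ 2 * hsSq e (D - C) + 2 * hsSq e D := by
  simp only [hsSq, ← ENNReal.tsum_mul_left, ← ENNReal.tsum_add]
  refine ENNReal.tsum_le_tsum fun h => ENNReal.tsum_le_tsum fun k => ?_
  rw [← ENNReal.ofReal_ofNat 2, ← ENNReal.ofReal_mul zero_le_two, ← ENNReal.ofReal_mul zero_le_two,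
    ← ENNReal.ofReal_add (by positivity) (by positivity)]
  refine ENNReal.ofReal_le_ofReal ?_
  rw [sub_apply, inner_sub_left]
  -- With `c`, `d` the entries of `C`, `D`: `2(d - c)² + 2d² - c² = (2d - c)²`.
  nlinarith [sq_nonneg (2 * ⟪D (e h), e k⟫ - ⟪C (e h), e k⟫)]

theorem exists_hessApprox [IsProbabilityMeasure μ] [Countable ι] (hS : IsDiagSqrt e lam S)
    {g : H → ℝ} {B : H → H →L[ℝ] H} (hB : IsHess μ e lam g B) :
    ∃ F γ b β, IsGrad μ e lam 2 g F ∧ HessApprox μ e lam S g F B γ b β := by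
  obtain ⟨hg, hBm, F, hF, φ, hφ, hφg, hφF, hφB⟩ := hB
  refine ⟨F, ?_⟩
  have hsq : ∀ n x, ∑' h, ∑' k, ENNReal.ofReal ((smoothHess e lam (φ n) x h k -
      ⟪B x (e h), e k⟫) ^ 2) = hsSq e (hessOp S (φ n) x - B x) := fun n x => by
    simp_rw [hsSq, sub_apply, inner_sub_left, inner_hessOp hS, smoothHess_eq hS]
  simp_rw [hsq] at hφB
  have hm : ∀ n h k, AEStronglyMeasurable (fun x => ⟪(hessOp S (φ n) x - B x) (e h), e k⟫) μ :=
    fun n h k => by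
      simp_rw [sub_apply, inner_sub_left]
      exact (continuous_hessOp hS (hφ n) _ _).aestronglyMeasurable.sub (hBm h k)
  obtain ⟨N, hN⟩ := eventually_atTop.1 (hφB.eventually_lt_const ENNReal.zero_lt_top)
  obtain ⟨ns, hns, hns1⟩ := exists_subseq_tendsto_ae two_ne_zero
    (fun n => (memLp_of_mem_expSpace (μ := μ) (hφ n) 2).1) hg.1 hφg
  have hφF' := hφF.comp hns.tendsto_atTop
  obtain ⟨ms, hms, hms1⟩ := exists_subseq_tendsto_ae two_ne_zero
    (f := fun n => smoothGrad e lam (φ (ns n)))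
    (fun n => (memLp_smoothGrad (μ := μ) hS (hφ _) 2).1) hF.1 hφF'
  -- Two successive extractions give a.e. convergence of the functions and then of the gradients.
  -- The shift by `N` makes every Hessian error finite.
  let idx : ℕ → ℕ := fun n => ns (ms (n + N))
  have hidx : Tendsto idx atTop atTop :=
    hns.tendsto_atTop.comp (hms.tendsto_atTop.comp (tendsto_add_atTop_nat N))
  have hidxN : ∀ n, N ≤ idx n := fun n =>
    (Nat.le_add_left N n).trans ((hms.le_apply).trans hns.le_apply)
  -- `B` is at finite Hilbert-Schmidt distance from the bounded Hessian of `φ N`.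
  have hBfin : ∫⁻ x, hsSq e (B x) ∂μ ≠ ∞ := by
    have h1 : ∫⁻ x, hsSq e (hessOp S (φ N) x) ∂μ ≠ ∞ := by
      simp_rw [hsSq_hessOp hS (hφ N)]
      rw [← eLpNorm_two_sq]
      exact ENNReal.pow_ne_top (memLp_hessMat hS (hφ N) 2).2.ne
    refine ne_top_of_le_ne_top ?_ (lintegral_mono fun x => hsSq_le (B x) (hessOp S (φ N) x))
    rw [lintegral_add_left' ((aemeasurable_hsSq e (hm N)).const_mul 2),
      lintegral_const_mul' _ _ ENNReal.ofNat_ne_top, lintegral_const_mul' _ _ ENNReal.ofNat_ne_top]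
    exact ENNReal.add_ne_top.2 ⟨ENNReal.mul_ne_top ENNReal.ofNat_ne_top (hN N le_rfl).ne,
      ENNReal.mul_ne_top ENNReal.ofNat_ne_top h1⟩
  obtain ⟨b, hb, -, hb0, hbB⟩ := exists_memLp_bound_of_hsSq e hBm hBfin
  choose β hβ hβ2 hβ0 hβB using fun n => exists_memLp_bound_of_hsSq e (hm (idx n))
    (hN _ (hidxN n)).ne
  refine ⟨fun n => φ (idx n), b, β, ⟨hg, hF, φ, hφ, hφg, hφF⟩, fun n => hφ _, ?_, ?_, hBm, hb, hb0,
    hbB, hβ, hβ0, ?_, hβB⟩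
  · filter_upwards [hns1] with x hx
    exact hx.comp (hms.tendsto_atTop.comp (tendsto_add_atTop_nat N))
  · filter_upwards [hms1] with x hx
    exact hx.comp (tendsto_add_atTop_nat N)
  · have h1 := hφB.comp hidx
    have h2 : Tendsto (fun n => eLpNorm (β n) 2 μ ^ 2) atTop (𝓝 0) := by
      simp_rw [hβ2]; exact h1
    have h3 := (ENNReal.continuous_rpow_const (y := 1 / 2)).tendsto 0 |>.comp h2
    rw [ENNReal.zero_rpow_of_pos (by norm_num)] at h3
    refine h3.congr fun n => ?_
    rw [Function.comp_apply, ← ENNReal.rpow_natCast, ← ENNReal.rpow_mul]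
    norm_num

end Approximation

/-! ### Removing the approximations of `g` and `ρ`. -/

section Limits

/-- Moves the weight `s` from the growing factor `t` to the decaying factor `k`. Every dominated
convergence bound below has this form. -/
theorem abs_mul_mul_mul_le {a k v t A K D s r : ℝ} (ha : |a| ≤ A) (hk : |k| * s ≤ K)
    (hv : |v| ≤ D) (ht : |t| ≤ s * r) (hs : 0 ≤ s) (hr : 0 ≤ r) :
    |a * k * v * t| ≤ A * K * D * r := by
  have hA := (abs_nonneg _).trans ha
  have hD := (abs_nonneg _).trans hv
  have hk0 : 0 ≤ |k| * s := mul_nonneg (abs_nonneg _) hs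
  calc |a * k * v * t| = |a| * |k| * |v| * |t| := by simp only [abs_mul]
    _ ≤ A * |k| * D * (s * r) := by gcongr
    _ = A * (|k| * s) * D * r := by ring
    _ ≤ A * K * D * r := by gcongr

/-- Dominated convergence for `M n`, combined with an error `E n` that is only small in `L¹`. -/
theorem integral_eq_zero_of_approx {α : Type*} [MeasurableSpace α] {μ : Measure α}
    {M E : ℕ → α → ℝ} {L bound : α → ℝ} {ε : ℕ → ℝ≥0∞}
    (hM : ∀ n, AEStronglyMeasurable (M n) μ) (hbound : ∀ n, ∀ᵐ x ∂μ, |M n x| ≤ bound x)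
    (hbi : Integrable bound μ) (hlim : ∀ᵐ x ∂μ, Tendsto (fun n => M n x) atTop (𝓝 (L x)))
    (hE : ∀ n, AEStronglyMeasurable (E n) μ) (hEε : ∀ n, ∫⁻ x, ‖E n x‖ₑ ∂μ ≤ ε n)
    (hε : ∀ n, ε n ≠ ∞) (hε0 : Tendsto ε atTop (𝓝 0))
    (hz : ∀ n, ∫ x, (M n x + E n x) ∂μ = 0) : ∫ x, L x ∂μ = 0 := by
  have hMi : ∀ n, Integrable (M n) μ := fun n => hbi.mono' (hM n) (hbound n)
  have hEi : ∀ n, Integrable (E n) μ := fun n =>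
    ⟨hE n, (hEε n).trans_lt (lt_top_iff_ne_top.2 (hε n))⟩
  have h1 := tendsto_integral_of_dominated_convergence bound hM hbi hbound hlim
  have h2 : Tendsto (fun n => ∫ x, E n x ∂μ) atTop (𝓝 0) := by
    rw [tendsto_zero_iff_enorm_tendsto_zero]
    exact tendsto_of_tendsto_of_tendsto_of_le_of_le tendsto_const_nhds hε0 (fun _ => zero_le)
      fun n => (enorm_integral_le_lintegral_enorm _).trans (hEε n)
  refine tendsto_nhds_unique h1 ?_
  have h3 : ∀ n, ∫ x, M n x ∂μ = -∫ x, E n x ∂μ := fun n => by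
    have := hz n
    rw [integral_add (hMi n) (hEi n)] at this
    linarith
  simp_rw [h3]
  simpa using h2.neg

variable {H : Type*} [NormedAddCommGroup H] [InnerProductSpace ℝ H]
  [MeasurableSpace H] [BorelSpace H] [SecondCountableTopology H] [CompleteSpace H]
  {ι : Type*} [Countable ι] {e : HilbertBasis ι ℝ H} {lam : ι → ℝ}
  {μ : Measure H} {S : H →L[ℝ] H} {g : H → ℝ} {F : H → H} {B : H → H →L[ℝ] H} {γ : ℕ → H → ℝ}
  {b : H → ℝ} {β : ℕ → H → ℝ} {u : H → ℝ} {φ φ' κ κ' T T' : ℝ → ℝ} {Cφ Cκ CT : ℝ}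

/-- Tests with `φ(γ_n) κ(|Q^{1/2}Dγ_n|²) v`. The Hessian of `γ_n` is split into `B`, treated by
domination, and an error treated in `L¹`; the decay of `κ` and `κ'` absorbs the gradient of `γ_n`.
The factor `1` gives all four terms the shape of `abs_mul_mul_mul_le`. -/
theorem integral_eq_zero_of_unifGrad [IsProbabilityMeasure μ] (hS : IsDiagSqrt e lam S)
    (hA : HessApprox μ e lam S g F B γ b β)
    (hF : MemLp F 2 μ) (hu : MemLp u 2 μ)
    (hibp : ∀ w ∈ expSpace H, ∫ x, ⟪smoothGrad e lam w x, F x⟫ ∂μ = -∫ x, w x * (2 * u x) ∂μ)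
    (hφ : ∀ t, HasDerivAt φ (φ' t) t) (hφ' : Continuous φ') (hφb : ∀ t, |φ t| ≤ Cφ)
    (hφb' : ∀ t, |φ' t| ≤ Cφ)
    (hκ : ∀ t, HasDerivAt κ (κ' t) t) (hκ' : Continuous κ')
    (hκb : ∀ s, 0 ≤ s → |κ s| * (1 + s) ≤ Cκ) (hκb' : ∀ s, 0 ≤ s → |κ' s| * (1 + s) ≤ Cκ)
    {v : H → ℝ} {V : H → H} (hv : UnifGrad e lam v V) :
    ∫ x, (φ' (g x) * κ (‖F x‖ ^ 2) * v x * ‖F x‖ ^ 2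
      + φ (g x) * κ' (‖F x‖ ^ 2) * v x * (2 * ⟪B x (F x), F x⟫)
      + φ (g x) * κ (‖F x‖ ^ 2) * 1 * ⟪V x, F x⟫
      + φ (g x) * κ (‖F x‖ ^ 2) * v x * (2 * u x)) ∂μ = 0 := by
  have hφc : Continuous φ := continuous_iff_continuousAt.2 fun t => (hφ t).continuousAt
  have hκc : Continuous κ := continuous_iff_continuousAt.2 fun t => (hκ t).continuousAt
  obtain ⟨D, hD0, hD⟩ := hv.bounded hS
  have hvc := hv.continuous hS
  set G : ℕ → H → H := fun n => smoothGrad e lam (γ n) with hG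
  have hGc : ∀ n, Continuous (G n) := fun n => continuous_smoothGrad hS (hA.mem n)
  have hγc : ∀ n, Continuous (γ n) := fun n => continuous_of_mem_expSpace (hA.mem n)
  have hq : ∀ n, Continuous fun x => ‖G n x‖ ^ 2 := fun n => (hGc n).norm.pow 2
  have hBG : ∀ n, AEStronglyMeasurable (fun x => ⟪B x (G n x), F x⟫) μ := fun n =>
    aestronglyMeasurable_inner_op e hA.measurable (hGc n).aestronglyMeasurable hF.1
  have hBnG : ∀ n, AEStronglyMeasurable (fun x => ⟪(hessOp S (γ n) x - B x) (G n x), F x⟫) μ :=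
    fun n => by
      refine aestronglyMeasurable_inner_op e (fun h k => ?_) (hGc n).aestronglyMeasurable hF.1
      simp_rw [sub_apply, inner_sub_left]
      exact (continuous_hessOp hS (hA.mem n) _ _).aestronglyMeasurable.sub (hA.measurable h k)
  have hCφ : 0 ≤ Cφ := (abs_nonneg _).trans (hφb 0)
  have hCκ : 0 ≤ Cκ := (by positivity : 0 ≤ |κ 0| * (1 + 0)).trans (hκb 0 le_rfl)
  -- Uses `‖z‖ ≤ 1 + ‖z‖²`: decay of order `1/s` at `s = ‖z‖²` absorbs a factor `‖z‖`.
  have hdecay : ∀ {f : ℝ → ℝ}, (∀ s, 0 ≤ s → |f s| * (1 + s) ≤ Cκ) → ∀ z : H,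
      |f (‖z‖ ^ 2)| * ‖z‖ ≤ Cκ ∧ |f (‖z‖ ^ 2)| * 1 ≤ Cκ := by
    intro f hf z
    have h1 := hf (‖z‖ ^ 2) (sq_nonneg _)
    constructor
    · refine le_trans (mul_le_mul_of_nonneg_left ?_ (abs_nonneg _)) h1
      nlinarith [sq_nonneg (‖z‖ - 1), sq_nonneg ‖z‖]
    · refine le_trans (mul_le_mul_of_nonneg_left ?_ (abs_nonneg _)) h1
      nlinarith [sq_nonneg ‖z‖]
  have hbF : Integrable (fun x => b x * ‖F x‖) μ := hA.memLp_bound.integrable_mul hF.norm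
  have hFi := (hF.integrable one_le_two).norm
  have hui := (hu.integrable one_le_two).norm
  refine integral_eq_zero_of_approx (μ := μ)
    (M := fun n x => φ' (γ n x) * κ (‖G n x‖ ^ 2) * v x * ⟪G n x, F x⟫
      + φ (γ n x) * κ' (‖G n x‖ ^ 2) * v x * (2 * ⟪B x (G n x), F x⟫)
      + φ (γ n x) * κ (‖G n x‖ ^ 2) * 1 * ⟪V x, F x⟫
      + φ (γ n x) * κ (‖G n x‖ ^ 2) * v x * (2 * u x))
    (E := fun n x => φ (γ n x) * κ' (‖G n x‖ ^ 2) * v x *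
      (2 * ⟪(hessOp S (γ n) x - B x) (G n x), F x⟫))
    (bound := fun x => Cφ * Cκ * D * ‖F x‖ + Cφ * Cκ * D * (2 * (b x * ‖F x‖)) +
      Cφ * Cκ * 1 * (D * ‖F x‖) + Cφ * Cκ * D * (2 * ‖u x‖))
    (ε := fun n => ENNReal.ofReal (Cφ * Cκ * D * 2) * (eLpNorm (β n) 2 μ * eLpNorm F 2 μ))
    (fun n => ?_) (fun n => ?_) ?_ ?_ (fun n => ?_) (fun n => ?_) (fun n => ?_) ?_ (fun n => ?_)
  · have a1 := (hφ'.comp (hγc n)).aestronglyMeasurable (μ := μ)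
    have a2 := (hφc.comp (hγc n)).aestronglyMeasurable (μ := μ)
    have a3 := (hκc.comp (hq n)).aestronglyMeasurable (μ := μ)
    have a4 := (hκ'.comp (hq n)).aestronglyMeasurable (μ := μ)
    have a5 := hvc.1.aestronglyMeasurable (μ := μ)
    exact ((((a1.mul a3).mul a5).mul ((hGc n).aestronglyMeasurable.inner hF.1)).add
      (((a2.mul a4).mul a5).mul ((hBG n).const_mul 2))).add
      (((a2.mul a3).mul aestronglyMeasurable_const).mul
        (hvc.2.aestronglyMeasurable.inner hF.1)) |>.add
      (((a2.mul a3).mul a5).mul (hu.1.const_mul 2))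
  · filter_upwards [hA.bound] with x hx
    refine (abs_add_le _ _).trans (add_le_add ((abs_add_le _ _).trans (add_le_add
      ((abs_add_le _ _).trans (add_le_add ?_ ?_)) ?_)) ?_)
    · exact abs_mul_mul_mul_le (hφb' _) (hdecay hκb _).1 (hD x).1
        (abs_real_inner_le_norm _ _) (norm_nonneg _) (norm_nonneg _)
    · refine abs_mul_mul_mul_le (hφb _) (hdecay hκb' _).1 (hD x).1 ?_ (norm_nonneg (G n x))
        (mul_nonneg zero_le_two (mul_nonneg (hA.bound_nonneg x) (norm_nonneg _)))
      rw [abs_mul, abs_two]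
      linarith [hx (G n x) (F x)]
    · refine abs_mul_mul_mul_le (hφb _) (hdecay hκb _).2 (abs_one.le) ?_ zero_le_one
        (mul_nonneg hD0 (norm_nonneg _))
      rw [one_mul]
      exact (abs_real_inner_le_norm _ _).trans
        (mul_le_mul_of_nonneg_right (hD x).2 (norm_nonneg _))
    · refine abs_mul_mul_mul_le (hφb _) (hdecay hκb _).2 (hD x).1 ?_ zero_le_one (by positivity)
      rw [abs_mul, abs_two, one_mul, Real.norm_eq_abs]
  · exact (((hFi.const_mul _).add ((hbF.const_mul 2).const_mul _)).add
      ((hFi.const_mul D).const_mul _)).add ((hui.const_mul 2).const_mul _)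
  · filter_upwards [hA.tendsto, hA.tendsto_grad] with x h1 h2
    have h3 : Tendsto (fun n => ‖G n x‖ ^ 2) atTop (𝓝 (‖F x‖ ^ 2)) := h2.norm.pow 2
    have a1 := (hφ'.tendsto _).comp h1
    have a2 := (hφc.tendsto _).comp h1
    have a3 := (hκc.tendsto _).comp h3
    have a4 := (hκ'.tendsto _).comp h3
    have a6 : Tendsto (fun n => ⟪G n x, F x⟫) atTop (𝓝 (‖F x‖ ^ 2)) := by
      rw [← real_inner_self_eq_norm_sq]
      exact h2.inner tendsto_const_nhds
    have a7 : Tendsto (fun n => ⟪B x (G n x), F x⟫) atTop (𝓝 ⟪B x (F x), F x⟫) :=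
      (((B x).continuous.tendsto _).comp h2).inner tendsto_const_nhds
    exact ((((a1.mul a3).mul_const _).mul a6).add (((a2.mul a4).mul_const _).mul
      (a7.const_mul 2))).add (((a2.mul a3).mul_const _).mul_const _) |>.add
      (((a2.mul a3).mul_const _).mul_const _)
  · have a2 := (hφc.comp (hγc n)).aestronglyMeasurable (μ := μ)
    have a4 := (hκ'.comp (hq n)).aestronglyMeasurable (μ := μ)
    exact ((a2.mul a4).mul hvc.1.aestronglyMeasurable).mul ((hBnG n).const_mul 2)
  · have hle : ∀ᵐ x ∂μ, ‖φ (γ n x) * κ' (‖G n x‖ ^ 2) * v x *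
        (2 * ⟪(hessOp S (γ n) x - B x) (G n x), F x⟫)‖ₑ ≤
        ENNReal.ofReal (Cφ * Cκ * D * 2) * (‖β n x‖ₑ * ‖F x‖ₑ) := by
      filter_upwards [hA.err n] with x hx
      have : |φ (γ n x) * κ' (‖G n x‖ ^ 2) * v x *
        (2 * ⟪(hessOp S (γ n) x - B x) (G n x), F x⟫)| ≤ Cφ * Cκ * D * (2 * (β n x * ‖F x‖)) := by
        refine abs_mul_mul_mul_le (hφb _) (hdecay hκb' _).1 (hD x).1 ?_ (norm_nonneg (G n x))
          (mul_nonneg zero_le_two (mul_nonneg (hA.err_nonneg n x) (norm_nonneg _)))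
        rw [abs_mul, abs_two]
        linarith [hx (G n x) (F x)]
      rw [← ofReal_norm (F x), Real.enorm_of_nonneg (hA.err_nonneg n x),
        ← ENNReal.ofReal_mul (hA.err_nonneg n x), ← ENNReal.ofReal_mul (by positivity),
        ← ofReal_norm, Real.norm_eq_abs]
      exact ENNReal.ofReal_le_ofReal (this.trans (le_of_eq (by ring)))
    refine (lintegral_mono_ae hle).trans ?_
    rw [lintegral_const_mul' _ _ ENNReal.ofReal_ne_top]
    gcongr
    exact lintegral_enorm_mul_enorm_le (hA.memLp_err n).1 hF.1
  · exact ENNReal.mul_ne_top ENNReal.ofReal_ne_top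
      (ENNReal.mul_ne_top (hA.memLp_err n).2.ne hF.2.ne)
  · have h1 := ENNReal.Tendsto.const_mul (ENNReal.Tendsto.mul_const hA.tendsto_err
      (Or.inr hF.2.ne)) (Or.inr (ENNReal.ofReal_ne_top (r := Cφ * Cκ * D * 2)))
    simpa using h1
  -- The squared gradient is in `ℰ₀(H)`, so the test function is a product of three functions in the
  -- uniform closure.
  · have hqmem := inner_smoothGrad_mem hS (hA.mem n) (hA.mem n)
    have hw := ((UnifGrad.comp hS (hA.mem n) hφ hφ').mul (UnifGrad.comp hS hqmem hκ hκ') hS).mul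
      hv hS
    rw [← hw.integral_inner hS hF hu hibp]
    refine integral_congr_ae (ae_of_all _ fun x => ?_)
    simp only [smoothGrad_norm_sq hS (hA.mem n)]
    simp only [inner_add_left, inner_smul_left, conj_trivial, sub_apply, inner_sub_left,
      real_inner_self_eq_norm_sq, hG]
    ring

/-- Takes `v = T(r_n)` with `r_n → ρ`. Convergence of gradients in `L¹` is enough, although `F` is
only in `L²`, because `κ(|F|²)|F|` is bounded. -/
theorem integral_eq_zero_of_isGrad_one [IsProbabilityMeasure μ] (hS : IsDiagSqrt e lam S)
    (hA : HessApprox μ e lam S g F B γ b β) (hg : AEStronglyMeasurable g μ)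
    (hF : MemLp F 2 μ) (hu : MemLp u 2 μ)
    (hibp : ∀ w ∈ expSpace H, ∫ x, ⟪smoothGrad e lam w x, F x⟫ ∂μ = -∫ x, w x * (2 * u x) ∂μ)
    (hφ : ∀ t, HasDerivAt φ (φ' t) t) (hφ' : Continuous φ') (hφb : ∀ t, |φ t| ≤ Cφ)
    (hφb' : ∀ t, |φ' t| ≤ Cφ)
    (hκ : ∀ t, HasDerivAt κ (κ' t) t) (hκ' : Continuous κ')
    (hκb : ∀ s, 0 ≤ s → |κ s| * (1 + s) ≤ Cκ) (hκb' : ∀ s, 0 ≤ s → |κ' s| * (1 + s) ≤ Cκ)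
    (hT : ∀ t, HasDerivAt T (T' t) t) (hT' : Continuous T') (hTb : ∀ t, |T t| ≤ CT)
    (hTb' : ∀ t, |T' t| ≤ CT) {ρ : H → ℝ} {R : H → H} (hρ : IsGrad μ e lam 1 ρ R) :
    ∫ x, (φ' (g x) * κ (‖F x‖ ^ 2) * T (ρ x) * ‖F x‖ ^ 2
      + φ (g x) * κ' (‖F x‖ ^ 2) * T (ρ x) * (2 * ⟪B x (F x), F x⟫)
      + φ (g x) * κ (‖F x‖ ^ 2) * T' (ρ x) * ⟪R x, F x⟫
      + φ (g x) * κ (‖F x‖ ^ 2) * T (ρ x) * (2 * u x)) ∂μ = 0 := by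
  obtain ⟨hρm, hRm, r₀, hr₀, hr₀ρ, hr₀R⟩ := hρ
  obtain ⟨ns, hns, hlim⟩ := exists_subseq_tendsto_ae one_ne_zero
    (fun n => (memLp_of_mem_expSpace (μ := μ) (hr₀ n) 1).1) hρm.1 hr₀ρ
  have hRlim := hr₀R.comp hns.tendsto_atTop
  set r := fun n => r₀ (ns n)
  have hr : ∀ n, r n ∈ expSpace H := fun n => hr₀ _
  have hφc : Continuous φ := continuous_iff_continuousAt.2 fun t => (hφ t).continuousAt
  have hκc : Continuous κ := continuous_iff_continuousAt.2 fun t => (hκ t).continuousAt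
  have hTc : Continuous T := continuous_iff_continuousAt.2 fun t => (hT t).continuousAt
  have hrc : ∀ n, Continuous (r n) := fun n => continuous_of_mem_expSpace (hr n)
  have hDc : ∀ n, Continuous (smoothGrad e lam (r n)) := fun n => continuous_smoothGrad hS (hr n)
  have hq : AEStronglyMeasurable (fun x => ‖F x‖ ^ 2) μ := hF.1.norm.pow 2
  have hCφ : 0 ≤ Cφ := (abs_nonneg _).trans (hφb 0)
  have hCT : 0 ≤ CT := (abs_nonneg _).trans (hTb 0)
  have hCκ : 0 ≤ Cκ := (by positivity : 0 ≤ |κ 0| * (1 + 0)).trans (hκb 0 le_rfl)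
  have hdecay : ∀ {f : ℝ → ℝ}, (∀ s, 0 ≤ s → |f s| * (1 + s) ≤ Cκ) → ∀ z : H,
      |f (‖z‖ ^ 2)| * ‖z‖ ≤ Cκ ∧ |f (‖z‖ ^ 2)| * 1 ≤ Cκ ∧ |f (‖z‖ ^ 2)| * ‖z‖ ^ 2 ≤ Cκ := by
    intro f hf z
    have h1 := hf (‖z‖ ^ 2) (sq_nonneg _)
    refine ⟨?_, ?_, ?_⟩ <;> refine le_trans (mul_le_mul_of_nonneg_left ?_ (abs_nonneg _)) h1
    · nlinarith [sq_nonneg (‖z‖ - 1), sq_nonneg ‖z‖]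
    · nlinarith [sq_nonneg ‖z‖]
    · linarith
  have a1 := hφ'.comp_aestronglyMeasurable hg
  have a2 := hφc.comp_aestronglyMeasurable hg
  have a3 := hκc.comp_aestronglyMeasurable hq
  have a4 := hκ'.comp_aestronglyMeasurable hq
  have hbi := hA.memLp_bound.integrable one_le_two
  have hui := (hu.integrable one_le_two).norm
  have hRi := (hRm.integrable le_rfl).norm
  refine integral_eq_zero_of_approx (μ := μ)
    (M := fun n x => φ' (g x) * κ (‖F x‖ ^ 2) * T (r n x) * ‖F x‖ ^ 2
      + φ (g x) * κ' (‖F x‖ ^ 2) * T (r n x) * (2 * ⟪B x (F x), F x⟫)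
      + φ (g x) * κ (‖F x‖ ^ 2) * T' (r n x) * ⟪R x, F x⟫
      + φ (g x) * κ (‖F x‖ ^ 2) * T (r n x) * (2 * u x))
    (E := fun n x => φ (g x) * κ (‖F x‖ ^ 2) * T' (r n x) *
      ⟪smoothGrad e lam (r n) x - R x, F x⟫)
    (bound := fun x => Cφ * Cκ * CT * 1 + Cφ * Cκ * CT * (2 * b x) +
      Cφ * Cκ * CT * ‖R x‖ + Cφ * Cκ * CT * (2 * ‖u x‖))
    (ε := fun n => ENNReal.ofReal (Cφ * Cκ * CT) *
      eLpNorm (fun x => smoothGrad e lam (r n) x - R x) 1 μ)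
    (fun n => ?_) (fun n => ?_) ?_ ?_ (fun n => ?_) (fun n => ?_) (fun n => ?_) ?_ (fun n => ?_)
  · have a5 := (hTc.comp (hrc n)).aestronglyMeasurable (μ := μ)
    have a6 := (hT'.comp (hrc n)).aestronglyMeasurable (μ := μ)
    exact ((((a1.mul a3).mul a5).mul hq).add
      (((a2.mul a4).mul a5).mul
        ((aestronglyMeasurable_inner_op e hA.measurable hF.1 hF.1).const_mul 2))).add
      (((a2.mul a3).mul a6).mul (hRm.1.inner hF.1)) |>.add
      (((a2.mul a3).mul a5).mul (hu.1.const_mul 2))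
  · filter_upwards [hA.bound] with x hx
    refine (abs_add_le _ _).trans (add_le_add ((abs_add_le _ _).trans (add_le_add
      ((abs_add_le _ _).trans (add_le_add ?_ ?_)) ?_)) ?_)
    · refine abs_mul_mul_mul_le (hφb' _) (hdecay hκb _).2.2 (hTb _) ?_ (sq_nonneg _) zero_le_one
      rw [mul_one, abs_of_nonneg (sq_nonneg _)]
    · refine abs_mul_mul_mul_le (hφb _) (hdecay hκb' _).2.2 (hTb _) ?_ (sq_nonneg ‖F x‖)
        (mul_nonneg zero_le_two (hA.bound_nonneg x))
      rw [abs_mul, abs_two]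
      linarith [hx (F x) (F x)]
    · refine abs_mul_mul_mul_le (hφb _) (hdecay hκb _).1 (hTb' _) ?_ (norm_nonneg (F x))
        (norm_nonneg _)
      rw [mul_comm]
      exact abs_real_inner_le_norm _ _
    · refine abs_mul_mul_mul_le (hφb _) (hdecay hκb _).2.1 (hTb _) ?_ zero_le_one (by positivity)
      rw [abs_mul, abs_two, one_mul, Real.norm_eq_abs]
  · exact (((integrable_const _).add ((hbi.const_mul 2).const_mul _)).add
      (hRi.const_mul _)).add ((hui.const_mul 2).const_mul _)
  · filter_upwards [hlim] with x h1
    have c1 := (hTc.tendsto _).comp h1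
    have c2 := (hT'.tendsto _).comp h1
    exact (((c1.const_mul _).mul_const _).add ((c1.const_mul _).mul_const _)).add
      ((c2.const_mul _).mul_const _) |>.add ((c1.const_mul _).mul_const _)
  · have a6 := (hT'.comp (hrc n)).aestronglyMeasurable (μ := μ)
    exact ((a2.mul a3).mul a6).mul (((hDc n).aestronglyMeasurable.sub hRm.1).inner hF.1)
  · rw [eLpNorm_one_eq_lintegral_enorm, ← lintegral_const_mul' _ _ ENNReal.ofReal_ne_top]
    refine lintegral_mono fun x => ?_
    rw [← ofReal_norm, ← ofReal_norm (_ - R x), ← ENNReal.ofReal_mul (by positivity),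
      Real.norm_eq_abs]
    refine ENNReal.ofReal_le_ofReal ?_
    refine abs_mul_mul_mul_le (hφb _) (hdecay hκb _).1 (hTb' _) ?_ (norm_nonneg (F x))
      (norm_nonneg _)
    rw [mul_comm]
    exact abs_real_inner_le_norm _ _
  · exact ENNReal.mul_ne_top ENNReal.ofReal_ne_top ((memLp_smoothGrad hS (hr n) 1).sub hRm).2.ne
  · have h1 := ENNReal.Tendsto.const_mul hRlim
      (Or.inr (ENNReal.ofReal_ne_top (r := Cφ * Cκ * CT)))
    simpa using h1
  · rw [← integral_eq_zero_of_unifGrad hS hA hF hu hibp hφ hφ' hφb hφb' hκ hκ' hκb hκb'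
      (UnifGrad.comp hS (hr n) hT hT')]
    refine integral_congr_ae (ae_of_all _ fun x => ?_)
    simp only [inner_smul_left, conj_trivial, inner_sub_left]
    ring

end Limits

/-! ### Regularizations of `1/s` and of the identity. -/

section Regularization

/-- The choice `κ(s) = s / (s² + ε)`: smooth at `0`, decaying like `1/s`, and tending to `1/s` for
`s > 0` as `ε → 0`. -/
theorem hasDerivAt_div_sq_add {ε : ℝ} (hε : 0 < ε) (s : ℝ) :
    HasDerivAt (fun s => s / (s ^ 2 + ε)) ((ε - s ^ 2) / (s ^ 2 + ε) ^ 2) s := by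
  have h1 : HasDerivAt (fun s : ℝ => s ^ 2 + ε) (2 * s) s := by
    simpa using (hasDerivAt_pow 2 s).add_const ε
  have h2 := (hasDerivAt_id s).fun_div h1 (by positivity)
  refine h2.congr_deriv ?_
  simp only [id]
  congr 1
  ring

theorem abs_div_sq_add_mul_le {ε : ℝ} (hε : 0 < ε) (hε1 : ε ≤ 1) {s : ℝ} (hs : 0 ≤ s) :
    |s / (s ^ 2 + ε)| * (1 + s) ≤ 2 / ε := by
  rw [abs_of_nonneg (by positivity), div_mul_eq_mul_div, div_le_div_iff₀ (by positivity) hε]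
  nlinarith [sq_nonneg (s - ε), mul_le_mul_of_nonneg_right hε1 (sq_nonneg s),
    mul_le_mul_of_nonneg_right hε1 hε.le]

theorem abs_deriv_div_sq_add_le {ε : ℝ} (hε : 0 < ε) (s : ℝ) :
    |(ε - s ^ 2) / (s ^ 2 + ε) ^ 2| ≤ 1 / (s ^ 2 + ε) := by
  have h : 0 < s ^ 2 + ε := by positivity
  rw [abs_div, abs_of_pos (pow_pos h 2), div_le_div_iff₀ (pow_pos h 2) h]
  have : |ε - s ^ 2| ≤ s ^ 2 + ε := abs_le.2 ⟨by linarith [sq_nonneg s], by linarith [sq_nonneg s]⟩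
  nlinarith

theorem abs_deriv_div_sq_add_mul_le {ε : ℝ} (hε : 0 < ε) (hε1 : ε ≤ 1) {s : ℝ} (hs : 0 ≤ s) :
    |(ε - s ^ 2) / (s ^ 2 + ε) ^ 2| * (1 + s) ≤ 2 / ε := by
  refine (mul_le_mul_of_nonneg_right (abs_deriv_div_sq_add_le hε s) (by positivity)).trans ?_
  rw [div_mul_eq_mul_div, div_le_div_iff₀ (by positivity) hε]
  nlinarith [sq_nonneg (s - ε), mul_le_mul_of_nonneg_right hε1 hε.le, sq_nonneg s]

/-- The choice `T(s) = s / (1 + δs²)`: bounded, with `|T(s)| ≤ |s|` and `|T'| ≤ 1`, and tending to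
the identity as `δ → 0`. -/
theorem hasDerivAt_div_one_add {δ : ℝ} (hδ : 0 < δ) (s : ℝ) :
    HasDerivAt (fun s => s / (1 + δ * s ^ 2)) ((1 - δ * s ^ 2) / (1 + δ * s ^ 2) ^ 2) s := by
  have h1 : HasDerivAt (fun s : ℝ => 1 + δ * s ^ 2) (δ * (2 * s)) s := by
    simpa using ((hasDerivAt_pow 2 s).const_mul δ).const_add 1
  have h2 := (hasDerivAt_id s).fun_div h1 (by positivity)
  refine h2.congr_deriv ?_
  simp only [id]
  congr 1
  ring

theorem abs_div_one_add_le_abs {δ : ℝ} (hδ : 0 < δ) (s : ℝ) : |s / (1 + δ * s ^ 2)| ≤ |s| := by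
  have h : 1 ≤ 1 + δ * s ^ 2 := by nlinarith [mul_nonneg hδ.le (sq_nonneg s)]
  rw [abs_div, abs_of_pos (zero_lt_one.trans_le h)]
  exact div_le_self (abs_nonneg _) h

theorem abs_div_one_add_le {δ : ℝ} (hδ : 0 < δ) (hδ1 : δ ≤ 1) (s : ℝ) :
    |s / (1 + δ * s ^ 2)| ≤ 1 / δ := by
  have h : 0 < 1 + δ * s ^ 2 := by positivity
  rw [abs_div, abs_of_pos h, div_le_div_iff₀ h hδ, ← sq_abs s]
  nlinarith [abs_nonneg s, sq_nonneg (|s| - 1), mul_nonneg hδ.le (sq_nonneg (|s| - 1)),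
    mul_nonneg hδ.le (abs_nonneg s)]

theorem abs_deriv_div_one_add_le {δ : ℝ} (hδ : 0 < δ) (s : ℝ) :
    |(1 - δ * s ^ 2) / (1 + δ * s ^ 2) ^ 2| ≤ 1 := by
  have h0 : 0 ≤ δ * s ^ 2 := by positivity
  have h1 : 0 < (1 + δ * s ^ 2) ^ 2 := by positivity
  rw [abs_div, abs_of_pos h1, div_le_one h1, abs_le]
  constructor <;> nlinarith

end Regularization

/-! ### The integration by parts formula with weight `ψ`. -/

section Formula

variable {H : Type*} [NormedAddCommGroup H] [InnerProductSpace ℝ H]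
  [MeasurableSpace H] [BorelSpace H] [SecondCountableTopology H] [CompleteSpace H]
  {ι : Type*} [Countable ι] {e : HilbertBasis ι ℝ H} {lam : ι → ℝ}
  {μ : Measure H} {S : H →L[ℝ] H} {g : H → ℝ} {F : H → H} {B : H → H →L[ℝ] H} {γ : ℕ → H → ℝ}
  {b : H → ℝ} {β : ℕ → H → ℝ} {u : H → ℝ} {φ φ' T T' : ℝ → ℝ} {Cφ CT : ℝ}

/-- Lets `κ(s) → 1/s`. The terms in `u` and `B` are dominated because `|F|⁻²` is in `L²`, the term
in `R` by the assumption on `‖R‖/‖F‖`. -/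
theorem integral_eq_zero_of_bounded [IsProbabilityMeasure μ] (hS : IsDiagSqrt e lam S)
    (hA : HessApprox μ e lam S g F B γ b β) (hg : AEStronglyMeasurable g μ)
    (hF : MemLp F 2 μ) (hu : MemLp u 2 μ)
    (hibp : ∀ w ∈ expSpace H, ∫ x, ⟪smoothGrad e lam w x, F x⟫ ∂μ = -∫ x, w x * (2 * u x) ∂μ)
    (hF0 : ∀ᵐ x ∂μ, F x ≠ 0) (hFinv : MemLp (fun x => (‖F x‖ ^ 2)⁻¹) 2 μ)
    (hφ : ∀ t, HasDerivAt φ (φ' t) t) (hφ' : Continuous φ') (hφb : ∀ t, |φ t| ≤ Cφ)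
    (hφb' : ∀ t, |φ' t| ≤ Cφ)
    (hT : ∀ t, HasDerivAt T (T' t) t) (hT' : Continuous T') (hTb : ∀ t, |T t| ≤ CT)
    (hTb' : ∀ t, |T' t| ≤ CT) {ρ : H → ℝ} {R : H → H} (hρ : IsGrad μ e lam 1 ρ R)
    (hR : Integrable (fun x => ‖R x‖ / ‖F x‖) μ) :
    ∫ x, (φ' (g x) * T (ρ x)
      + φ (g x) * T (ρ x) * (2 * (u x / ‖F x‖ ^ 2 - ⟪B x (F x), F x⟫ / ‖F x‖ ^ 4))
      + φ (g x) * T' (ρ x) * (⟪R x, F x⟫ / ‖F x‖ ^ 2)) ∂μ = 0 := by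
  have hφc : Continuous φ := continuous_iff_continuousAt.2 fun t => (hφ t).continuousAt
  have hTc : Continuous T := continuous_iff_continuousAt.2 fun t => (hT t).continuousAt
  have hq : AEStronglyMeasurable (fun x => ‖F x‖ ^ 2) μ := hF.1.norm.pow 2
  set ε : ℕ → ℝ := fun n => 1 / ((n : ℝ) + 1) with hε
  have hε0 : ∀ n, 0 < ε n := fun n => Nat.one_div_pos_of_nat
  have hε1 : ∀ n, ε n ≤ 1 := fun n => by
    rw [hε]; exact div_le_one_of_le₀ (by linarith [(Nat.cast_nonneg n : (0 : ℝ) ≤ n)]) (by positivity)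
  have hεlim : Tendsto ε atTop (𝓝 0) := tendsto_one_div_add_atTop_nhds_zero_nat
  have hκc : ∀ n, Continuous fun s : ℝ => s / (s ^ 2 + ε n) := fun n =>
    continuous_id.div (by fun_prop) fun s => by have := hε0 n; positivity
  have hκc' : ∀ n, Continuous fun s : ℝ => (ε n - s ^ 2) / (s ^ 2 + ε n) ^ 2 := fun n =>
    Continuous.div (by fun_prop) (by fun_prop) fun s => by have := hε0 n; positivity
  have hbq : Integrable (fun x => b x * (‖F x‖ ^ 2)⁻¹) μ := hA.memLp_bound.integrable_mul hFinv
  have huq : Integrable (fun x => ‖u x‖ * (‖F x‖ ^ 2)⁻¹) μ := hu.norm.integrable_mul hFinv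
  refine integral_eq_zero_of_approx (μ := μ)
    (M := fun n x => φ' (g x) * (‖F x‖ ^ 2 / ((‖F x‖ ^ 2) ^ 2 + ε n)) * T (ρ x) * ‖F x‖ ^ 2
      + φ (g x) * ((ε n - (‖F x‖ ^ 2) ^ 2) / ((‖F x‖ ^ 2) ^ 2 + ε n) ^ 2) * T (ρ x) *
        (2 * ⟪B x (F x), F x⟫)
      + φ (g x) * (‖F x‖ ^ 2 / ((‖F x‖ ^ 2) ^ 2 + ε n)) * T' (ρ x) * ⟪R x, F x⟫
      + φ (g x) * (‖F x‖ ^ 2 / ((‖F x‖ ^ 2) ^ 2 + ε n)) * T (ρ x) * (2 * u x))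
    (E := fun _ _ => 0) (ε := fun _ => 0)
    (bound := fun x => Cφ * 1 * CT * 1 + Cφ * 1 * CT * (2 * (b x * (‖F x‖ ^ 2)⁻¹)) +
      Cφ * 1 * CT * (‖R x‖ / ‖F x‖) + Cφ * 1 * CT * (2 * (‖u x‖ * (‖F x‖ ^ 2)⁻¹)))
    (fun n => ?_) (fun n => ?_) ?_ ?_ (fun n => aestronglyMeasurable_const) (fun n => by simp)
    (fun n => by simp) tendsto_const_nhds (fun n => ?_)
  · have a1 := hφ'.comp_aestronglyMeasurable hg
    have a2 := hφc.comp_aestronglyMeasurable hg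
    have a3 := (hκc n).comp_aestronglyMeasurable hq
    have a4 := (hκc' n).comp_aestronglyMeasurable hq
    have a5 := hTc.comp_aestronglyMeasurable hρ.1.1
    have a6 := hT'.comp_aestronglyMeasurable hρ.1.1
    exact ((((a1.mul a3).mul a5).mul hq).add
      (((a2.mul a4).mul a5).mul
        ((aestronglyMeasurable_inner_op e hA.measurable hF.1 hF.1).const_mul 2))).add
      (((a2.mul a3).mul a6).mul (hρ.2.1.1.inner hF.1)) |>.add
      (((a2.mul a3).mul a5).mul (hu.1.const_mul 2))
  · filter_upwards [hA.bound, hF0] with x hx hx0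
    have hn : 0 < ‖F x‖ := norm_pos_iff.2 hx0
    -- The bounds `s κ(s) ≤ 1` and `s² |κ'(s)| ≤ 1` do not depend on `ε`, unlike the decay constant
    -- `2/ε`.
    have k1 : |‖F x‖ ^ 2 / ((‖F x‖ ^ 2) ^ 2 + ε n)| * ‖F x‖ ^ 2 ≤ 1 := by
      have := hε0 n
      rw [abs_of_nonneg (by positivity), div_mul_eq_mul_div, div_le_one (by positivity)]
      nlinarith
    have k2 : |(ε n - (‖F x‖ ^ 2) ^ 2) / ((‖F x‖ ^ 2) ^ 2 + ε n) ^ 2| * (‖F x‖ ^ 2) ^ 2 ≤ 1 := by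
      have := hε0 n
      refine (mul_le_mul_of_nonneg_right (abs_deriv_div_sq_add_le this _) (by positivity)).trans ?_
      rw [div_mul_eq_mul_div, div_le_one (by positivity)]
      linarith
    refine (abs_add_le _ _).trans (add_le_add ((abs_add_le _ _).trans (add_le_add
      ((abs_add_le _ _).trans (add_le_add ?_ ?_)) ?_)) ?_)
    · refine abs_mul_mul_mul_le (hφb' _) k1 (hTb _) ?_ (sq_nonneg _) zero_le_one
      rw [mul_one, abs_of_nonneg (sq_nonneg _)]
    · refine abs_mul_mul_mul_le (hφb _) k2 (hTb _) ?_ (by positivity)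
        (mul_nonneg zero_le_two (mul_nonneg (hA.bound_nonneg x) (by positivity)))
      have e1 : (‖F x‖ ^ 2) ^ 2 * (2 * (b x * (‖F x‖ ^ 2)⁻¹)) = 2 * (b x * ‖F x‖ * ‖F x‖) := by
        field_simp
      rw [abs_mul, abs_two, e1]
      linarith [hx (F x) (F x)]
    · refine abs_mul_mul_mul_le (hφb _) k1 (hTb' _) ?_ (sq_nonneg _) (by positivity)
      have e1 : ‖F x‖ ^ 2 * (‖R x‖ / ‖F x‖) = ‖R x‖ * ‖F x‖ := by field_simp
      rw [e1]
      exact abs_real_inner_le_norm _ _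
    · refine abs_mul_mul_mul_le (hφb _) k1 (hTb _) ?_ (sq_nonneg _) (by positivity)
      have e1 : ‖F x‖ ^ 2 * (2 * (‖u x‖ * (‖F x‖ ^ 2)⁻¹)) = 2 * ‖u x‖ := by field_simp
      rw [abs_mul, abs_two, e1, Real.norm_eq_abs]
  · exact (((integrable_const _).add ((hbq.const_mul 2).const_mul _)).add
      (hR.const_mul _)).add ((huq.const_mul 2).const_mul _)
  · filter_upwards [hF0] with x hx0
    have hn : 0 < ‖F x‖ := norm_pos_iff.2 hx0
    have hq0 : (‖F x‖ ^ 2) ^ 2 + 0 ≠ 0 := by positivity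
    have k1 : Tendsto (fun n => ‖F x‖ ^ 2 / ((‖F x‖ ^ 2) ^ 2 + ε n)) atTop
        (𝓝 (‖F x‖ ^ 2 / ((‖F x‖ ^ 2) ^ 2 + 0))) :=
      tendsto_const_nhds.div (hεlim.const_add _) hq0
    have k2 : Tendsto (fun n => (ε n - (‖F x‖ ^ 2) ^ 2) / ((‖F x‖ ^ 2) ^ 2 + ε n) ^ 2) atTop
        (𝓝 ((0 - (‖F x‖ ^ 2) ^ 2) / ((‖F x‖ ^ 2) ^ 2 + 0) ^ 2)) :=
      (hεlim.sub_const _).div ((hεlim.const_add _).pow 2) (pow_ne_zero 2 hq0)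
    have hlim := ((((k1.const_mul (φ' (g x))).mul_const (T (ρ x))).mul_const (‖F x‖ ^ 2)).add
      (((k2.const_mul (φ (g x))).mul_const (T (ρ x))).mul_const (2 * ⟪B x (F x), F x⟫))).add
      (((k1.const_mul (φ (g x))).mul_const (T' (ρ x))).mul_const ⟪R x, F x⟫) |>.add
      (((k1.const_mul (φ (g x))).mul_const (T (ρ x))).mul_const (2 * u x))
    refine hlim.trans (le_of_eq ?_)
    congr 1
    field_simp
    ring
  · simp only [add_zero]
    exact integral_eq_zero_of_isGrad_one hS hA hg hF hu hibp hφ hφ' hφb hφb'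
      (fun s => hasDerivAt_div_sq_add (hε0 n) s) (hκc' n)
      (fun s hs => abs_div_sq_add_mul_le (hε0 n) (hε1 n) hs)
      (fun s hs => abs_deriv_div_sq_add_mul_le (hε0 n) (hε1 n) hs) hT hT' hTb hTb' hρ

/-- Integration by parts along `Q^{1/2} Dg / |Q^{1/2} Dg|²`, with `ψ` written out. -/
theorem integral_deriv_comp_mul_eq [IsProbabilityMeasure μ] (hS : IsDiagSqrt e lam S)
    (hA : HessApprox μ e lam S g F B γ b β) (hg : AEStronglyMeasurable g μ)
    (hF : MemLp F 2 μ) (hu : MemLp u 2 μ)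
    (hibp : ∀ w ∈ expSpace H, ∫ x, ⟪smoothGrad e lam w x, F x⟫ ∂μ = -∫ x, w x * (2 * u x) ∂μ)
    (hF0 : ∀ᵐ x ∂μ, F x ≠ 0) (hFinv : MemLp (fun x => (‖F x‖ ^ 2)⁻¹) 2 μ)
    (hφ : ∀ t, HasDerivAt φ (φ' t) t) (hφ' : Continuous φ') (hφb : ∀ t, |φ t| ≤ Cφ)
    (hφb' : ∀ t, |φ' t| ≤ Cφ) {ρ : H → ℝ} {R : H → H} (hρ : IsGrad μ e lam 1 ρ R)
    (hR : Integrable (fun x => ‖R x‖ / ‖F x‖) μ)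
    (hψ : Integrable (fun x => (u x / ‖F x‖ ^ 2 - ⟪B x (F x), F x⟫ / ‖F x‖ ^ 4) * ρ x) μ) :
    ∫ x, (φ' (g x) * ρ x + φ (g x) *
      (2 * ((u x / ‖F x‖ ^ 2 - ⟪B x (F x), F x⟫ / ‖F x‖ ^ 4) * ρ x) +
        ⟪R x, F x⟫ / ‖F x‖ ^ 2)) ∂μ = 0 := by
  have hφc : Continuous φ := continuous_iff_continuousAt.2 fun t => (hφ t).continuousAt
  have hCφ : 0 ≤ Cφ := (abs_nonneg _).trans (hφb 0)
  set δ : ℕ → ℝ := fun n => 1 / ((n : ℝ) + 1) with hδ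
  have hδ0 : ∀ n, 0 < δ n := fun n => Nat.one_div_pos_of_nat
  have hδ1 : ∀ n, δ n ≤ 1 := fun n => by
    rw [hδ]; exact div_le_one_of_le₀ (by linarith [(Nat.cast_nonneg n : (0 : ℝ) ≤ n)]) (by positivity)
  have hδlim : Tendsto δ atTop (𝓝 0) := tendsto_one_div_add_atTop_nhds_zero_nat
  have hTc : ∀ n, Continuous fun s : ℝ => s / (1 + δ n * s ^ 2) := fun n =>
    continuous_id.div (by fun_prop) fun s => by have := hδ0 n; positivity
  have hTc' : ∀ n, Continuous fun s : ℝ => (1 - δ n * s ^ 2) / (1 + δ n * s ^ 2) ^ 2 := fun n =>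
    Continuous.div (by fun_prop) (by fun_prop) fun s => by have := hδ0 n; positivity
  have hq : AEStronglyMeasurable (fun x => ‖F x‖) μ := hF.1.norm
  have hψm : AEStronglyMeasurable (fun x => u x / ‖F x‖ ^ 2 - ⟪B x (F x), F x⟫ / ‖F x‖ ^ 4) μ := by
    have h1 := aestronglyMeasurable_inner_op e hA.measurable hF.1 hF.1
    have h2 := (hq.aemeasurable.pow_const 2)
    have h4 := (hq.aemeasurable.pow_const 4)
    exact ((hu.1.aemeasurable.div h2).sub (h1.aemeasurable.div h4)).aestronglyMeasurable
  have hRFm : AEStronglyMeasurable (fun x => ⟪R x, F x⟫ / ‖F x‖ ^ 2) μ :=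
    ((hρ.2.1.1.inner hF.1).aemeasurable.div (hq.aemeasurable.pow_const 2)).aestronglyMeasurable
  have hρi := (hρ.1.integrable le_rfl).norm
  refine integral_eq_zero_of_approx (μ := μ)
    (M := fun n x => φ' (g x) * (ρ x / (1 + δ n * ρ x ^ 2))
      + φ (g x) * (ρ x / (1 + δ n * ρ x ^ 2)) *
        (2 * (u x / ‖F x‖ ^ 2 - ⟪B x (F x), F x⟫ / ‖F x‖ ^ 4))
      + φ (g x) * ((1 - δ n * ρ x ^ 2) / (1 + δ n * ρ x ^ 2) ^ 2) * (⟪R x, F x⟫ / ‖F x‖ ^ 2))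
    (E := fun _ _ => 0) (ε := fun _ => 0)
    (bound := fun x => Cφ * ‖ρ x‖ + Cφ * (2 *
      ‖(u x / ‖F x‖ ^ 2 - ⟪B x (F x), F x⟫ / ‖F x‖ ^ 4) * ρ x‖) + Cφ * (‖R x‖ / ‖F x‖))
    (fun n => ?_) (fun n => ?_) ?_ ?_ (fun n => aestronglyMeasurable_const) (fun n => by simp)
    (fun n => by simp) tendsto_const_nhds (fun n => ?_)
  · have a1 := hφ'.comp_aestronglyMeasurable hg
    have a2 := hφc.comp_aestronglyMeasurable hg
    have a5 := (hTc n).comp_aestronglyMeasurable hρ.1.1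
    have a6 := (hTc' n).comp_aestronglyMeasurable hρ.1.1
    exact ((a1.mul a5).add ((a2.mul a5).mul (hψm.const_mul 2))).add ((a2.mul a6).mul hRFm)
  · filter_upwards [hF0] with x hx0
    have hn : 0 < ‖F x‖ := norm_pos_iff.2 hx0
    have t1 := abs_div_one_add_le_abs (hδ0 n) (ρ x)
    have t2 := abs_deriv_div_one_add_le (hδ0 n) (ρ x)
    refine (abs_add_le _ _).trans (add_le_add ((abs_add_le _ _).trans (add_le_add ?_ ?_)) ?_)
    · rw [abs_mul, Real.norm_eq_abs]
      exact mul_le_mul (hφb' _) t1 (abs_nonneg _) hCφ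
    · rw [abs_mul, abs_mul, abs_mul, abs_two, norm_mul, Real.norm_eq_abs, Real.norm_eq_abs, mul_assoc]
      refine mul_le_mul (hφb _) ?_ (by positivity) hCφ
      calc _ ≤ |ρ x| * (2 * |u x / ‖F x‖ ^ 2 - ⟪B x (F x), F x⟫ / ‖F x‖ ^ 4|) := by gcongr
        _ = _ := by ring
    · rw [abs_mul, abs_mul, mul_assoc]
      refine mul_le_mul (hφb _) ?_ (by positivity) hCφ
      refine (mul_le_of_le_one_left (abs_nonneg _) t2).trans ?_
      rw [abs_div, abs_of_pos (pow_pos hn 2), div_le_div_iff₀ (pow_pos hn 2) hn]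
      have := mul_le_mul_of_nonneg_right (abs_real_inner_le_norm (R x) (F x)) hn.le
      linarith
  · exact ((hρi.const_mul _).add ((hψ.norm.const_mul 2).const_mul _)).add (hR.const_mul _)
  · refine ae_of_all _ fun x => ?_
    have h0 : Tendsto (fun n => 1 + δ n * ρ x ^ 2) atTop (𝓝 1) := by
      simpa using (hδlim.mul_const (ρ x ^ 2)).const_add 1
    have h1 : Tendsto (fun n => 1 - δ n * ρ x ^ 2) atTop (𝓝 1) := by
      simpa using (hδlim.mul_const (ρ x ^ 2)).const_sub 1
    have k1 : Tendsto (fun n => ρ x / (1 + δ n * ρ x ^ 2)) atTop (𝓝 (ρ x)) := by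
      have h := (tendsto_const_nhds (x := ρ x)).div h0 one_ne_zero
      rwa [div_one] at h
    have k2 : Tendsto (fun n => (1 - δ n * ρ x ^ 2) / (1 + δ n * ρ x ^ 2) ^ 2) atTop (𝓝 1) := by
      have h := h1.div (h0.pow 2) (by norm_num)
      rwa [one_pow, div_one] at h
    have hlim := ((k1.const_mul (φ' (g x))).add ((k1.const_mul (φ (g x))).mul_const
      (2 * (u x / ‖F x‖ ^ 2 - ⟪B x (F x), F x⟫ / ‖F x‖ ^ 4)))).add
      ((k2.const_mul (φ (g x))).mul_const (⟪R x, F x⟫ / ‖F x‖ ^ 2))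
    refine hlim.trans (le_of_eq ?_)
    congr 1
    ring
  · simp only [add_zero]
    -- One constant must bound both `T` and `T'`; `1/δ` serves since `δ ≤ 1`.
    have hCT : ∀ s : ℝ, |(1 - δ n * s ^ 2) / (1 + δ n * s ^ 2) ^ 2| ≤ 1 / δ n := fun s =>
      (abs_deriv_div_one_add_le (hδ0 n) s).trans ((one_le_div (hδ0 n)).2 (hδ1 n))
    exact integral_eq_zero_of_bounded hS hA hg hF hu hibp hF0 hFinv hφ hφ' hφb hφb'
      (fun s => hasDerivAt_div_one_add (hδ0 n) s) (hTc' n)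
      (fun s => abs_div_one_add_le (hδ0 n) (hδ1 n) s) hCT hρ hR

end Formula

/-! ### From the formula to vanishing on null sets. -/

section AbsolutelyContinuous

/-- If `∫ φ'(g) ρ dμ = -∫ φ(g) m dμ` for bounded `φ` with bounded continuous derivative, then the
image under `g` of `ρ μ` vanishes on Lebesgue null sets. -/
theorem setIntegral_preimage_eq_zero {X : Type*} [MeasurableSpace X] {μ : Measure X}
    {g ρ m : X → ℝ} (hg : Measurable g) (hρ : Integrable ρ μ) (hm : Integrable m μ)
    (h : ∀ (φ φ' : ℝ → ℝ) (C : ℝ), (∀ t, HasDerivAt φ (φ' t) t) → Continuous φ' →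
      (∀ t, |φ t| ≤ C) → (∀ t, |φ' t| ≤ C) → ∫ x, (φ' (g x) * ρ x + φ (g x) * m x) ∂μ = 0)
    {A : Set ℝ} (hA : MeasurableSet A) (hA0 : volume A = 0) : ∫ x in g ⁻¹' A, ρ x ∂μ = 0 := by
  have hρm : AEMeasurable (fun x => ‖ρ x‖ₑ) μ := hρ.1.enorm
  set ν : Measure ℝ := (μ.withDensity fun x => ‖ρ x‖ₑ).map g with hν
  have hfin : IsFiniteMeasure (μ.withDensity fun x => ‖ρ x‖ₑ) :=
    isFiniteMeasure_withDensity hρ.2.ne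
  have hνfin : IsFiniteMeasure ν := Measure.isFiniteMeasure_map _ _
  have hcpt : IsFiniteMeasureOnCompacts (ν + volume) := ⟨fun K hK => by
    rw [Measure.add_apply]
    exact ENNReal.add_lt_top.2 ⟨measure_lt_top _ _, hK.measure_lt_top⟩⟩
  set χ : ℝ → ℝ := A.indicator fun _ => 1 with hχ
  have hχi : Integrable χ (ν + volume) := by
    refine (integrable_indicator_iff hA).2 (integrableOn_const ?_)
    rw [Measure.add_apply, hA0, add_zero]
    exact measure_ne_top _ _
  have hχ0 : χ =ᵐ[volume] 0 := indicator_meas_zero hA0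
  refine abs_nonpos_iff.1 (le_of_forall_pos_le_add fun r hr => ?_)
  set M : ℝ := ∫ x, |m x| ∂μ with hM
  have hM0 : 0 ≤ M := integral_nonneg fun x => abs_nonneg _
  -- Chosen so that the two errors `ε` and `εM` add up to `r`.
  set ε : ℝ := r / (1 + M) with hε
  have hεpos : 0 < ε := by positivity
  -- A single `f` approximates `1_A` for `ν` and for Lebesgue measure. As `A` is Lebesgue null, this
  -- forces `∫ |f| dt ≤ ε`, so the primitive of `f` is bounded by `ε`.
  obtain ⟨f, hfs, hfε, hfc, hfi⟩ := hχi.exists_hasCompactSupport_integral_sub_le hεpos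
  have hdi := integrable_add_measure.1 (hχi.sub hfi).norm
  have hsum := integral_add_measure hdi.1 hdi.2
  simp only [Pi.sub_apply] at hsum hdi
  rw [hsum] at hfε
  have hfvol : Integrable f volume := (integrable_add_measure.1 hfi).2
  have hn1 : 0 ≤ ∫ t, ‖χ t - f t‖ ∂ν := integral_nonneg fun t => norm_nonneg _
  have hvol : ∫ t, ‖χ t - f t‖ = ∫ t, ‖f t‖ := by
    refine integral_congr_ae (hχ0.mono fun t ht => ?_)
    simp only [ht, Pi.zero_apply, zero_sub, norm_neg]
  have hn2 : 0 ≤ ∫ t, ‖f t‖ := integral_nonneg fun t => norm_nonneg _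
  rw [hvol] at hfε
  have hνint : ∫ t, ‖χ t - f t‖ ∂ν = ∫ x, ‖ρ x‖ * ‖χ (g x) - f (g x)‖ ∂μ := by
    rw [hν, integral_map hg.aemeasurable,
      integral_withDensity_eq_integral_toReal_smul₀ hρm (ae_of_all _ fun x => enorm_lt_top)]
    · simp only [toReal_enorm, smul_eq_mul]
    · exact (((measurable_const.indicator hA).sub hfc.measurable).norm).aestronglyMeasurable
  obtain ⟨K, hK⟩ := hfc.bounded_above_of_compact_support hfs
  have hφb : ∀ t, |∫ s in (0 : ℝ)..t, f s| ≤ ε := fun t => by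
    refine (intervalIntegral.norm_integral_le_integral_norm_uIoc (f := f) (μ := volume)).trans
      ((setIntegral_le_integral hfvol.norm (ae_of_all _ fun s => norm_nonneg _)).trans ?_)
    linarith
  have hφd : ∀ t, HasDerivAt (fun t => ∫ s in (0 : ℝ)..t, f s) (f t) t := fun t =>
    intervalIntegral.integral_hasDerivAt_right (hfc.intervalIntegrable _ _)
      (hfc.stronglyMeasurableAtFilter _ _) hfc.continuousAt
  have hφc : Continuous fun t => ∫ s in (0 : ℝ)..t, f s :=
    continuous_iff_continuousAt.2 fun t => (hφd t).continuousAt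
  have key := h _ f (max ε K) hφd hfc (fun t => (hφb t).trans (le_max_left _ _))
    fun t => (hK t).trans (le_max_right _ _)
  have i1 : Integrable (fun x => f (g x) * ρ x) μ :=
    hρ.bdd_mul (hfc.measurable.comp hg).aestronglyMeasurable (ae_of_all _ fun x => hK (g x))
  have i2 : Integrable (fun x => (∫ s in (0 : ℝ)..g x, f s) * m x) μ :=
    hm.bdd_mul (hφc.measurable.comp hg).aestronglyMeasurable (ae_of_all _ fun x => hφb (g x))
  have hχρ : (fun x => χ (g x) * ρ x) = (g ⁻¹' A).indicator ρ := by
    funext x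
    by_cases hx : g x ∈ A <;> simp [hχ, hx]
  have i3 : Integrable (fun x => χ (g x) * ρ x) μ := hχρ ▸ hρ.indicator (hg hA)
  rw [integral_add i1 i2] at key
  have hsplit : ∫ x in g ⁻¹' A, ρ x ∂μ = ∫ x, (χ (g x) - f (g x)) * ρ x ∂μ
      - ∫ x, (∫ s in (0 : ℝ)..g x, f s) * m x ∂μ := by
    simp_rw [sub_mul]
    rw [integral_sub i3 i1, ← integral_indicator (hg hA), ← hχρ]
    linarith
  have b1 : |∫ x, (χ (g x) - f (g x)) * ρ x ∂μ| ≤ ∫ t, ‖χ t - f t‖ ∂ν := by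
    rw [hνint, ← Real.norm_eq_abs]
    refine (norm_integral_le_integral_norm _).trans_eq (integral_congr_ae (ae_of_all _ fun x => ?_))
    simp only [norm_mul, mul_comm]
  have b2 : |∫ x, (∫ s in (0 : ℝ)..g x, f s) * m x ∂μ| ≤ ε * M := by
    rw [hM, ← integral_const_mul, ← Real.norm_eq_abs]
    refine (norm_integral_le_integral_norm _).trans
      (integral_mono i2.norm (hm.abs.const_mul _) fun x => ?_)
    simp only [norm_mul, Real.norm_eq_abs]
    exact mul_le_mul_of_nonneg_right (hφb _) (abs_nonneg _)
  have hr' : ε + ε * M = r := by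
    rw [hε]; field_simp
  rw [hsplit, zero_add]
  have := abs_sub (∫ x, (χ (g x) - f (g x)) * ρ x ∂μ) (∫ x, (∫ s in (0 : ℝ)..g x, f s) * m x ∂μ)
  linarith

end AbsolutelyContinuous

/-! ### Properties of the chosen gradient, Hessian and generator. -/

section Existence

variable {H : Type*} [NormedAddCommGroup H] [InnerProductSpace ℝ H] [MeasurableSpace H]
  {ι : Type*} {e : HilbertBasis ι ℝ H} {lam : ι → ℝ} {μ : Measure H} {g : H → ℝ}

theorem MemW1.isGrad_grad {p : ℝ≥0∞} (h : MemW1 μ e lam p g) :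
    IsGrad μ e lam p g (grad μ e lam p g) := by
  rw [grad, dif_pos h]
  exact h.choose_spec

theorem isHess_hess (h : ∃ B, IsHess μ e lam g B) : IsHess μ e lam g (hess μ e lam g) := by
  rw [hess, dif_pos h]
  exact h.choose_spec

theorem MemDomL0.isL0_L0 (h : MemDomL0 μ e lam g) : IsL0 μ e lam g (L0 μ e lam g) := by
  rw [L0, dif_pos h]
  exact h.choose_spec

/-- Supplies `ρ = 1` for part (a). -/
theorem isGrad_one_zero [IsFiniteMeasure μ] (p : ℝ≥0∞) :
    IsGrad μ e lam p (fun _ => 1) (fun _ => 0) := by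
  refine ⟨memLp_const _, memLp_const _, fun _ _ => 1, fun _ => one_mem_expSpace, ?_, ?_⟩
  · simp
  · simp [smoothGrad]

theorem HessApprox.congr_grad {S : H →L[ℝ] H} {F F' : H → H} {B : H → H →L[ℝ] H} {γ : ℕ → H → ℝ}
    {b : H → ℝ} {β : ℕ → H → ℝ} [BorelSpace H] [CompleteSpace H] [SecondCountableTopology H]
    (hA : HessApprox μ e lam S g F B γ b β) (h : F =ᵐ[μ] F') :
    HessApprox μ e lam S g F' B γ b β :=
  { hA with
    tendsto_grad := by
      filter_upwards [hA.tendsto_grad, h] with x hx hxF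
      rwa [← hxF] }

end Existence

/-! ### Consequences of the integrability of `|F|⁻¹`. -/

section Inverse

variable {X E : Type*} [MeasurableSpace X] {μ : Measure X} [NormedAddCommGroup E] {F : X → E}

theorem lintegral_enorm_inv_lt_top (h : MemLp (fun x => ‖F x‖ₑ⁻¹) 4 μ) :
    ∫⁻ x, ‖F x‖ₑ⁻¹ ^ 4 ∂μ < ∞ := by
  have := eLpNorm_nnreal_pow_eq_lintegral (μ := μ) (f := fun x => ‖F x‖ₑ⁻¹) (p := 4) (by norm_num)
  simp only [enorm_eq_self, NNReal.coe_ofNat, ENNReal.coe_ofNat, ENNReal.rpow_ofNat] at this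
  exact this.symm.trans_lt (ENNReal.pow_lt_top h.2)

/-- In `ℝ≥0∞` the inverse of `0` is `∞`, so integrability excludes zeros of `F` up to a null set.
From then on the real inverse, with `0⁻¹ = 0`, can be used. -/
theorem ae_ne_zero_of_memLp_enorm_inv (h : MemLp (fun x => ‖F x‖ₑ⁻¹) 4 μ) :
    ∀ᵐ x ∂μ, F x ≠ 0 := by
  filter_upwards [ae_lt_top' (h.1.aemeasurable.pow_const 4) (lintegral_enorm_inv_lt_top h).ne]
    with x hx hx0
  simp [hx0] at hx

theorem memLp_norm_sq_inv (hF : AEStronglyMeasurable F μ) (h : MemLp (fun x => ‖F x‖ₑ⁻¹) 4 μ) :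
    MemLp (fun x => (‖F x‖ ^ 2)⁻¹) 2 μ := by
  refine ⟨(hF.norm.aemeasurable.pow_const 2).inv.aestronglyMeasurable, ?_⟩
  refine (ENNReal.pow_lt_top_iff.1 ?_).resolve_right two_ne_zero
  rw [eLpNorm_two_sq]
  refine lt_of_eq_of_lt (lintegral_congr_ae ?_) (lintegral_enorm_inv_lt_top h)
  filter_upwards [ae_ne_zero_of_memLp_enorm_inv h] with x hx
  have hn : ‖F x‖ ^ 2 ≠ 0 := pow_ne_zero _ (norm_ne_zero_iff.2 hx)
  rw [enorm_inv hn, enorm_pow, enorm_norm, ENNReal.inv_pow, ← pow_mul]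

end Inverse

end GaussHilbert

/-! ### Proof of the theorem. -/

theorem propositionA1 {H : Type*} [NormedAddCommGroup H] [InnerProductSpace ℝ H]
    [CompleteSpace H] [TopologicalSpace.SeparableSpace H] [MeasurableSpace H] [BorelSpace H]
    (Q : H →L[ℝ] H) (hQsymm : Q.IsSymmetric) (hQpos : ∀ x : H, x ≠ 0 → 0 < ⟪Q x, x⟫)
    {ι : Type*} (e : HilbertBasis ι ℝ H) (lam : ι → ℝ) (hQe : ∀ k, Q (e k) = lam k • e k)
    (hQtrace : Summable (fun k => ⟪Q (e k), e k⟫))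
    (μ : Measure H) (hμ : GaussHilbert.IsCenteredGaussian μ Q)
    (g : H → ℝ) (hg : Measurable g) (hgL : GaussHilbert.MemDomL0 μ e lam g)
    (hgrad : MemLp (fun x => ‖GaussHilbert.grad μ e lam 2 g x‖ₑ⁻¹) 4 μ) :
    μ.map g ≪ (volume : Measure ℝ) ∧
    ∀ ρ : H → ℝ, GaussHilbert.MemW1 μ e lam 1 ρ →
      Integrable (fun x => GaussHilbert.psi μ e lam g x * ρ x) μ →
      Integrable (fun x =>
        ‖GaussHilbert.grad μ e lam 1 ρ x‖ / ‖GaussHilbert.grad μ e lam 2 g x‖) μ →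
      VectorMeasure.AbsolutelyContinuous ((μ.withDensityᵥ ρ).map g)
        (volume : Measure ℝ).toENNRealVectorMeasure := by
  open GaussHilbert in
  have : SecondCountableTopology H := UniformSpace.secondCountable_of_separable H
  have hlam : ∀ k, ⟪Q (e k), e k⟫ = lam k := fun k => by
    rw [hQe, real_inner_smul_left, real_inner_self_eq_norm_sq, e.orthonormal.1 k, one_pow, mul_one]
  have hpos' : ∀ k, 0 < lam k := fun k => hlam k ▸ hQpos _ (e.orthonormal.ne_zero k)
  have hpos : ∀ k, 0 ≤ lam k := fun k => (hpos' k).le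
  simp_rw [hlam] at hQtrace
  -- All `λ_k` are positive and summable, and a summable family has countable support.
  have hι : Countable ι := by
    have h := hQtrace.countable_support
    rwa [Function.support_eq_univ fun k => (hpos' k).ne', Set.countable_univ_iff] at h
  obtain ⟨S, hS⟩ := exists_isDiagSqrt e hQtrace hpos
  have hG := hμ.hasGaussianCharFun (hS.inner_inner hpos hQe)
  have hprob := hG.isProb
  have hL := hgL.isL0_L0
  obtain ⟨F₁, B₁, hF₁, hB₁, hibp⟩ := hG.exists_isHess_of_isL0 hS hpos hL
  obtain ⟨F₂, γ, b, β, hF₂, hA⟩ := exists_hessApprox hS (isHess_hess ⟨B₁, hB₁⟩)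
  have hF : IsGrad μ e lam 2 g (grad μ e lam 2 g) := MemW1.isGrad_grad ⟨F₁, hF₁⟩
  -- `hess`, `L0` and `grad` come from separate choices of limits; closability identifies the
  -- gradients involved.
  replace hA := hA.congr_grad (hG.isGrad_unique hS hpos hF₂ hF)
  replace hibp : ∀ w ∈ expSpace H, ∫ x, ⟪smoothGrad e lam w x, grad μ e lam 2 g x⟫ ∂μ =
      -∫ x, w x * (2 * L0 μ e lam g x) ∂μ := fun w hw => by
    rw [← hibp w hw]
    refine integral_congr_ae ?_
    filter_upwards [hG.isGrad_unique hS hpos hF hF₁] with x hx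
    rw [hx]
  have hF0 := ae_ne_zero_of_memLp_enorm_inv hgrad
  have hFinv := memLp_norm_sq_inv hF.2.1.1 hgrad
  have main : ∀ (ρ : H → ℝ) (R : H → H), IsGrad μ e lam 1 ρ R →
      Integrable (fun x => ‖R x‖ / ‖grad μ e lam 2 g x‖) μ →
      Integrable (fun x => psi μ e lam g x * ρ x) μ → ∀ A : Set ℝ, MeasurableSet A →
      volume A = 0 → ∫ x in g ⁻¹' A, ρ x ∂μ = 0 := by
    intro ρ R hρ hR hψ A hA' hA0
    -- Here `m = 2ψρ + ⟨R, F⟩ / |F|²`; its second term is dominated by `‖R‖ / ‖F‖`.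
    refine setIntegral_preimage_eq_zero hg (memLp_one_iff_integrable.1 hρ.1)
      (((hψ.const_mul 2).add ?_ : Integrable (fun x => 2 * (psi μ e lam g x * ρ x) +
        ⟪R x, grad μ e lam 2 g x⟫ / ‖grad μ e lam 2 g x‖ ^ 2) μ))
      (fun φ φ' C hφ hφ' hφb hφb' => integral_deriv_comp_mul_eq hS hA hg.aestronglyMeasurable
        hF.2.1 hL.2.1 hibp hF0 hFinv hφ hφ' hφb hφb' hρ hR hψ) hA' hA0
    refine hR.mono ((hρ.2.1.1.inner hF.2.1.1).div₀ (hF.2.1.1.norm.pow 2)) ?_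
    filter_upwards [hF0] with x hx
    have hn : 0 < ‖grad μ e lam 2 g x‖ := norm_pos_iff.2 hx
    rw [norm_div, norm_div, norm_pow, norm_norm, norm_norm, Real.norm_eq_abs,
      div_le_div_iff₀ (pow_pos hn 2) hn]
    have := mul_le_mul_of_nonneg_right (abs_real_inner_le_norm (R x) (grad μ e lam 2 g x)) hn.le
    linarith
  constructor
  · refine Measure.AbsolutelyContinuous.mk fun A hA' hA0 => ?_
    -- Each term of `ψ` is bounded by a product of two `L²` functions, one of them `|F|⁻²`; the
    -- other is `L₀g` or the bound `b` of the Hessian.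
    have hψ : Integrable (fun x => psi μ e lam g x * 1) μ := by
      simp only [mul_one]
      refine ((hL.2.1.integrable_mul hFinv).congr (ae_of_all _ fun x =>
        (div_eq_mul_inv _ _).symm)).sub ((hA.memLp_bound.integrable_mul hFinv).mono
          ((aestronglyMeasurable_inner_op e hA.measurable hF.2.1.1 hF.2.1.1).div₀
            (hF.2.1.1.norm.pow 4)) ?_)
      filter_upwards [hF0, hA.bound] with x hx hb
      have hn : 0 < ‖grad μ e lam 2 g x‖ := norm_pos_iff.2 hx
      rw [Pi.mul_apply, ← div_eq_mul_inv, Real.norm_of_nonneg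
        (div_nonneg (hA.bound_nonneg x) (sq_nonneg _)), norm_div, norm_pow, norm_norm,
        Real.norm_eq_abs, div_le_div_iff₀ (pow_pos hn 4) (pow_pos hn 2)]
      refine (mul_le_mul_of_nonneg_right (hb _ _) (sq_nonneg _)).trans_eq (by ring)
    have h := main (fun _ => 1) (fun _ => 0) (isGrad_one_zero 1) (by simp) hψ A hA' hA0
    rw [Measure.map_apply hg hA']
    simpa [Measure.real, ENNReal.toReal_eq_zero_iff] using h
  · intro ρ hρ hψ hR
    refine VectorMeasure.AbsolutelyContinuous.mk fun A hA' hA0 => ?_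
    rw [Measure.toENNRealVectorMeasure_apply_measurable hA'] at hA0
    rw [VectorMeasure.map_apply _ hg hA',
      withDensityᵥ_apply (memLp_one_iff_integrable.1 hρ.isGrad_grad.1) (hg hA')]
    exact main ρ _ hρ.isGrad_grad hR hψ A hA' hA0
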